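/- Work over $\mathbb F_2=\mathbb Z/2\mathbb Z$, with cohomological gradings. Let $\mathfrak{sl}_2(\wedge)_{dg}$ be the $\mathbb Z$-graded Lie superalgebra with basis $e,f,h$ (degree $0$), $v_2,v_{-2},\tilde v_0,d,D$ (degree $1$), $x$ (degree $2$), whose only nonzero brackets of basis elements over $\mathbb F_2$ are, up to symmetry, $[e,f]=h$, $[e,v_{-2}]=[f,v_2]=\tilde v_0$, $[v_2,v_{-2}]=[d,D]=x$. View it as an $L_\infty$-algebra with $l_1=[d,\cdot\,]$, $l_2=[\cdot,\cdot]$ and $l_n=0$ for $n\ge 3$. For a diagram $P$ of an oriented link in the thickened annulus, let $\mathrm{CKh}(P)$ be the $\mathbb F_2$-vector space on the Kauffman states of $P$ whose circles are labelled $+$ or $-$, with its homological grading and its $k$-grading (the number of nontrivial circles labelled $+$ minus the number of those labelled $-$). Let $\partial=\partial_0+\partial_-$ be the decomposition of the Khovanov differential into its $k$-preserving and $k$-decreasing parts, and $\partial^{Lee}=\partial_0^{Lee}+\partial_+^{Lee}$ that of the Lee differential (merge $-\otimes-\mapsto +$, split $-\mapsto +\otimes+$, and $0$ otherwise) into its $k$-preserving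 and $k$-increasing parts. Put $k_1=\partial_0$, let $k_2$ be the action in which $e,f,h$ act on every nontrivial circle as on the defining representation of $\mathfrak{sl}_2$ and on every trivial circle trivially, $v_2,v_{-2},d,D$ act by $\partial_+^{Lee},\partial_-,\partial_0,\partial_0^{Lee}$, and $\tilde v_0=[e,v_{-2}]$, $x=[v_2,v_{-2}]$ act by the corresponding commutators, and let $k_n=0$ for $n\ge 3$. **Theorem.** Let $P$ be a diagram of an oriented annular link, and let $P'$ be obtained from $P$ by a Reidemeister I move that adds a kink (a positive or a negative crossing, passed first over or first under, on any edge). Then $\mathrm{CKh}(P)$ and $\mathrm{CKh}(P')$, with the above operations, are $L_\infty$-modules over $\mathfrak{sl}_2(\wedge)_{dg}$, and they are $L_\infty$-quasi-isomorphic: there is an $L_\infty$-module homomorphism whose first component induces an isomorphism on homology (with respect to $\partial_0$), from $\mathrm{CKh}(P')$ to $\mathrm{CKh}(P)$ if the new crossing is positive, and from $\mathrm{CKh}(P)$ to $\mathrm{CKh}(P')$ if it is negative. -/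

import Mathlib

noncomputable section

open scoped Classical

namespace AnnularKh

/-! ## `L∞`-algebras, `L∞`-modules and their homomorphisms over `𝔽₂`

Cohomological grading conventions are used.  All signs are trivial, since the ground field has
characteristic two; in particular skew-symmetric means symmetric.  A sum over the
`(i, n - i)`-unshuffles `σ` of `n` inputs is written as a sum over the set
`S = {σ(1), …, σ(i)}`, which determines the unshuffle. -/

/-- The entries of `x` with index in `S`, in increasing order of the index. -/
def pick {α : Type*} {n : ℕ} (S : Finset (Fin n)) (x : Fin n → α) : Fin S.card → α :=
  fun j => x (S.orderEmbOfFin rfl j)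

/-- Operations on a `ℤ`-graded `𝔽₂`-vector space `V`: `l n` takes `n` inputs (only `n ≥ 1` is
used). -/
structure AlgOps (V : Type*) [AddCommGroup V] [Module (ZMod 2) V] where
  gr : ℤ → Submodule (ZMod 2) V
  l : ∀ n : ℕ, MultilinearMap (ZMod 2) (fun _ : Fin n => V) V

/-- Operations with `n` inputs from `V` and one input from `M`, and with values in `M'`. -/
abbrev MixedOps (V M M' : Type*) [AddCommGroup V] [Module (ZMod 2) V]
    [AddCommGroup M] [Module (ZMod 2) M] [AddCommGroup M'] [Module (ZMod 2) M'] : Type _ :=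
  ∀ n : ℕ, MultilinearMap (ZMod 2) (fun _ : Fin n => V) (M →ₗ[ZMod 2] M')

/-- Operations on a `ℤ`-graded `𝔽₂`-vector space `M` with further inputs from `V`.  Here `k n` is
the operation `k_{n+1} : V^{⊗ n} ⊗ M → M`. -/
structure ModOps (V M : Type*) [AddCommGroup V] [Module (ZMod 2) V]
    [AddCommGroup M] [Module (ZMod 2) M] where
  gr : ℤ → Submodule (ZMod 2) M
  k : MixedOps V M M

section LInfinity

variable {V M M' : Type*} [AddCommGroup V] [Module (ZMod 2) V]
  [AddCommGroup M] [Module (ZMod 2) M] [AddCommGroup M'] [Module (ZMod 2) M']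

/-- `A` is an `L∞`-algebra. -/
structure IsLInfAlgebra (A : AlgOps V) : Prop where
  graded : DirectSum.IsInternal A.gr
  symm : ∀ (n : ℕ) (σ : Equiv.Perm (Fin n)) (x : Fin n → V), A.l n (x ∘ σ) = A.l n x
  degree : ∀ n : ℕ, 1 ≤ n → ∀ (a : Fin n → ℤ) (x : Fin n → V), (∀ i, x i ∈ A.gr (a i)) →
    A.l n x ∈ A.gr ((∑ i, a i) + 2 - n)
  /-- The generalized Jacobi identity. -/
  jacobi : ∀ n : ℕ, 1 ≤ n → ∀ x : Fin n → V,
    ∑ S : Finset (Fin n) with S.Nonempty,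
      A.l (Sᶜ.card + 1) (Fin.cons (A.l S.card (pick S x)) (pick Sᶜ x)) = 0

/-- `K` is an `L∞`-module over the `L∞`-algebra `A`. -/
structure IsLInfModule (A : AlgOps V) (K : ModOps V M) : Prop where
  isLInfAlgebra : IsLInfAlgebra A
  graded : DirectSum.IsInternal K.gr
  symm : ∀ (n : ℕ) (σ : Equiv.Perm (Fin n)) (x : Fin n → V), K.k n (x ∘ σ) = K.k n x
  /-- `k_{n+1}` has degree `2 - (n + 1) = 1 - n`. -/
  degree : ∀ (n : ℕ) (a : Fin n → ℤ) (b : ℤ) (x : Fin n → V) (m : M),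
    (∀ i, x i ∈ A.gr (a i)) → m ∈ K.gr b → K.k n x m ∈ K.gr ((∑ i, a i) + b + 1 - n)
  relation : ∀ (n : ℕ) (x : Fin n → V) (m : M),
    (∑ S : Finset (Fin n) with S.Nonempty,
      K.k (Sᶜ.card + 1) (Fin.cons (A.l S.card (pick S x)) (pick Sᶜ x)) m) +
    (∑ S : Finset (Fin n), K.k Sᶜ.card (pick Sᶜ x) (K.k S.card (pick S x) m)) = 0

/-- `h` is an `L∞`-module homomorphism from `K` to `K'`.  Here `h n` is the component
`h_{n+1} : V^{⊗ n} ⊗ M → M'`. -/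
structure IsLInfHom (A : AlgOps V) (K : ModOps V M) (K' : ModOps V M')
    (h : MixedOps V M M') : Prop where
  symm : ∀ (n : ℕ) (σ : Equiv.Perm (Fin n)) (x : Fin n → V), h n (x ∘ σ) = h n x
  /-- `h_{n+1}` has degree `1 - (n + 1) = - n`. -/
  degree : ∀ (n : ℕ) (a : Fin n → ℤ) (b : ℤ) (x : Fin n → V) (m : M),
    (∀ i, x i ∈ A.gr (a i)) → m ∈ K.gr b → h n x m ∈ K'.gr ((∑ i, a i) + b - n)
  relation : ∀ (n : ℕ) (x : Fin n → V) (m : M),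
    (∑ S : Finset (Fin n) with S.Nonempty,
      h (Sᶜ.card + 1) (Fin.cons (A.l S.card (pick S x)) (pick Sᶜ x)) m) +
    (∑ S : Finset (Fin n), h Sᶜ.card (pick Sᶜ x) (K.k S.card (pick S x) m)) +
    (∑ S : Finset (Fin n), K'.k Sᶜ.card (pick Sᶜ x) (h S.card (pick S x) m)) = 0

/-- The homology `ker d / im d` of a differential `d`. -/
abbrev Homology (d : M →ₗ[ZMod 2] M) : Type _ :=
  LinearMap.ker d ⧸ (LinearMap.range d).submoduleOf (LinearMap.ker d)

/-- The map induced on homology by a linear map commuting with the differentials. -/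
def homologyMap {d : M →ₗ[ZMod 2] M} {d' : M' →ₗ[ZMod 2] M'} (f : M →ₗ[ZMod 2] M')
    (hf : ∀ m, f (d m) = d' (f m)) : Homology d →ₗ[ZMod 2] Homology d' :=
  Submodule.mapQ _ _
    (f.restrict (p := LinearMap.ker d) (q := LinearMap.ker d') (by
      intro m hm
      rw [LinearMap.mem_ker] at hm ⊢
      rw [← hf, hm, map_zero]))
    (by
      rintro ⟨m, hm⟩ hr
      obtain ⟨y, hy⟩ := hr
      exact ⟨f y, by rw [← hf, hy]; rfl⟩)

/-- `h` is an `L∞`-quasi-isomorphism: an `L∞`-module homomorphism whose first component `h_1`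
induces an isomorphism on the homology with respect to the differentials `k_1`. -/
def IsLInfQuasiIso (A : AlgOps V) (K : ModOps V M) (K' : ModOps V M')
    (h : MixedOps V M M') : Prop :=
  IsLInfHom A K K' h ∧
    ∃ hf : ∀ m, h 0 ![] (K.k 0 ![] m) = K'.k 0 ![] (h 0 ![] m),
      Function.Bijective (homologyMap (h 0 ![]) hf)

end LInfinity

/-- The grading on the space with basis `ι` in which the basis element `b` has degree `deg b`. -/
def basisGrading {ι : Type*} (deg : ι → ℤ) (i : ℤ) : Submodule (ZMod 2) (ι → ZMod 2) where
  carrier := {v | ∀ b, v b ≠ 0 → deg b = i}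
  zero_mem' := fun b hb => absurd rfl hb
  add_mem' := by
    intro u v hu hv b hb
    by_cases h : u b = 0
    · exact hv b (by simpa [h] using hb)
    · exact hu b h
  smul_mem' := by
    intro c v hv b hb
    exact hv b (fun h => hb (by simp [h]))

/-! ## The Lie superalgebra `sl₂(∧)_dg` -/

/-- The basis of `sl₂(∧)_dg`. -/
inductive SlBasis : Type
  | e | f | h | v2 | vm2 | v0 | d | D | x
  deriving DecidableEq

namespace SlBasis

instance : Fintype SlBasis :=
  ⟨{e, f, h, v2, vm2, v0, d, D, x}, by intro b; cases b <;> simp⟩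

def degree : SlBasis → ℤ
  | e => 0
  | f => 0
  | h => 0
  | v2 => 1
  | vm2 => 1
  | v0 => 1
  | d => 1
  | D => 1
  | x => 2

/-- The integral bracket of two basis elements, in coordinates. -/
def bracket : SlBasis → SlBasis → SlBasis → ℤ
  | e, f => Pi.single h 1
  | f, e => Pi.single h (-1)
  | h, e => Pi.single e 2
  | e, h => Pi.single e (-2)
  | h, f => Pi.single f (-2)
  | f, h => Pi.single f 2
  | h, v2 => Pi.single v2 2
  | v2, h => Pi.single v2 (-2)
  | h, vm2 => Pi.single vm2 (-2)
  | vm2, h => Pi.single vm2 2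
  | e, vm2 => Pi.single v0 1
  | vm2, e => Pi.single v0 (-1)
  | f, v2 => Pi.single v0 (-1)
  | v2, f => Pi.single v0 1
  | e, v0 => Pi.single v2 (-2)
  | v0, e => Pi.single v2 2
  | f, v0 => Pi.single vm2 2
  | v0, f => Pi.single vm2 (-2)
  | v2, vm2 => Pi.single x 1
  | vm2, v2 => Pi.single x 1
  | v0, v0 => Pi.single x 2
  | d, D => Pi.single x (-1)
  | D, d => Pi.single x (-1)
  | _, _ => 0

end SlBasis

/-- The underlying space of `sl₂(∧)_dg` over `𝔽₂`. -/
abbrev Sl2dg : Type := SlBasis → ZMod 2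

namespace Sl2dg

/-- The bracket of `sl₂(∧)_dg`, reduced modulo two. -/
def bracket : Sl2dg →ₗ[ZMod 2] Sl2dg →ₗ[ZMod 2] Sl2dg :=
  Fintype.linearCombination (ZMod 2) fun a =>
    Fintype.linearCombination (ZMod 2) fun b => fun c => (SlBasis.bracket a b c : ZMod 2)

/-- A bilinear map as a multilinear map with two inputs. -/
def binary (B : Sl2dg →ₗ[ZMod 2] Sl2dg →ₗ[ZMod 2] Sl2dg) :
    MultilinearMap (ZMod 2) (fun _ : Fin 2 => Sl2dg) Sl2dg where
  toFun y := B (y 0) (y 1)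
  map_update_add' := by
    intro _ y i u v
    fin_cases i <;> simp
  map_update_smul' := by
    intro _ y i c u
    fin_cases i <;> simp

/-- `sl₂(∧)_dg` as an `L∞`-algebra: `l_1 = [d, ·]`, `l_2 = [·, ·]`, and `l_n = 0` for `n ≥ 3`. -/
def ops : AlgOps Sl2dg where
  gr := basisGrading SlBasis.degree
  l
    | 1 => MultilinearMap.ofSubsingleton (ZMod 2) Sl2dg Sl2dg (0 : Fin 1)
        (bracket (Pi.single SlBasis.d 1))
    | 2 => binary bracket
    | _ => 0

end Sl2dg

/-! ## Annular link diagrams -/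

/-- The Gauss data of an oriented link diagram in the annulus, together with an arc `γ` in general
position from the inner boundary `𝕏` to the outer boundary `𝕆` that misses the crossings.

Finitely many points are marked on the link: its passages through the crossings, and possibly
others (at least one on each component without crossings).  `next` sends a point to the following
one along the orientation.  The piece of the link from `p` to `next p` is called the edge `p`. -/
structure GaussData where
  Pt : Type
  Cr : Type
  [fintypePt : Fintype Pt]
  [fintypeCr : Fintype Cr]
  next : Equiv.Perm Pt
  /-- `strand (c, true)` is the passage over the crossing `c`, `strand (c, false)` the passage
  under it. -/
  strand : Cr × Bool ↪ Pt
  positive : Cr → Bool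
  /-- The number of intersections of an edge with `γ`, modulo two. -/
  wt : Pt → ZMod 2

attribute [instance] GaussData.fintypePt GaussData.fintypeCr

namespace GaussData

variable (G : GaussData)

/-- The edge that arrives at the crossing `c` on the over-strand (`b = true`) or on the
under-strand (`b = false`). -/
def inEdge (c : G.Cr) (b : Bool) : G.Pt := G.next.symm (G.strand (c, b))

/-- The edge that leaves the crossing `c` on the over-strand (`b = true`) or on the under-strand
(`b = false`). -/
def outEdge (c : G.Cr) (b : Bool) : G.Pt := G.strand (c, b)

/-! ### Realizability in the annulus -/

/-- Generates the relation of lying in the same connected component of the diagram (as a planar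
graph, whose components may be linked unions of several components of the link). -/
inductive CompStep : G.Pt → G.Pt → Prop
  | pass (p : G.Pt) : CompStep p (G.next p)
  | crossing (c : G.Cr) : CompStep (G.strand (c, true)) (G.strand (c, false))

abbrev Component : Type := Quot G.CompStep

/-- One step around the boundary of a region of the diagram.  The pair `(p, true)` is the edge `p`
travelled along the orientation, and `(p, false)` the edge `p` travelled against it.  When a
crossing is reached, the journey continues on the half-edge that follows counterclockwise; the
counterclockwise order of the half-edges is over-in, under-in, over-out, under-out at a positive
crossing, and under-in, over-in, under-out, over-out at a negative one. -/
inductive FaceStep : G.Pt × Bool → G.Pt × Bool → Prop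
  | passForward (p : G.Pt) (hp : G.next p ∉ Set.range G.strand) :
      FaceStep (p, true) (G.next p, true)
  | passBackward (p : G.Pt) (hp : p ∉ Set.range G.strand) :
      FaceStep (p, false) (G.next.symm p, false)
  | inIn (c : G.Cr) (b : Bool) (hb : b = G.positive c) :
      FaceStep (G.inEdge c b, true) (G.inEdge c (!b), false)
  | inOut (c : G.Cr) (b : Bool) (hb : b ≠ G.positive c) :
      FaceStep (G.inEdge c b, true) (G.outEdge c (!b), true)
  | outOut (c : G.Cr) (b : Bool) (hb : b = G.positive c) :
      FaceStep (G.outEdge c b, false) (G.outEdge c (!b), true)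
  | outIn (c : G.Cr) (b : Bool) (hb : b ≠ G.positive c) :
      FaceStep (G.outEdge c b, false) (G.inEdge c (!b), false)

/-- The regions of the sphere that are cut out by one connected component of the diagram, for all
these components. -/
abbrev Face : Type := Quot G.FaceStep

/-- The number, modulo two, of intersections of `γ` with the boundary of a region. -/
def faceWt (F : G.Face) : ZMod 2 :=
  ∑ t : G.Pt × Bool with Quot.mk G.FaceStep t = F, G.wt t.1

/-- The data comes from a diagram in the annulus, that is, in the sphere without two points.

`planar`: each connected component of the diagram is a graph on the sphere.  It has one vertex for
each crossing and one for each other marked point, and it has as many edges as marked points, so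
that Euler's formula for all the components together reads as stated.

`annular`: with respect to each component, `𝕏` and `𝕆` lie in regions `X` and `O`, and an arc from
`𝕏` to `𝕆` meets the boundary of a region an odd number of times exactly if one but not the
other end point lies in it. -/
structure IsAnnular : Prop where
  planar : Nat.card G.Face = Nat.card G.Cr + 2 * Nat.card G.Component
  annular : ∀ K : G.Component, ∃ X O : G.Pt × Bool,
    Quot.mk G.CompStep X.1 = K ∧ Quot.mk G.CompStep O.1 = K ∧
    ∀ t : G.Pt × Bool, Quot.mk G.CompStep t.1 = K →
      G.faceWt (Quot.mk _ t) =
        (if Quot.mk G.FaceStep t = Quot.mk G.FaceStep X then 1 else 0) +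
        (if Quot.mk G.FaceStep t = Quot.mk G.FaceStep O then 1 else 0)

/-! ### Reidemeister I -/

/-- The diagram after a Reidemeister I move that puts a kink into the edge `p`, inside a disk that
misses `γ`.  The new crossing is positive if `pos` is true and negative otherwise; the kink passes
first over and then under it if `overFirst` is true, and the other way round otherwise.  The first
passage is the point `Sum.inr false`, the second one is `Sum.inr true`.  Of the intersections of
the edge `p` with `γ`, `w` (modulo two) lie in front of the kink and the others behind it. -/
def kink (p : G.Pt) (w : ZMod 2) (overFirst pos : Bool) : GaussData where
  Pt := G.Pt ⊕ Bool
  Cr := Option G.Cr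
  next := (Equiv.sumCongr G.next (Equiv.refl Bool)) *
    (Equiv.swap (Sum.inl p) (Sum.inr false) * Equiv.swap (Sum.inr false) (Sum.inr true))
  strand :=
    { toFun := fun t => match t with
        | (some c, b) => Sum.inl (G.strand (c, b))
        | (none, b) => Sum.inr (xor b overFirst)
      inj' := by
        rintro ⟨_ | c, b⟩ ⟨_ | c', b'⟩ h
        · simpa using h
        · simp at h
        · simp at h
        · simpa using h }
  positive
    | some c => G.positive c
    | none => pos
  wt
    | Sum.inl q => if q = p then w else G.wt q
    | Sum.inr false => 0
    | Sum.inr true => G.wt p - w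

/-! ### Kauffman states -/

/-- How the smoothing `s` of all crossings connects the edges (`false` is the `0`-smoothing and
`true` the `1`-smoothing).  The smoothing of a crossing that respects the orientation is the
`0`-smoothing of a positive crossing and the `1`-smoothing of a negative one. -/
inductive Joined (s : G.Cr → Bool) : G.Pt → G.Pt → Prop
  | pass (p : G.Pt) (hp : G.next p ∉ Set.range G.strand) : Joined s p (G.next p)
  | oriented (c : G.Cr) (b : Bool) (hc : s c ≠ G.positive c) :
      Joined s (G.inEdge c b) (G.outEdge c (!b))
  | unorientedIn (c : G.Cr) (hc : s c = G.positive c) :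
      Joined s (G.inEdge c true) (G.inEdge c false)
  | unorientedOut (c : G.Cr) (hc : s c = G.positive c) :
      Joined s (G.outEdge c true) (G.outEdge c false)

/-- The circles of the smoothing `s`. -/
abbrev Circle (s : G.Cr → Bool) : Type := Quot (G.Joined s)

variable {G}

/-- The circle through an edge. -/
abbrev circ (s : G.Cr → Bool) (p : G.Pt) : G.Circle s := Quot.mk _ p

/-- A circle is nontrivial if it separates `𝕏` from `𝕆`, that is, if it meets `γ` an odd number of
times. -/
def Nontriv {s : G.Cr → Bool} (Z : G.Circle s) : Prop :=
  ∑ p : G.Pt with circ s p = Z, G.wt p = 1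

variable (G)

/-- The generators of the Khovanov complex: a smoothing with a label on each of its circles, where
`true` stands for `+` (`v₊` or `w₊`) and `false` for `-` (`v₋` or `w₋`). -/
abbrev Gen : Type := Σ s : G.Cr → Bool, (G.Circle s → Bool)

instance (s : G.Cr → Bool) : Fintype (G.Circle s) := Fintype.ofFinite _

instance : Fintype G.Gen := inferInstanceAs (Fintype (Σ s : G.Cr → Bool, (G.Circle s → Bool)))

variable {G}

/-- The label of the circle through the edge `p`. -/
def Gen.label (g : G.Gen) (p : G.Pt) : Bool := g.2 (circ g.1 p)

/-- The homological degree. -/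
def Gen.homDeg (g : G.Gen) : ℤ :=
  (Finset.univ.filter fun c => g.1 c = true).card -
    (Finset.univ.filter fun c => G.positive c = false).card

/-- The `k`-degree: the number of nontrivial circles with label `+`, minus the number of those
with label `-`. -/
def Gen.kDeg (g : G.Gen) : ℤ :=
  ∑ Z : G.Circle g.1, if Nontriv Z then (if g.2 Z = true then 1 else -1) else 0

/-! ### The Khovanov and Lee differentials -/

/-- `z` occurs in the product of `x` and `y` under the Khovanov merge map. -/
def khMerge : Bool → Bool → Bool → Prop
  | true, true, z => z = true
  | true, false, z => z = false
  | false, true, z => z = false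
  | false, false, _ => False

/-- `y ⊗ z` occurs in the coproduct of `x` under the Khovanov split map. -/
def khSplit : Bool → Bool → Bool → Prop
  | true, y, z => y ≠ z
  | false, y, z => y = false ∧ z = false

/-- The Lee merge map: `- ⊗ - ↦ +`, and `0` otherwise. -/
def leeMerge (x y z : Bool) : Prop := x = false ∧ y = false ∧ z = true

/-- The Lee split map: `- ↦ + ⊗ +`, and `+ ↦ 0`. -/
def leeSplit (x y z : Bool) : Prop := x = false ∧ y = true ∧ z = true

/-- `g'` occurs in the image of `g` under the edge map of the cube of resolutions at the crossing
`c` with the given merge and split maps.  In either smoothing, the circles that touch `c` are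
those through the over-in edge and through the over-out edge. -/
def EdgeTerm (merge split : Bool → Bool → Bool → Prop) (c : G.Cr) (g g' : G.Gen) : Prop :=
  g.1 c = false ∧ g'.1 = Function.update g.1 c true ∧
  (∀ p, circ g.1 p ≠ circ g.1 (G.inEdge c true) → circ g.1 p ≠ circ g.1 (G.outEdge c true) →
    g'.label p = g.label p) ∧
  ((circ g.1 (G.inEdge c true) ≠ circ g.1 (G.outEdge c true) ∧
      circ g'.1 (G.inEdge c true) = circ g'.1 (G.outEdge c true) ∧
      merge (g.label (G.inEdge c true)) (g.label (G.outEdge c true))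
        (g'.label (G.inEdge c true))) ∨
    (circ g.1 (G.inEdge c true) = circ g.1 (G.outEdge c true) ∧
      circ g'.1 (G.inEdge c true) ≠ circ g'.1 (G.outEdge c true) ∧
      split (g.label (G.inEdge c true)) (g'.label (G.inEdge c true))
        (g'.label (G.outEdge c true))))

/-- The endomorphism in which the coefficient of `g'` in the image of `g` is `1` if `R g g'` holds
and `0` otherwise. -/
def ofRel (R : G.Gen → G.Gen → Prop) : Matrix G.Gen G.Gen (ZMod 2) :=
  Matrix.of fun g' g => if R g g' then 1 else 0

variable (G)

/-- `∂₀`: the part of the Khovanov differential that preserves the `k`-degree. -/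
def dZero : Matrix G.Gen G.Gen (ZMod 2) :=
  ofRel fun g g' => (∃ c, EdgeTerm khMerge khSplit c g g') ∧ g'.kDeg = g.kDeg

/-- `∂₋`: the part of the Khovanov differential that decreases the `k`-degree. -/
def dMinus : Matrix G.Gen G.Gen (ZMod 2) :=
  ofRel fun g g' => (∃ c, EdgeTerm khMerge khSplit c g g') ∧ g'.kDeg < g.kDeg

/-- `∂₀ᴸᵉᵉ`: the part of the Lee differential that preserves the `k`-degree. -/
def leeZero : Matrix G.Gen G.Gen (ZMod 2) :=
  ofRel fun g g' => (∃ c, EdgeTerm leeMerge leeSplit c g g') ∧ g'.kDeg = g.kDeg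

/-- `∂₊ᴸᵉᵉ`: the part of the Lee differential that increases the `k`-degree. -/
def leePlus : Matrix G.Gen G.Gen (ZMod 2) :=
  ofRel fun g g' => (∃ c, EdgeTerm leeMerge leeSplit c g g') ∧ g.kDeg < g'.kDeg

/-! ### The action of `sl₂(∧)_dg` -/

/-- The sum over all nontrivial circles of the map `v₋ ↦ v₊`, `v₊ ↦ 0` on that circle. -/
def eAct : Matrix G.Gen G.Gen (ZMod 2) :=
  ofRel fun g g' => ∃ Z : G.Circle g.1, Nontriv Z ∧ g.2 Z = false ∧
    g' = ⟨g.1, Function.update g.2 Z true⟩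

/-- The sum over all nontrivial circles of the map `v₊ ↦ v₋`, `v₋ ↦ 0` on that circle. -/
def fAct : Matrix G.Gen G.Gen (ZMod 2) :=
  ofRel fun g g' => ∃ Z : G.Circle g.1, Nontriv Z ∧ g.2 Z = true ∧
    g' = ⟨g.1, Function.update g.2 Z false⟩

/-- The sum over all nontrivial circles of the map `v₊ ↦ v₊`, `v₋ ↦ -v₋` on that circle. -/
def hAct : Matrix G.Gen G.Gen (ZMod 2) :=
  Matrix.diagonal fun g => (g.kDeg : ZMod 2)

/-- The action of the basis elements.  Those of `ṽ₀ = [e, v₋₂]` and `x = [v₂, v₋₂]` are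
determined by the brackets. -/
def basisAct : SlBasis → Matrix G.Gen G.Gen (ZMod 2)
  | .e => G.eAct
  | .f => G.fAct
  | .h => G.hAct
  | .v2 => G.leePlus
  | .vm2 => G.dMinus
  | .v0 => G.eAct * G.dMinus - G.dMinus * G.eAct
  | .d => G.dZero
  | .D => G.leeZero
  | .x => G.leePlus * G.dMinus + G.dMinus * G.leePlus

/-- The annular Khovanov complex `CKh` over `𝔽₂` with its operations over `sl₂(∧)_dg`: the
differential `k_1 = ∂₀`, the action `k_2`, and `k_n = 0` for `n ≥ 3`. -/
def CKh : ModOps Sl2dg (G.Gen → ZMod 2) where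
  gr := basisGrading Gen.homDeg
  k
    | 0 => MultilinearMap.constOfIsEmpty (ZMod 2) (fun _ : Fin 0 => Sl2dg)
        (Matrix.toLin' G.dZero)
    | 1 => MultilinearMap.ofSubsingleton (ZMod 2) Sl2dg _ (0 : Fin 1)
        (Fintype.linearCombination (ZMod 2) fun b => Matrix.toLin' (G.basisAct b))
    | _ => 0

end GaussData

/-- An oriented link diagram in the annulus. -/
structure AnnularDiagram extends GaussData where
  isAnnular : toGaussData.IsAnnular

end AnnularKh

end

/-!
Two observations carry the proof: a deformation argument for the relations between the operators,
and the collapse of the complex of a kink onto a part that is preserved by all operators.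

*Relations.*  Over `𝔽₂[t]`, the Khovanov differential plus `t` times the Lee differential is the
differential of the cube of resolutions for the Frobenius algebra `𝔽₂[t][X] / (X² - t)`, with `+`
for `1` and `-` for `X`; and `f + t e` is the sum of the multiplications by `X` on all nontrivial
circles (`sum_edgeMat_eq`, `sum_wt_xMat_eq`).  Edge maps commute with the multiplication by `X` on
every edge (`edgeMat_mul_xMat`), hence the deformed differential commutes with `f + t e`.  It also
follows that the commutativity of a square of the cube needs to be checked only on generators all
of whose labels are `+` (`eq_zero_of_commute_xMat`).  There a merge is the identity and a split is
the multiplication by a sum of two classes `X`, and the comparison is a matter of which edges lie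
on a common circle (`factorMat_square`, `edgeMat_comm`).  The geometric input is that two different
circles meeting at a crossing become one when its smoothing is changed, which holds by a parity
count of ends of edges (`circ_eq_of_circ_ne`).  In characteristic two, commuting edge maps of square
zero add up to a differential.

The coefficients of the powers of `t` and the homogeneous components for the `k`-degree of
`(∂ + t ∂ᴸᵉᵉ)² = 0`, of `[f + t e, ∂ + t ∂ᴸᵉᵉ] = 0` and of `(f + t e)² = t · const` are the
relations between `e`, `f`, `h`, `v₂`, `v₋₂`, `d` and `D`.  Those with `ṽ₀` and `x` are formal
consequences (`bracketTwo_relations`).  Since `l_1` and `k_1` are given by `d`, these relations say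
that `CKh` is an `L∞`-module (`isLInfModule_of_basisAct`).

*Reidemeister I.*  The generators of the complex of a kink form three copies of the generators of
the complex without the kink (`bijective_kinkGen`): one for the smoothing of the new crossing
that produces no circle inside the kink, and two for the other smoothing, one for each label of the
small circle.  This circle is trivial, so that neither its label nor the `k`-degree is affected by
the remaining crossings and by `e` and `f`.

For a positive kink, the small circle is merged into the rest, and the part with label `+` on it
is mapped to the copy without small circle by the identity, since `+` is the unit.  These two parts
form an acyclic subcomplex, and the projection to the part with label `-` is a strict homomorphism.
For a negative kink, the small circle is split off, and dually the inclusion of the part with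
label `+` is a strict homomorphism with acyclic cokernel.
-/

noncomputable section

open scoped Classical

namespace AnnularKh

/-! ### Gradings by a basis -/

section Graded

variable {ι : Type*}

theorem isInternal_basisGrading [Fintype ι] (deg : ι → ℤ) :
    DirectSum.IsInternal (basisGrading deg) := by
  rw [DirectSum.isInternal_submodule_iff_iSupIndep_and_iSup_eq_top]
  constructor
  · intro i
    rw [Submodule.disjoint_def]
    intro v hv hv'
    have key : (⨆ (j : ℤ) (_ : j ≠ i), basisGrading deg j) ≤
        ⨅ b : {b : ι // deg b = i}, LinearMap.ker (LinearMap.proj (R := ZMod 2)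
          (φ := fun _ : ι => ZMod 2) b.1) := by
      refine iSup₂_le fun j hj u hu => ?_
      simp only [Submodule.mem_iInf, LinearMap.mem_ker, LinearMap.proj_apply]
      rintro ⟨b, hb⟩
      by_contra h
      exact hj ((hu b h).symm.trans hb)
    have h0 := key hv'
    simp only [Submodule.mem_iInf, LinearMap.mem_ker, LinearMap.proj_apply] at h0
    funext b
    by_contra h
    exact h (h0 ⟨b, hv b h⟩)
  · rw [eq_top_iff]
    intro v _
    rw [pi_eq_sum_univ' v]
    refine Submodule.sum_mem _ fun b _ => Submodule.smul_mem _ _ ?_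
    refine Submodule.mem_iSup_of_mem (deg b) ?_
    intro c hc
    by_contra h
    have : b ≠ c := fun e => h (by rw [e])
    simp [Ne.symm this] at hc

/-- A matrix is homogeneous of degree `n` with respect to the degrees `deg` of the basis. -/
def HasDegree {R : Type*} [Zero R] (deg : ι → ℤ) (n : ℤ) (A : Matrix ι ι R) : Prop :=
  ∀ i j, A i j ≠ 0 → deg i = deg j + n

variable {deg : ι → ℤ} {m n : ℤ} {A B C : Matrix ι ι (ZMod 2)}

theorem HasDegree.mul [Fintype ι] (hA : HasDegree deg m A) (hB : HasDegree deg n B) :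
    HasDegree deg (m + n) (A * B) := by
  intro i j h
  obtain ⟨k, -, hk⟩ := Finset.exists_ne_zero_of_sum_ne_zero h
  rw [hA i k (left_ne_zero_of_mul hk), hB k j (right_ne_zero_of_mul hk)]
  ring

theorem HasDegree.add (hA : HasDegree deg n A) (hB : HasDegree deg n B) :
    HasDegree deg n (A + B) := by
  intro i j h
  by_cases h0 : A i j = 0
  · exact hB i j (by simpa [h0] using h)
  · exact hA i j h0

theorem HasDegree.sub (hA : HasDegree deg n A) (hB : HasDegree deg n B) :
    HasDegree deg n (A - B) := by
  intro i j h
  by_cases h0 : A i j = 0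
  · exact hB i j (by simpa [h0] using h)
  · exact hA i j h0

theorem HasDegree.eq_zero_of_add_eq_zero (hA : HasDegree deg m A) (hB : HasDegree deg n B)
    (hmn : m ≠ n) (h : A + B = 0) : A = 0 ∧ B = 0 := by
  have key : A = 0 := by
    ext i j
    by_contra hne
    have hB0 : B i j ≠ 0 := by
      intro h0
      have := congrFun (congrFun h i) j
      rw [Matrix.add_apply, h0, add_zero] at this
      exact hne this
    have h1 := hA i j hne
    have h2 := hB i j hB0
    omega
  exact ⟨key, by simpa [key] using h⟩

theorem HasDegree.eq_zero_of_add_add_eq_zero {a b c : ℤ} (hA : HasDegree deg a A)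
    (hB : HasDegree deg b B) (hC : HasDegree deg c C) (hab : a ≠ b) (hac : a ≠ c) (hbc : b ≠ c)
    (h : A + B + C = 0) : A = 0 ∧ B = 0 ∧ C = 0 := by
  have key : A = 0 := by
    ext i j
    by_contra hne
    have h1 := hA i j hne
    have := congrFun (congrFun h i) j
    have hB0 : B i j = 0 := by
      by_contra h0
      have h2 := hB i j h0
      omega
    have hC0 : C i j = 0 := by
      by_contra h0
      have h2 := hC i j h0
      omega
    rw [Matrix.add_apply, Matrix.add_apply, hB0, hC0, add_zero, add_zero] at this
    exact hne this
  rw [key, zero_add] at h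
  exact ⟨key, hB.eq_zero_of_add_eq_zero hC hbc h⟩

theorem HasDegree.mulVec_mem [Fintype ι] (hA : HasDegree deg n A) {i : ℤ} {v : ι → ZMod 2}
    (hv : v ∈ basisGrading deg i) : A.mulVec v ∈ basisGrading deg (i + n) := by
  intro b hb
  obtain ⟨k, -, hk⟩ := Finset.exists_ne_zero_of_sum_ne_zero hb
  rw [hA b k (left_ne_zero_of_mul hk), hv k (right_ne_zero_of_mul hk)]

end Graded

/-! ### Unshuffles with few inputs -/

/-- An operation applied to the entries in `S` can be computed from any increasing enumeration
of `S`. -/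
theorem apply_pick {α β : Type*} (l : ∀ n : ℕ, (Fin n → α) → β) {n k : ℕ} (S : Finset (Fin n))
    (f : Fin k → Fin n) (hf : StrictMono f) (hS : S.card = k) (hfS : ∀ j, f j ∈ S)
    (x : Fin n → α) : l S.card (pick S x) = l k (x ∘ f) := by
  subst hS
  have : f = S.orderEmbOfFin rfl := Finset.orderEmbOfFin_unique rfl hfS hf
  subst this
  rfl

theorem apply_pick_empty {α β : Type*} (l : ∀ n : ℕ, (Fin n → α) → β) {n : ℕ}
    (S : Finset (Fin n)) (hS : S = ∅) (x : Fin n → α) : l S.card (pick S x) = l 0 ![] := by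
  rw [apply_pick l S ![] (fun i => i.elim0) (by simp [hS]) (fun i => i.elim0)]
  congr 1
  exact Subsingleton.elim _ _

theorem apply_pick_univ {α β : Type*} (l : ∀ n : ℕ, (Fin n → α) → β) {n : ℕ}
    (S : Finset (Fin n)) (hS : S = Finset.univ) (x : Fin n → α) :
    l S.card (pick S x) = l n x := by
  rw [apply_pick l S id strictMono_id (by simp [hS]) (by simp [hS])]
  rfl

theorem apply_pick_singleton {α β : Type*} (l : ∀ n : ℕ, (Fin n → α) → β) {n : ℕ}
    (S : Finset (Fin n)) (i : Fin n) (hS : S = {i}) (x : Fin n → α) :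
    l S.card (pick S x) = l 1 ![x i] := by
  rw [apply_pick l S ![i] (Subsingleton.strictMono _) (by simp [hS]) (by simp [hS])]
  congr 1
  ext j
  simp

theorem sum_finset_fin_one {β : Type*} [AddCommMonoid β] (T : Finset (Fin 1) → β) :
    ∑ S, T S = T ∅ + T {0} := by
  have : (Finset.univ : Finset (Finset (Fin 1))) = {∅, {0}} := by decide
  rw [this, Finset.sum_insert (by decide), Finset.sum_singleton]

theorem sum_finset_fin_two {β : Type*} [AddCommMonoid β] (T : Finset (Fin 2) → β) :
    ∑ S, T S = T ∅ + (T {0} + (T {1} + T {0, 1})) := by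
  have : (Finset.univ : Finset (Finset (Fin 2))) = {∅, {0}, {1}, {0, 1}} := by decide
  rw [this, Finset.sum_insert (by decide), Finset.sum_insert (by decide),
    Finset.sum_insert (by decide), Finset.sum_singleton]

theorem sum_finset_fin_three {β : Type*} [AddCommMonoid β] (T : Finset (Fin 3) → β) :
    ∑ S, T S = T ∅ + (T {0} + (T {1} + (T {2} + (T {0, 1} + (T {0, 2} + (T {1, 2}
      + T {0, 1, 2})))))) := by
  have : (Finset.univ : Finset (Finset (Fin 3))) =
      {∅, {0}, {1}, {2}, {0, 1}, {0, 2}, {1, 2}, {0, 1, 2}} := by decide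
  rw [this, Finset.sum_insert (by decide), Finset.sum_insert (by decide),
    Finset.sum_insert (by decide), Finset.sum_insert (by decide), Finset.sum_insert (by decide),
    Finset.sum_insert (by decide), Finset.sum_insert (by decide), Finset.sum_singleton]

/-! ### `sl₂(∧)_dg` is an `L∞`-algebra -/

namespace Sl2dg

/-- The basis vector of `sl₂(∧)_dg`. -/
abbrev basis (a : SlBasis) : Sl2dg := Pi.single a 1

theorem eq_sum_basis (y : Sl2dg) : y = ∑ a, y a • basis a := by
  funext b
  simp [Finset.sum_apply, Pi.single_apply]

theorem bracket_basis (a b : SlBasis) :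
    bracket (basis a) (basis b) = fun c => (SlBasis.bracket a b c : ZMod 2) := by
  simp [bracket, Fintype.linearCombination_apply_single]

theorem bracket_basis_comm (a b : SlBasis) :
    bracket (basis a) (basis b) = bracket (basis b) (basis a) := by
  rw [bracket_basis, bracket_basis]
  revert a b
  decide

/-- Two linear maps out of `sl₂(∧)_dg` agree if they agree on the basis. -/
theorem lin_ext {W : Type*} [AddCommGroup W] [Module (ZMod 2) W] {f g : Sl2dg →ₗ[ZMod 2] W}
    (h : ∀ a, f (basis a) = g (basis a)) : f = g :=
  LinearMap.pi_ext' fun a => LinearMap.ext_ring (h a)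

theorem bracket_comm (y z : Sl2dg) : bracket y z = bracket z y := by
  have : bracket = bracket.flip :=
    lin_ext fun a => lin_ext fun b => bracket_basis_comm a b
  exact congrArg (fun f => f y z) this

theorem bracket_bracket_basis (a b c : SlBasis) :
    bracket (bracket (basis a) (basis b)) (basis c) =
      fun k => ∑ i, (SlBasis.bracket a b i : ZMod 2) * (SlBasis.bracket i c k : ZMod 2) := by
  conv_lhs => rw [eq_sum_basis (bracket (basis a) (basis b))]
  rw [map_sum, LinearMap.sum_apply]
  funext k
  simp only [map_smul, LinearMap.smul_apply, bracket_basis, Finset.sum_apply, Pi.smul_apply,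
    smul_eq_mul]

theorem bracket_d_bracket_d (y : Sl2dg) : bracket (basis .d) (bracket (basis .d) y) = 0 := by
  have h0 (a : SlBasis) : bracket (basis .d) (bracket (basis .d) (basis a)) = 0 := by
    rw [bracket_comm, bracket_bracket_basis]
    revert a
    decide
  have := lin_ext (f := (bracket (basis .d)).comp (bracket (basis .d))) (g := 0) h0
  exact congrArg (fun f => f y) this

theorem jacobi_basis (a b c : SlBasis) :
    bracket (bracket (basis a) (basis b)) (basis c) +
    bracket (bracket (basis a) (basis c)) (basis b) +
    bracket (bracket (basis b) (basis c)) (basis a) = 0 := by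
  rw [bracket_bracket_basis, bracket_bracket_basis, bracket_bracket_basis]
  revert a b c
  decide +kernel

theorem jacobi (u v w : Sl2dg) :
    bracket (bracket u v) w + bracket (bracket u w) v + bracket (bracket v w) u = 0 := by
  have h3 (a b : SlBasis) (w : Sl2dg) : bracket (bracket (basis a) (basis b)) w +
      bracket (bracket (basis a) w) (basis b) + bracket (bracket (basis b) w) (basis a) = 0 := by
    have := lin_ext (f := bracket (bracket (basis a) (basis b)) +
      (bracket.flip (basis b)).comp (bracket (basis a)) +
      (bracket.flip (basis a)).comp (bracket (basis b))) (g := 0) fun c => jacobi_basis a b c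
    exact congrArg (fun f => f w) this
  have h2 (a : SlBasis) (v w : Sl2dg) : bracket (bracket (basis a) v) w +
      bracket (bracket (basis a) w) v + bracket (bracket v w) (basis a) = 0 := by
    have := lin_ext (f := (bracket.flip w).comp (bracket (basis a)) +
      bracket (bracket (basis a) w) +
      (bracket.flip (basis a)).comp (bracket.flip w)) (g := 0) fun b => h3 a b w
    exact congrArg (fun f => f v) this
  have := lin_ext (f := (bracket.flip w).comp (bracket.flip v) +
      (bracket.flip v).comp (bracket.flip w) + bracket (bracket v w)) (g := 0) fun a => h2 a v w
  exact congrArg (fun f => f u) this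

theorem bracket_degree {i j : ℤ} {y z : Sl2dg} (hy : y ∈ basisGrading SlBasis.degree i)
    (hz : z ∈ basisGrading SlBasis.degree j) :
    bracket y z ∈ basisGrading SlBasis.degree (i + j) := by
  have h0 : ∀ a b c, (SlBasis.bracket a b c : ZMod 2) ≠ 0 → c.degree = a.degree + b.degree := by
    decide
  rw [eq_sum_basis y, eq_sum_basis z, map_sum]
  refine Submodule.sum_mem _ fun b _ => ?_
  rw [map_sum, LinearMap.sum_apply]
  refine Submodule.sum_mem _ fun a _ => ?_
  simp only [map_smul, LinearMap.smul_apply, bracket_basis]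
  intro c hc
  simp only [Pi.smul_apply, smul_eq_mul] at hc
  rw [h0 a b c (right_ne_zero_of_mul (right_ne_zero_of_mul hc)),
    hy a (left_ne_zero_of_mul (right_ne_zero_of_mul hc)), hz b (left_ne_zero_of_mul hc)]

theorem basis_d_mem : basis .d ∈ basisGrading SlBasis.degree 1 := by
  intro b hb
  by_contra h
  apply hb
  refine Pi.single_eq_of_ne ?_ _
  rintro rfl
  exact h rfl

theorem ops_l_one (y : Fin 1 → Sl2dg) : ops.l 1 y = bracket (basis .d) (y 0) := rfl

theorem ops_l_two (y : Fin 2 → Sl2dg) : ops.l 2 y = bracket (y 0) (y 1) := rfl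

theorem ops_l_eq_zero : ∀ {n : ℕ}, 3 ≤ n → ops.l n = 0
  | 0, h => absurd h (by decide)
  | 1, h => absurd h (by decide)
  | 2, h => absurd h (by decide)
  | _ + 3, _ => rfl

theorem isLInfAlgebra_ops : IsLInfAlgebra ops where
  graded := isInternal_basisGrading _
  symm n σ x := by
    match n with
    | 0 => rfl
    | 1 => rw [Subsingleton.elim σ 1]; rfl
    | 2 =>
      rw [ops_l_two, ops_l_two]
      have : σ = 1 ∨ σ = Equiv.swap 0 1 := by
        revert σ
        decide
      rcases this with rfl | rfl
      · rfl
      · exact bracket_comm _ _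
    | n + 3 => rfl
  degree n hn a x hx := by
    match n, hn with
    | 1, _ =>
      rw [ops_l_one]
      change _ ∈ basisGrading _ _
      convert bracket_degree basis_d_mem (hx 0) using 2
      simp
      ring
    | 2, _ =>
      rw [ops_l_two]
      change _ ∈ basisGrading _ _
      convert bracket_degree (hx 0) (hx 1) using 2
      simp
    | n + 3, _ => exact Submodule.zero_mem _
  jacobi n hn x := by
    rw [Finset.sum_filter]
    match n, hn with
    | 1, _ =>
      rw [sum_finset_fin_one, if_neg (by decide), if_pos (by decide),
        apply_pick_empty (fun n z => ops.l (n + 1) (Fin.cons _ z)) _ (by decide),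
        apply_pick_univ (fun n z => ops.l n z) _ (by decide), zero_add]
      change bracket (basis .d) (bracket (basis .d) (x 0)) = 0
      exact bracket_d_bracket_d _
    | 2, _ =>
      rw [sum_finset_fin_two, if_neg (by decide), if_pos (by decide), if_pos (by decide),
        if_pos (by decide),
        apply_pick_singleton (fun n z => ops.l (n + 1) (Fin.cons _ z)) _ 1 (by decide),
        apply_pick_singleton (fun n z => ops.l n z) _ 0 (by decide),
        apply_pick_singleton (fun n z => ops.l (n + 1) (Fin.cons _ z)) _ 0 (by decide),
        apply_pick_singleton (fun n z => ops.l n z) _ 1 (by decide),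
        apply_pick_empty (fun n z => ops.l (n + 1) (Fin.cons _ z)) _ (by decide),
        apply_pick_univ (fun n z => ops.l n z) _ (by decide), zero_add]
      change bracket (bracket (basis .d) (x 0)) (x 1) + (bracket (bracket (basis .d) (x 1)) (x 0) +
        bracket (basis .d) (bracket (x 0) (x 1))) = 0
      rw [bracket_comm (basis .d) (bracket _ _), ← add_assoc]
      exact jacobi _ _ _
    | 3, _ =>
      rw [sum_finset_fin_three, if_neg (by decide), if_pos (by decide), if_pos (by decide),
        if_pos (by decide), if_pos (by decide), if_pos (by decide), if_pos (by decide),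
        if_pos (by decide)]
      have h1 (i : Fin 3) : ops.l (({i} : Finset (Fin 3))ᶜ.card + 1)
          (Fin.cons (ops.l ({i} : Finset (Fin 3)).card (pick {i} x)) (pick {i}ᶜ x)) = 0 := by
        rw [ops_l_eq_zero (by revert i; decide)]
        rfl
      have h2 : ops.l (({0, 1, 2} : Finset (Fin 3))ᶜ.card + 1)
          (Fin.cons (ops.l ({0, 1, 2} : Finset (Fin 3)).card (pick {0, 1, 2} x))
            (pick {0, 1, 2}ᶜ x)) = 0 := by
        rw [ops_l_eq_zero (n := ({0, 1, 2} : Finset (Fin 3)).card) (by decide)]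
        exact (ops.l _).map_coord_zero 0 rfl
      rw [h1, h1, h1, h2]
      have hp (i j k : Fin 3) (hij : i < j) (hk : ({i, j} : Finset (Fin 3))ᶜ = {k}) :
          ops.l (({i, j} : Finset (Fin 3))ᶜ.card + 1)
            (Fin.cons (ops.l ({i, j} : Finset (Fin 3)).card (pick {i, j} x)) (pick {i, j}ᶜ x)) =
          bracket (bracket (x i) (x j)) (x k) := by
        rw [apply_pick_singleton (fun n z => ops.l (n + 1) (Fin.cons _ z)) _ k hk,
          apply_pick (fun n z => ops.l n z) _ ![i, j]
            (by simpa [Fin.strictMono_iff_lt_succ] using hij)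
            (Finset.card_pair hij.ne) (by simp [Fin.forall_fin_two])]
        rfl
      rw [hp 0 1 2 (by decide) (by decide), hp 0 2 1 (by decide) (by decide),
        hp 1 2 0 (by decide) (by decide)]
      simp only [zero_add, add_zero, ← add_assoc]
      exact jacobi _ _ _
    | n + 4, _ =>
      refine Finset.sum_eq_zero fun S _ => ?_
      split_ifs with hS
      · by_cases h : 3 ≤ S.card
        · rw [ops_l_eq_zero h]
          exact (ops.l _).map_coord_zero 0 rfl
        · rw [ops_l_eq_zero (n := Sᶜ.card + 1)]
          · rfl
          · rw [Finset.card_compl, Fintype.card_fin]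
            omega
      · rfl

end Sl2dg

/-! ### Modules without higher operations and strict homomorphisms -/

namespace GaussData

variable (G : GaussData)

/-- The action of all of `sl₂(∧)_dg`. -/
def act : Sl2dg →ₗ[ZMod 2] Module.End (ZMod 2) (G.Gen → ZMod 2) :=
  Fintype.linearCombination (ZMod 2) fun b => Matrix.toLin' (G.basisAct b)

theorem act_basis (a : SlBasis) : G.act (Sl2dg.basis a) = Matrix.toLin' (G.basisAct a) := by
  simp [act, Fintype.linearCombination_apply_single]

theorem CKh_k_eq_zero : ∀ {n : ℕ}, 2 ≤ n → G.CKh.k n = 0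
  | 0, h => absurd h (by decide)
  | 1, h => absurd h (by decide)
  | _ + 2, _ => rfl

variable {G}

theorem act_mem (hdeg : ∀ a, HasDegree Gen.homDeg a.degree (G.basisAct a)) {i j : ℤ} {y : Sl2dg}
    {m : G.Gen → ZMod 2} (hy : y ∈ basisGrading SlBasis.degree i)
    (hm : m ∈ basisGrading Gen.homDeg j) : G.act y m ∈ basisGrading Gen.homDeg (i + j) := by
  rw [Sl2dg.eq_sum_basis y, map_sum, LinearMap.sum_apply]
  refine Submodule.sum_mem _ fun a _ => ?_
  by_cases h : y a = 0
  · simp [h]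
  · rw [map_smul, LinearMap.smul_apply, act_basis, Matrix.toLin'_apply, ← hy a h, add_comm]
    exact Submodule.smul_mem _ _ ((hdeg a).mulVec_mem hm)

/-- `CKh` is an `L∞`-module as soon as `∂₀` squares to zero and the commutators of the operators
of the basis elements are as in `sl₂(∧)_dg`: since `l_1` and `k_1` are given by `d`, the
compatibility of the action with the differentials is the bracket relation with `d`. -/
theorem isLInfModule_of_basisAct (h0 : G.dZero * G.dZero = 0)
    (hcomm : ∀ a b, G.act (Sl2dg.bracket (Sl2dg.basis a) (Sl2dg.basis b)) =
      Matrix.toLin' (G.basisAct a * G.basisAct b + G.basisAct b * G.basisAct a))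
    (hdeg : ∀ a, HasDegree Gen.homDeg a.degree (G.basisAct a)) :
    IsLInfModule Sl2dg.ops G.CKh where
  isLInfAlgebra := Sl2dg.isLInfAlgebra_ops
  graded := isInternal_basisGrading _
  symm n σ x := by
    match n with
    | 0 => rfl
    | 1 => rw [Subsingleton.elim σ 1]; rfl
    | n + 2 => rfl
  degree n a b x m hx hm := by
    match n with
    | 0 =>
      change (G.basisAct .d).mulVec m ∈ basisGrading _ _
      convert (hdeg .d).mulVec_mem hm using 2
      simp [SlBasis.degree]
    | 1 =>
      change G.act (x 0) m ∈ basisGrading _ _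
      convert act_mem hdeg (hx 0) hm using 2
      simp
    | n + 2 => exact Submodule.zero_mem _
  relation n x m := by
    have hact (y z : Sl2dg) (m : G.Gen → ZMod 2) :
        G.act (Sl2dg.bracket y z) m + (G.act z (G.act y m) + G.act y (G.act z m)) = 0 := by
      have h2 (a : SlBasis) (z : Sl2dg) : G.act (Sl2dg.bracket (Sl2dg.basis a) z) =
          G.act (Sl2dg.basis a) * G.act z + G.act z * G.act (Sl2dg.basis a) := by
        have := Sl2dg.lin_ext (f := G.act.comp (Sl2dg.bracket (Sl2dg.basis a)))
          (g := (LinearMap.mul (ZMod 2) _ (G.act (Sl2dg.basis a))).comp G.act +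
            ((LinearMap.mul (ZMod 2) _).flip (G.act (Sl2dg.basis a))).comp G.act) fun b => by
              simp only [LinearMap.comp_apply, LinearMap.add_apply, LinearMap.mul_apply',
                LinearMap.flip_apply, hcomm, act_basis, map_add, Matrix.toLin'_mul,
                Module.End.mul_eq_comp]
        exact congrArg (fun f => f z) this
      have h1 : G.act (Sl2dg.bracket y z) = G.act y * G.act z + G.act z * G.act y := by
        have := Sl2dg.lin_ext (f := G.act.comp (Sl2dg.bracket.flip z))
          (g := ((LinearMap.mul (ZMod 2) _).flip (G.act z)).comp G.act +
            (LinearMap.mul (ZMod 2) _ (G.act z)).comp G.act) fun a => h2 a z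
        exact congrArg (fun f => f y) this
      rw [h1, LinearMap.add_apply, Module.End.mul_apply, Module.End.mul_apply,
        add_comm (G.act z _)]
      exact ZModModule.add_self _
    rw [Finset.sum_filter]
    match n with
    | 0 =>
      rw [Finset.univ_unique, Finset.sum_singleton, Finset.sum_singleton, if_neg (by decide),
        zero_add]
      change (Matrix.toLin' G.dZero) ((Matrix.toLin' G.dZero) m) = 0
      rw [← Matrix.toLin'_mul_apply, h0, map_zero, LinearMap.zero_apply]
    | 1 =>
      rw [sum_finset_fin_one, sum_finset_fin_one, if_neg (by decide), if_pos (by decide),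
        apply_pick_empty (fun n z => G.CKh.k (n + 1) (Fin.cons _ z)) _ (by decide),
        apply_pick_univ (fun n z => Sl2dg.ops.l n z) {0} (by decide),
        apply_pick_univ (fun n z => G.CKh.k n z) ∅ᶜ (by decide),
        apply_pick_univ (fun n z => G.CKh.k n z) {0} (by decide),
        apply_pick_empty (fun n z => G.CKh.k n z) ∅ (by decide),
        apply_pick_empty (fun n z => G.CKh.k n z) {0}ᶜ (by decide), zero_add]
      have := hact (Sl2dg.basis .d) (x 0) m
      rw [act_basis] at this
      exact this
    | 2 =>
      rw [sum_finset_fin_two, sum_finset_fin_two, if_neg (by decide), if_pos (by decide),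
        if_pos (by decide), if_pos (by decide),
        apply_pick_empty (fun n z => G.CKh.k (n + 1) (Fin.cons _ z)) {0, 1}ᶜ (by decide),
        apply_pick_univ (fun n z => Sl2dg.ops.l n z) {0, 1} (by decide),
        apply_pick_singleton (fun n z => G.CKh.k n z) {0}ᶜ 1 (by decide),
        apply_pick_singleton (fun n z => G.CKh.k n z) {1}ᶜ 0 (by decide),
        apply_pick_singleton (fun n z => G.CKh.k n z) {0} 0 (by decide),
        apply_pick_singleton (fun n z => G.CKh.k n z) {1} 1 (by decide),
        CKh_k_eq_zero (n := ({0} : Finset (Fin 2))ᶜ.card + 1) G (by decide),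
        CKh_k_eq_zero (n := ({1} : Finset (Fin 2))ᶜ.card + 1) G (by decide),
        CKh_k_eq_zero (n := (∅ : Finset (Fin 2))ᶜ.card) G (by decide),
        CKh_k_eq_zero (n := ({0, 1} : Finset (Fin 2)).card) G (by decide)]
      simp only [zero_apply, LinearMap.zero_apply, zero_add, map_zero, add_zero]
      exact hact (x 0) (x 1) m
    | n + 3 =>
      rw [Finset.sum_eq_zero, Finset.sum_eq_zero, zero_add]
      · intro S _
        by_cases h : 2 ≤ S.card
        · rw [CKh_k_eq_zero G h]
          simp
        · rw [CKh_k_eq_zero (n := Sᶜ.card) G]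
          · rfl
          · rw [Finset.card_compl, Fintype.card_fin]
            omega
      · intro S _
        split_ifs with hS
        · by_cases h : 3 ≤ S.card
          · rw [Sl2dg.ops_l_eq_zero h]
            rw [(G.CKh.k (Sᶜ.card + 1)).map_coord_zero 0 rfl]
            rfl
          · rw [CKh_k_eq_zero (n := Sᶜ.card + 1) G]
            · rfl
            · rw [Finset.card_compl, Fintype.card_fin]
              omega
        · rfl

end GaussData

section Strict

variable {V M M' : Type*} [AddCommGroup V] [Module (ZMod 2) V]
  [AddCommGroup M] [Module (ZMod 2) M] [AddCommGroup M'] [Module (ZMod 2) M']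

/-- A linear map as a family of operations with trivial higher components. -/
def strictOps (φ : M →ₗ[ZMod 2] M') : MixedOps V M M'
  | 0 => MultilinearMap.constOfIsEmpty (ZMod 2) (fun _ : Fin 0 => V) φ
  | _ + 1 => 0

theorem strictOps_eq_zero (φ : M →ₗ[ZMod 2] M') :
    ∀ {n : ℕ}, n ≠ 0 → (strictOps φ : MixedOps V M M') n = 0
  | 0, h => absurd rfl h
  | _ + 1, _ => rfl

/-- A linear map of degree zero that commutes with all operations is an `L∞`-homomorphism. -/
theorem isLInfHom_strictOps {A : AlgOps V} {K : ModOps V M} {K' : ModOps V M'}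
    {φ : M →ₗ[ZMod 2] M'} (hdeg : ∀ b, ∀ m ∈ K.gr b, φ m ∈ K'.gr b)
    (hφ : ∀ n (x : Fin n → V) m, φ (K.k n x m) = K'.k n x (φ m)) :
    IsLInfHom A K K' (strictOps φ) where
  symm n σ x := by cases n <;> rfl
  degree n a b x m _ hm := by
    cases n with
    | zero =>
      have : strictOps φ 0 x m ∈ K'.gr b := hdeg b m hm
      simpa using this
    | succ n => exact Submodule.zero_mem _
  relation n x m := by
    rw [Finset.sum_eq_zero, zero_add, Finset.sum_eq_single Finset.univ,
      Finset.sum_eq_single (∅ : Finset (Fin n)),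
      apply_pick_empty (fun n z => strictOps φ n z) _ Finset.compl_univ,
      apply_pick_univ (fun n z => K.k n z) _ rfl,
      apply_pick_univ (fun n z => K'.k n z) _ Finset.compl_empty,
      apply_pick_empty (fun n z => strictOps φ n z) _ rfl]
    · change φ (K.k n x m) + K'.k n x (φ m) = 0
      rw [hφ]
      exact ZModModule.add_self _
    · intro S _ hS
      rw [strictOps_eq_zero φ (by simpa using hS)]
      simp
    · simp
    · intro S _ hS
      rw [strictOps_eq_zero φ (by simpa using hS)]
      rfl
    · simp
    · intro S _
      rfl

/-- A surjective chain map with acyclic kernel induces an isomorphism on homology. -/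
theorem bijective_homologyMap_of_surjective {d : M →ₗ[ZMod 2] M} {d' : M' →ₗ[ZMod 2] M'}
    (φ : M →ₗ[ZMod 2] M') (hφ : ∀ m, φ (d m) = d' (φ m)) (hd : ∀ m, d (d m) = 0)
    (hsurj : Function.Surjective φ)
    (hker : ∀ m, φ m = 0 → d m = 0 → ∃ w, φ w = 0 ∧ d w = m) :
    Function.Bijective (homologyMap φ hφ) := by
  constructor
  · rw [← LinearMap.ker_eq_bot, LinearMap.ker_eq_bot']
    intro z hz
    obtain ⟨⟨m, hm⟩, rfl⟩ := Submodule.Quotient.mk_surjective _ z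
    have hz' := (Submodule.Quotient.mk_eq_zero _).1 hz
    obtain ⟨y, hy⟩ := hz'
    change d' y = φ m at hy
    obtain ⟨u, rfl⟩ := hsurj y
    obtain ⟨w, -, hw⟩ := hker (m - d u) (by rw [map_sub, hφ, hy, sub_self])
      (by rw [map_sub, hd, LinearMap.mem_ker.1 hm, sub_zero])
    refine (Submodule.Quotient.mk_eq_zero _).2 ⟨u + w, ?_⟩
    change d (u + w) = m
    rw [map_add, hw, add_sub_cancel]
  · intro z
    obtain ⟨⟨m', hm'⟩, rfl⟩ := Submodule.Quotient.mk_surjective _ z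
    rw [LinearMap.mem_ker] at hm'
    obtain ⟨u, rfl⟩ := hsurj m'
    obtain ⟨w, hw0, hw⟩ := hker (d u) (by rw [hφ, hm']) (hd u)
    have hu : d (u - w) = 0 := by rw [map_sub, hw, sub_self]
    refine ⟨Submodule.Quotient.mk ⟨u - w, hu⟩, ?_⟩
    change Submodule.Quotient.mk _ = _
    congr 1
    apply Subtype.ext
    change φ (u - w) = φ u
    rw [map_sub, hw0, sub_zero]

/-- An injective chain map with acyclic cokernel induces an isomorphism on homology. -/
theorem bijective_homologyMap_of_injective {d : M →ₗ[ZMod 2] M} {d' : M' →ₗ[ZMod 2] M'}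
    (φ : M →ₗ[ZMod 2] M') (hφ : ∀ m, φ (d m) = d' (φ m)) (hd : ∀ m, d' (d' m) = 0)
    (hinj : Function.Injective φ)
    (hcoker : ∀ v, d' v ∈ LinearMap.range φ → ∃ w, v - d' w ∈ LinearMap.range φ) :
    Function.Bijective (homologyMap φ hφ) := by
  constructor
  · rw [← LinearMap.ker_eq_bot, LinearMap.ker_eq_bot']
    intro z hz
    obtain ⟨⟨m, hm⟩, rfl⟩ := Submodule.Quotient.mk_surjective _ z
    have hz' := (Submodule.Quotient.mk_eq_zero _).1 hz
    obtain ⟨v, hv⟩ := hz'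
    change d' v = φ m at hv
    obtain ⟨w, y, hy⟩ := hcoker v ⟨m, hv.symm⟩
    refine (Submodule.Quotient.mk_eq_zero _).2 ⟨y, hinj ?_⟩
    change φ (d y) = φ m
    rw [hφ, hy, map_sub, hd, sub_zero, hv]
  · intro z
    obtain ⟨⟨v, hv⟩, rfl⟩ := Submodule.Quotient.mk_surjective _ z
    rw [LinearMap.mem_ker] at hv
    obtain ⟨w, y, hy⟩ := hcoker v ⟨0, by rw [hv, map_zero]⟩
    have hy0 : d y = 0 := by
      apply hinj
      rw [hφ, hy, map_sub, hd, hv, sub_zero, map_zero]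
    refine ⟨Submodule.Quotient.mk ⟨y, hy0⟩, ?_⟩
    refine (Submodule.Quotient.eq _).2 ⟨-w, ?_⟩
    change d' (-w) = φ y - v
    rw [hy, map_neg]
    abel

end Strict

namespace GaussData

variable {G : GaussData}

/-! ### Circles of neighbouring smoothings -/

/-- The circle through the edge `p` touches the crossing `c`. -/
def Touches (s : G.Cr → Bool) (c : G.Cr) (p : G.Pt) : Prop :=
  circ s p = circ s (G.inEdge c true) ∨ circ s p = circ s (G.outEdge c true)

section Smoothings

variable {s s' : G.Cr → Bool} {c : G.Cr} {p q : G.Pt}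

theorem Touches.congr (h : circ s p = circ s q) (hq : Touches s c q) : Touches s c p := by
  unfold Touches at *
  rwa [h]

theorem touches_inEdge (s : G.Cr → Bool) (c : G.Cr) : ∀ b, Touches s c (G.inEdge c b)
  | true => Or.inl rfl
  | false => by
    by_cases h : s c = G.positive c
    · exact Or.inl (Quot.sound (Joined.unorientedIn c h)).symm
    · exact Or.inr (Quot.sound (Joined.oriented c false h))

theorem touches_outEdge (s : G.Cr → Bool) (c : G.Cr) : ∀ b, Touches s c (G.outEdge c b)
  | true => Or.inr rfl
  | false => by
    by_cases h : s c = G.positive c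
    · exact Or.inr (Quot.sound (Joined.unorientedOut c h)).symm
    · exact Or.inl (Quot.sound (Joined.oriented c true h)).symm

/-- Changing the smoothing of one crossing connects only edges whose circles touch it. -/
theorem circ_eq_or_touches (h : ∀ c', c' ≠ c → s' c' = s c') (hpq : circ s' p = circ s' q) :
    circ s p = circ s q ∨ Touches s c p ∧ Touches s c q := by
  have hgen := Quot.eqvGen_exact hpq
  clear hpq
  induction hgen with
  | rel p q hpq =>
    cases hpq with
    | pass p hp => exact Or.inl (Quot.sound (Joined.pass p hp))
    | oriented c' b hc' =>
      by_cases e : c' = c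
      · subst e
        exact Or.inr ⟨touches_inEdge _ _ _, touches_outEdge _ _ _⟩
      · exact Or.inl (Quot.sound (Joined.oriented c' b (h c' e ▸ hc')))
    | unorientedIn c' hc' =>
      by_cases e : c' = c
      · subst e
        exact Or.inr ⟨touches_inEdge _ _ _, touches_inEdge _ _ _⟩
      · exact Or.inl (Quot.sound (Joined.unorientedIn c' (h c' e ▸ hc')))
    | unorientedOut c' hc' =>
      by_cases e : c' = c
      · subst e
        exact Or.inr ⟨touches_outEdge _ _ _, touches_outEdge _ _ _⟩
      · exact Or.inl (Quot.sound (Joined.unorientedOut c' (h c' e ▸ hc')))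
  | refl p => exact Or.inl rfl
  | symm p q _ ih =>
    rcases ih with h | ⟨h1, h2⟩
    · exact Or.inl h.symm
    · exact Or.inr ⟨h2, h1⟩
  | trans p q r _ _ ih1 ih2 =>
    rcases ih1 with h | ⟨h1, h2⟩ <;> rcases ih2 with h' | ⟨h1', h2'⟩
    · exact Or.inl (h.trans h')
    · exact Or.inr ⟨h1'.congr h, h2'⟩
    · exact Or.inr ⟨h1, h2.congr h'.symm⟩
    · exact Or.inr ⟨h1, h2'⟩

/-- If only one circle touches `c`, then changing the smoothing of `c` connects no further
edges. -/
theorem circ_eq_of_circ_eq (h : ∀ c', c' ≠ c → s' c' = s c')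
    (hc : circ s (G.inEdge c true) = circ s (G.outEdge c true)) (hpq : circ s' p = circ s' q) :
    circ s p = circ s q := by
  rcases circ_eq_or_touches h hpq with h | ⟨h1 | h1, h2 | h2⟩
  · exact h
  all_goals rw [h1, h2]
  all_goals rw [hc]

/-- Each edge has two ends.  Hence the values of a function on the edges that does not change at
the marked points off the crossings, taken at the four ends at each crossing, add up to zero. -/
theorem sum_ends_eq_zero (χ : G.Pt → ZMod 2)
    (hχ : ∀ p, G.next p ∉ Set.range G.strand → χ p = χ (G.next p)) :
    ∑ c : G.Cr, (χ (G.inEdge c true) + χ (G.outEdge c true) +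
      (χ (G.inEdge c false) + χ (G.outEdge c false))) = 0 := by
  have h1 : ∑ q, (χ (G.next.symm q) + χ q) = 0 := by
    rw [Finset.sum_add_distrib, Equiv.sum_comp G.next.symm χ]
    exact ZModModule.add_self _
  rw [← h1, ← Fintype.sum_of_injective G.strand G.strand.injective
    (fun t => χ (G.next.symm (G.strand t)) + χ (G.strand t)) _ ?_ fun _ => rfl,
    Fintype.sum_prod_type]
  · simp only [Fintype.sum_bool]
    rfl
  · intro q hq
    rw [hχ (G.next.symm q) (by simpa using hq), Equiv.apply_symm_apply]
    exact ZModModule.add_self _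

/-- If two circles touch `c`, then they become one when the smoothing of `c` is changed.
Otherwise the edges that lie on a common circle with the over-in edge both before and after the
change have just one end at `c`, so that together they have an odd number of ends. -/
theorem circ_eq_of_circ_ne (h : ∀ c', c' ≠ c → s' c' = s c') (hc : s' c ≠ s c)
    (hne : circ s (G.inEdge c true) ≠ circ s (G.outEdge c true)) :
    circ s' (G.inEdge c true) = circ s' (G.outEdge c true) := by
  by_contra hne'
  let χ : G.Pt → ZMod 2 := fun p =>
    if circ s p = circ s (G.inEdge c true) ∧ circ s' p = circ s' (G.inEdge c true) then 1 else 0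
  have hχ {p q : G.Pt} (h1 : G.Joined s p q) (h2 : G.Joined s' p q) : χ p = χ q := by
    simp only [χ]
    rw [show circ s p = circ s q from Quot.sound h1, show circ s' p = circ s' q from Quot.sound h2]
  have hsum := sum_ends_eq_zero χ fun p hp => hχ (Joined.pass p hp) (Joined.pass p hp)
  have hin : χ (G.inEdge c true) = 1 := if_pos ⟨rfl, rfl⟩
  have hout : χ (G.outEdge c true) = 0 := if_neg fun e => hne e.1.symm
  have hfalse : χ (G.inEdge c false) = 0 ∧ χ (G.outEdge c false) = 0 := by
    by_cases e : s c = G.positive c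
    · have e' : s' c ≠ G.positive c := fun e' => hc (e'.trans e.symm)
      constructor
      · refine if_neg fun k => hne' ?_
        rw [← k.2]
        exact Quot.sound (Joined.oriented c false e')
      · refine if_neg fun k => hne ?_
        rw [← k.1]
        exact (Quot.sound (Joined.unorientedOut c e)).symm
    · have e' : s' c = G.positive c := by
        revert hc e
        cases s c <;> cases s' c <;> cases G.positive c <;> simp
      constructor
      · refine if_neg fun k => hne ?_
        rw [← k.1]
        exact Quot.sound (Joined.oriented c false e)
      · refine if_neg fun k => hne' ?_
        rw [← k.2]
        exact (Quot.sound (Joined.unorientedOut c e')).symm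
  rw [Finset.sum_eq_single c, hin, hout, hfalse.1, hfalse.2] at hsum
  · simp at hsum
  · intro c' _ e
    by_cases k : s c' = G.positive c'
    · have k' : s' c' = G.positive c' := (h c' e).trans k
      rw [← hχ (Joined.unorientedIn c' k) (Joined.unorientedIn c' k'),
        ← hχ (Joined.unorientedOut c' k) (Joined.unorientedOut c' k')]
      exact ZModModule.add_self _
    · have k' : s' c' ≠ G.positive c' := fun k' => k ((h c' e).symm.trans k')
      rw [hχ (Joined.oriented c' true k) (Joined.oriented c' true k'),
        hχ (Joined.oriented c' false k) (Joined.oriented c' false k'),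
        add_comm (χ (G.outEdge c' !true))]
      exact ZModModule.add_self _
  · simp

/-- The circles of `s'` are those of `s`, except that the two circles of `s` that touch `c` have
become one. -/
def Merges (s s' : G.Cr → Bool) (c : G.Cr) : Prop :=
  circ s (G.inEdge c true) ≠ circ s (G.outEdge c true) ∧
  ∀ p q, circ s' p = circ s' q ↔ circ s p = circ s q ∨ Touches s c p ∧ Touches s c q

theorem merges_of_circ_ne (h : ∀ c', c' ≠ c → s' c' = s c') (hc : s' c ≠ s c)
    (hne : circ s (G.inEdge c true) ≠ circ s (G.outEdge c true)) : Merges s s' c := by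
  have hj := circ_eq_of_circ_ne h hc hne
  have hmono {p q : G.Pt} : circ s p = circ s q → circ s' p = circ s' q :=
    circ_eq_of_circ_eq (fun c' e => (h c' e).symm) hj
  have htouch {p : G.Pt} : Touches s c p → circ s' p = circ s' (G.inEdge c true)
    | Or.inl e => hmono e
    | Or.inr e => (hmono e).trans hj.symm
  refine ⟨hne, fun p q => ⟨circ_eq_or_touches h, ?_⟩⟩
  rintro (e | ⟨e, e'⟩)
  · exact hmono e
  · exact (htouch e).trans (htouch e').symm

theorem Merges.mono (h : Merges s s' c) (e : circ s p = circ s q) : circ s' p = circ s' q :=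
  (h.2 p q).2 (Or.inl e)

theorem Merges.circ_eq (h : Merges s s' c) :
    circ s' (G.inEdge c true) = circ s' (G.outEdge c true) :=
  (h.2 _ _).2 (Or.inr ⟨Or.inl rfl, Or.inr rfl⟩)

theorem Merges.circ_eq_inEdge_iff (h : Merges s s' c) :
    circ s' p = circ s' (G.inEdge c true) ↔ Touches s c p := by
  rw [h.2]
  constructor
  · rintro (e | ⟨e, -⟩)
    · exact Or.inl e
    · exact e
  · exact fun e => Or.inr ⟨e, Or.inl rfl⟩

theorem Merges.touches_iff (h : Merges s s' c) : Touches s' c p ↔ Touches s c p := by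
  rw [← h.circ_eq_inEdge_iff, Touches, ← h.circ_eq, or_self]

theorem Merges.circ_eq_iff_of_not_touches (h : Merges s s' c) (hp : ¬ Touches s c p) :
    circ s' q = circ s' p ↔ circ s q = circ s p := by
  rw [h.2]
  exact or_iff_left fun e => hp e.2

/-- The possible effects of a change of the smoothing of one crossing; the last one, in which a
single circle stays a single circle, does not occur for planar diagrams. -/
theorem merges_or_merges_or (h : ∀ c', c' ≠ c → s' c' = s c') (hc : s' c ≠ s c) :
    Merges s s' c ∨ Merges s' s c ∨
      circ s (G.inEdge c true) = circ s (G.outEdge c true) ∧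
      circ s' (G.inEdge c true) = circ s' (G.outEdge c true) := by
  by_cases h1 : circ s (G.inEdge c true) = circ s (G.outEdge c true)
  · by_cases h2 : circ s' (G.inEdge c true) = circ s' (G.outEdge c true)
    · exact Or.inr (Or.inr ⟨h1, h2⟩)
    · exact Or.inr (Or.inl (merges_of_circ_ne (fun c' e => (h c' e).symm) hc.symm h2))
  · exact Or.inl (merges_of_circ_ne h hc h1)

end Smoothings

/-! ### Generators as labelled edges -/

theorem Gen.label_congr {g : G.Gen} {p q : G.Pt} (h : circ g.1 p = circ g.1 q) :
    g.label p = g.label q := congrArg g.2 h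

theorem Gen.ext_label {g g' : G.Gen} (h : g.1 = g'.1) (hl : ∀ p, g.label p = g'.label p) :
    g = g' := by
  obtain ⟨s, l⟩ := g
  obtain ⟨s', l'⟩ := g'
  obtain rfl : s = s' := h
  congr 1
  funext Z
  induction Z using Quot.ind with
  | mk p => exact hl p

/-- The generator in which an edge `p` lies on a circle with label `l p`. -/
def ofLabel (s : G.Cr → Bool) (l : G.Pt → Bool)
    (hl : ∀ p q, circ s p = circ s q → l p = l q) : G.Gen :=
  ⟨s, Quot.lift l fun p q hpq => hl p q (Quot.sound hpq)⟩

/-- The generator with label `+` on all circles. -/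
def allPlus (s : G.Cr → Bool) : G.Gen := ofLabel s (fun _ => true) fun _ _ _ => rfl

/-- Changes the label of the circle through the edge `p`. -/
def Gen.flip (g : G.Gen) (p : G.Pt) : G.Gen :=
  ofLabel g.1 (fun q => if circ g.1 q = circ g.1 p then !g.label q else g.label q) fun q r h => by
    rw [h, Gen.label_congr h]

@[simp]
theorem Gen.flip_fst (g : G.Gen) (p : G.Pt) : (g.flip p).1 = g.1 := rfl

theorem Gen.flip_label (g : G.Gen) (p q : G.Pt) :
    (g.flip p).label q = if circ g.1 q = circ g.1 p then !g.label q else g.label q := rfl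

theorem Gen.flip_label_of_eq {g : G.Gen} {p q : G.Pt} (h : circ g.1 q = circ g.1 p) :
    (g.flip p).label q = !g.label q := if_pos h

theorem Gen.flip_label_of_ne {g : G.Gen} {p q : G.Pt} (h : circ g.1 q ≠ circ g.1 p) :
    (g.flip p).label q = g.label q := if_neg h

theorem Gen.flip_flip (g : G.Gen) (p : G.Pt) : (g.flip p).flip p = g := by
  refine Gen.ext_label rfl fun q => ?_
  simp only [Gen.flip_label, Gen.flip_fst]
  split_ifs <;> simp

theorem Gen.flip_comm (g : G.Gen) (p q : G.Pt) : (g.flip p).flip q = (g.flip q).flip p := by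
  refine Gen.ext_label rfl fun r => ?_
  by_cases hp : circ g.1 r = circ g.1 p <;> by_cases hq : circ g.1 r = circ g.1 q
  · rw [Gen.flip_label_of_eq (g := g.flip p) hq, Gen.flip_label_of_eq hp,
      Gen.flip_label_of_eq (g := g.flip q) hp, Gen.flip_label_of_eq hq]
  · rw [Gen.flip_label_of_ne (g := g.flip p) hq, Gen.flip_label_of_eq hp,
      Gen.flip_label_of_eq (g := g.flip q) hp, Gen.flip_label_of_ne hq]
  · rw [Gen.flip_label_of_eq (g := g.flip p) hq, Gen.flip_label_of_ne hp,
      Gen.flip_label_of_ne (g := g.flip q) hp, Gen.flip_label_of_eq hq]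
  · rw [Gen.flip_label_of_ne (g := g.flip p) hq, Gen.flip_label_of_ne hp,
      Gen.flip_label_of_ne (g := g.flip q) hp, Gen.flip_label_of_ne hq]

theorem Gen.flip_congr {g : G.Gen} {p q : G.Pt} (h : circ g.1 p = circ g.1 q) :
    g.flip p = g.flip q := by
  refine Gen.ext_label rfl fun r => ?_
  rw [Gen.flip_label, Gen.flip_label, h]

theorem Gen.eq_flip_iff {g g' : G.Gen} {p : G.Pt} : g' = g.flip p ↔ g = g'.flip p := by
  constructor
  · rintro rfl
    exact (g.flip_flip p).symm
  · rintro rfl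
    exact (g'.flip_flip p).symm

theorem Gen.mk_update {g : G.Gen} {p : G.Pt} {b : Bool} (h : g.label p = !b) :
    (⟨g.1, Function.update g.2 (circ g.1 p) b⟩ : G.Gen) = g.flip p := by
  refine Gen.ext_label rfl fun q => ?_
  rw [Gen.flip_label]
  change Function.update g.2 (circ g.1 p) b (circ g.1 q) = _
  rw [Function.update_apply]
  split_ifs with e
  · rw [Gen.label_congr e, h, Bool.not_not]
  · rfl

/-! ### The terms of the edge maps -/

section EdgeTerms

variable {merge split : Bool → Bool → Bool → Prop} {c : G.Cr} {g g' : G.Gen}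

/-- The labels of the circles that do not touch `c` agree. -/
def AgreeOff (c : G.Cr) (g g' : G.Gen) : Prop := ∀ p, ¬ Touches g.1 c p → g'.label p = g.label p

theorem EdgeTerm.agreeOff (h : EdgeTerm merge split c g g') : AgreeOff c g g' := fun p hp =>
  h.2.2.1 p (fun e => hp (Or.inl e)) fun e => hp (Or.inr e)

theorem edgeTerm_iff_of_merges (hc : g.1 c = false) (hs : g'.1 = Function.update g.1 c true)
    (h : Merges g.1 g'.1 c) : EdgeTerm merge split c g g' ↔ AgreeOff c g g' ∧
      merge (g.label (G.inEdge c true)) (g.label (G.outEdge c true))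
        (g'.label (G.inEdge c true)) := by
  constructor
  · intro k
    refine ⟨k.agreeOff, ?_⟩
    rcases k.2.2.2 with k | k
    · exact k.2.2
    · exact absurd k.1 h.1
  · rintro ⟨k1, k2⟩
    exact ⟨hc, hs, fun p h1 h2 => k1 p (not_or.2 ⟨h1, h2⟩), Or.inl ⟨h.1, h.circ_eq, k2⟩⟩

theorem edgeTerm_iff_of_splits (hc : g.1 c = false) (hs : g'.1 = Function.update g.1 c true)
    (h : Merges g'.1 g.1 c) : EdgeTerm merge split c g g' ↔ AgreeOff c g g' ∧
      split (g.label (G.inEdge c true)) (g'.label (G.inEdge c true))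
        (g'.label (G.outEdge c true)) := by
  constructor
  · intro k
    refine ⟨k.agreeOff, ?_⟩
    rcases k.2.2.2 with k | k
    · exact absurd h.circ_eq k.1
    · exact k.2.2
  · rintro ⟨k1, k2⟩
    exact ⟨hc, hs, fun p h1 h2 => k1 p (not_or.2 ⟨h1, h2⟩), Or.inr ⟨h.circ_eq, h.1, k2⟩⟩

theorem not_edgeTerm_of_circ_eq
    (h : circ g.1 (G.inEdge c true) = circ g.1 (G.outEdge c true))
    (h' : circ g'.1 (G.inEdge c true) = circ g'.1 (G.outEdge c true)) :
    ¬ EdgeTerm merge split c g g' := by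
  intro k
  rcases k.2.2.2 with k | k
  · exact k.1 h
  · exact k.2.1 h'

theorem update_off {s s' : G.Cr → Bool} (hs : s' = Function.update s c true) :
    ∀ c', c' ≠ c → s' c' = s c' := fun c' e => by rw [hs, Function.update_of_ne e]

theorem update_ne {s s' : G.Cr → Bool} (hc : s c = false) (hs : s' = Function.update s c true) :
    s' c ≠ s c := by rw [hs, Function.update_self, hc]; decide

theorem EdgeTerm.merges_or (h : EdgeTerm merge split c g g') :
    Merges g.1 g'.1 c ∨ Merges g'.1 g.1 c := by
  rcases merges_or_merges_or (update_off h.2.1) (update_ne h.1 h.2.1) with k | k | k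
  · exact Or.inl k
  · exact Or.inr k
  · exact absurd h (not_edgeTerm_of_circ_eq k.1 k.2)

theorem EdgeTerm.crossing_unique {merge' split' : Bool → Bool → Bool → Prop} {c' : G.Cr}
    (h : EdgeTerm merge split c g g') (h' : EdgeTerm merge' split' c' g g') : c' = c := by
  by_contra e
  have h1 := update_off h.2.1 c' e
  exact update_ne h'.1 h'.2.1 h1

end EdgeTerms

/-! ### The Khovanov and Lee differentials over `𝔽₂[t]` and multiplication by `X`

The space of labels of one circle is the algebra `𝔽₂[t][X] / (X² - t)`, with `+` for `1` and `-`
for `X`.  Its multiplication and comultiplication are the Khovanov maps plus `t` times the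
Lee maps. -/

section Deformed

variable {R : Type*} [CommRing R] (t : R)

/-- The coefficient in the multiplication by `X`, which exchanges `+` and `-`. -/
def xCoef : Bool → R
  | true => 1
  | false => t

/-- Multiplication by `X` on the circle through the edge `p`. -/
def xMat (p : G.Pt) : Matrix G.Gen G.Gen R :=
  Matrix.of fun g' g => if g' = g.flip p then xCoef t (g.label p) else 0

/-- The edge maps at the crossing `c`: the Khovanov maps plus `t` times the Lee maps. -/
def edgeMat (c : G.Cr) : Matrix G.Gen G.Gen R :=
  Matrix.of fun g' g => (if EdgeTerm khMerge khSplit c g g' then 1 else 0) +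
    t * (if EdgeTerm leeMerge leeSplit c g g' then 1 else 0)

/-- The structure constants of the multiplication. -/
def mergeCoef (x y z : Bool) : R :=
  (if khMerge x y z then 1 else 0) + t * (if leeMerge x y z then 1 else 0)

/-- The structure constants of the comultiplication. -/
def splitCoef (x y z : Bool) : R :=
  (if khSplit x y z then 1 else 0) + t * (if leeSplit x y z then 1 else 0)

theorem mergeCoef_comm (x y z : Bool) : mergeCoef t x y z = mergeCoef t y x z := by
  cases x <;> cases y <;> cases z <;> simp [mergeCoef, khMerge, leeMerge]

theorem splitCoef_comm (x y z : Bool) : splitCoef t x y z = splitCoef t x z y := by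
  cases x <;> cases y <;> cases z <;> simp [splitCoef, khSplit, leeSplit]

theorem mergeCoef_not (x y z : Bool) :
    mergeCoef t (!x) y z * xCoef t x = xCoef t (!z) * mergeCoef t x y (!z) := by
  cases x <;> cases y <;> cases z <;> simp [mergeCoef, khMerge, leeMerge, xCoef]

theorem splitCoef_not (x y z : Bool) :
    splitCoef t (!x) y z * xCoef t x = xCoef t (!y) * splitCoef t x (!y) z := by
  cases x <;> cases y <;> cases z <;> simp [splitCoef, khSplit, leeSplit, xCoef]

theorem edgeMat_of_merges {c : G.Cr} {g g' : G.Gen} (hc : g.1 c = false)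
    (hs : g'.1 = Function.update g.1 c true) (h : Merges g.1 g'.1 c) :
    edgeMat t c g' g = if AgreeOff c g g' then
      mergeCoef t (g.label (G.inEdge c true)) (g.label (G.outEdge c true))
        (g'.label (G.inEdge c true)) else 0 := by
  rw [edgeMat, Matrix.of_apply, edgeTerm_iff_of_merges hc hs h, edgeTerm_iff_of_merges hc hs h]
  by_cases k : AgreeOff c g g' <;> simp [k, mergeCoef]

theorem edgeMat_of_splits {c : G.Cr} {g g' : G.Gen} (hc : g.1 c = false)
    (hs : g'.1 = Function.update g.1 c true) (h : Merges g'.1 g.1 c) :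
    edgeMat t c g' g = if AgreeOff c g g' then
      splitCoef t (g.label (G.inEdge c true)) (g'.label (G.inEdge c true))
        (g'.label (G.outEdge c true)) else 0 := by
  rw [edgeMat, Matrix.of_apply, edgeTerm_iff_of_splits hc hs h, edgeTerm_iff_of_splits hc hs h]
  by_cases k : AgreeOff c g g' <;> simp [k, splitCoef]

theorem edgeMat_of_circ_eq {c : G.Cr} {g g' : G.Gen}
    (h : circ g.1 (G.inEdge c true) = circ g.1 (G.outEdge c true))
    (h' : circ g'.1 (G.inEdge c true) = circ g'.1 (G.outEdge c true)) :
    edgeMat t c g' g = 0 := by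
  rw [edgeMat, Matrix.of_apply, if_neg (not_edgeTerm_of_circ_eq h h'),
    if_neg (not_edgeTerm_of_circ_eq h h'), mul_zero, add_zero]

theorem edgeMat_of_not {c : G.Cr} {g g' : G.Gen}
    (h : ¬ (g.1 c = false ∧ g'.1 = Function.update g.1 c true)) : edgeMat t c g' g = 0 := by
  rw [edgeMat, Matrix.of_apply, if_neg fun k => h ⟨k.1, k.2.1⟩, if_neg fun k => h ⟨k.1, k.2.1⟩,
    mul_zero, add_zero]

theorem xMat_mul_apply (p : G.Pt) (A : Matrix G.Gen G.Gen R) (g' g : G.Gen) :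
    (xMat t p * A) g' g = xCoef t (!g'.label p) * A (g'.flip p) g := by
  rw [Matrix.mul_apply, Finset.sum_eq_single (g'.flip p)]
  · rw [xMat, Matrix.of_apply, if_pos (g'.flip_flip p).symm, Gen.flip_label_of_eq rfl]
  · intro k _ hk
    rw [xMat, Matrix.of_apply, if_neg fun e => hk (Gen.eq_flip_iff.1 e), zero_mul]
  · simp

theorem mul_xMat_apply (p : G.Pt) (A : Matrix G.Gen G.Gen R) (g' g : G.Gen) :
    (A * xMat t p) g' g = A g' (g.flip p) * xCoef t (g.label p) := by
  rw [Matrix.mul_apply, Finset.sum_eq_single (g.flip p)]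
  · rw [xMat, Matrix.of_apply, if_pos rfl]
  · intro k _ hk
    rw [xMat, Matrix.of_apply, if_neg hk, mul_zero]
  · simp

theorem agreeOff_flip_iff {c : G.Cr} {p : G.Pt} {g g' : G.Gen}
    (h : Merges g.1 g'.1 c ∨ Merges g'.1 g.1 c) (hp : ¬ Touches g.1 c p) :
    AgreeOff c (g.flip p) g' ↔ AgreeOff c g (g'.flip p) := by
  have key (q : G.Pt) : circ g'.1 q = circ g'.1 p ↔ circ g.1 q = circ g.1 p := by
    rcases h with h | h
    · exact h.circ_eq_iff_of_not_touches hp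
    · exact (h.circ_eq_iff_of_not_touches (h.touches_iff.not.1 hp)).symm
  refine forall_congr' fun q => imp_congr_right fun _ => ?_
  by_cases hq : circ g.1 q = circ g.1 p
  · rw [Gen.flip_label_of_eq hq, Gen.flip_label_of_eq ((key q).2 hq)]
    cases g.label q <;> cases g'.label q <;> simp
  · rw [Gen.flip_label_of_ne hq, Gen.flip_label_of_ne ((key q).not.2 hq)]

theorem agreeOff_flip_left {c : G.Cr} {p : G.Pt} {g g' : G.Gen} (hp : Touches g.1 c p) :
    AgreeOff c (g.flip p) g' ↔ AgreeOff c g g' := by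
  refine forall_congr' fun q => imp_congr_right fun hq => ?_
  rw [Gen.flip_label_of_ne (g := g) fun e => hq (hp.congr e)]

theorem agreeOff_flip_right {c : G.Cr} {p : G.Pt} {g g' : G.Gen}
    (h : Merges g.1 g'.1 c ∨ Merges g'.1 g.1 c) (hp : Touches g.1 c p) :
    AgreeOff c g (g'.flip p) ↔ AgreeOff c g g' := by
  refine forall_congr' fun q => imp_congr_right fun hq => ?_
  rw [Gen.flip_label_of_ne fun e => hq ?_]
  rcases h with h | h
  · rw [← h.touches_iff] at hp ⊢
    exact hp.congr e
  · rw [h.touches_iff] at hp ⊢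
    exact hp.congr e

/-- The edge maps are linear over the multiplication by `X` on any edge. -/
theorem edgeMat_mul_xMat (c : G.Cr) (p : G.Pt) :
    edgeMat t c * xMat t p = xMat t p * edgeMat (G := G) t c := by
  ext g' g
  rw [xMat_mul_apply, mul_xMat_apply]
  by_cases hcs : g.1 c = false ∧ g'.1 = Function.update g.1 c true
  swap
  · rw [edgeMat_of_not (g := g.flip p) t hcs, edgeMat_of_not (g' := g'.flip p) t hcs, zero_mul,
      mul_zero]
  obtain ⟨hc, hs⟩ := hcs
  rcases merges_or_merges_or (update_off hs) (update_ne hc hs) with h | h | h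
  · rw [edgeMat_of_merges (g := g.flip p) t hc hs h, edgeMat_of_merges (g' := g'.flip p) t hc hs h]
    by_cases hp : Touches g.1 c p
    · rw [agreeOff_flip_left hp, agreeOff_flip_right (Or.inl h) hp]
      split_ifs with k
      · rw [Gen.flip_label_of_eq (g := g') (h.circ_eq_inEdge_iff.2 hp).symm,
          Gen.label_congr (g := g') (h.circ_eq_inEdge_iff.2 hp)]
        rcases hp with hp | hp
        · rw [Gen.flip_label_of_eq hp.symm, Gen.flip_label_of_ne fun e => h.1 (e.trans hp).symm,
            Gen.label_congr hp, mergeCoef_not]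
        · rw [Gen.flip_label_of_eq hp.symm, Gen.flip_label_of_ne fun e => h.1 (e.trans hp),
            Gen.label_congr hp, mergeCoef_comm, mergeCoef_not, mergeCoef_comm]
      · rw [zero_mul, mul_zero]
    · rw [agreeOff_flip_iff (Or.inl h) hp]
      split_ifs with k
      · have hl := k p hp
        rw [Gen.flip_label_of_eq rfl] at hl
        rw [Gen.flip_label_of_ne fun e => hp (Or.inl e.symm),
          Gen.flip_label_of_ne fun e => hp (Or.inr e.symm),
          Gen.flip_label_of_ne fun e => hp (h.circ_eq_inEdge_iff.1 e.symm), hl, mul_comm]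
      · rw [zero_mul, mul_zero]
  · rw [edgeMat_of_splits (g := g.flip p) t hc hs h, edgeMat_of_splits (g' := g'.flip p) t hc hs h]
    by_cases hp : Touches g.1 c p
    · rw [agreeOff_flip_left hp, agreeOff_flip_right (Or.inr h) hp]
      have hp' := h.touches_iff.1 hp
      have hpa := h.circ_eq_inEdge_iff.2 hp'
      split_ifs with k
      · rw [Gen.flip_label_of_eq (g := g) hpa.symm, Gen.label_congr (g := g) hpa]
        rcases hp' with hp' | hp'
        · rw [Gen.flip_label_of_eq hp'.symm, Gen.flip_label_of_ne fun e => h.1 (e.trans hp').symm,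
            Gen.label_congr hp', splitCoef_not]
        · rw [Gen.flip_label_of_eq hp'.symm, Gen.flip_label_of_ne fun e => h.1 (e.trans hp'),
            Gen.label_congr hp', splitCoef_comm, splitCoef_not, splitCoef_comm]
      · rw [zero_mul, mul_zero]
    · rw [agreeOff_flip_iff (Or.inr h) hp]
      have hp' := h.touches_iff.not.1 hp
      split_ifs with k
      · have hl := k p hp
        rw [Gen.flip_label_of_eq rfl] at hl
        rw [Gen.flip_label_of_ne fun e => hp (Or.inl e.symm),
          Gen.flip_label_of_ne fun e => hp' (Or.inl e.symm),
          Gen.flip_label_of_ne fun e => hp' (Or.inr e.symm), hl, mul_comm]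
      · rw [zero_mul, mul_zero]
  · rw [edgeMat_of_circ_eq (g := g.flip p) t h.1 h.2,
      edgeMat_of_circ_eq (g' := g'.flip p) t h.1 h.2,
      zero_mul, mul_zero]

theorem xCoef_not_mul (b : Bool) : xCoef t (!b) * xCoef t b = t := by
  cases b <;> simp [xCoef]

theorem xMat_comm (p q : G.Pt) : xMat t p * xMat t q = xMat t q * xMat (G := G) t p := by
  ext g' g
  rw [mul_xMat_apply, mul_xMat_apply, xMat, xMat, Matrix.of_apply, Matrix.of_apply,
    Gen.flip_comm g q p, ite_mul, ite_mul, zero_mul, zero_mul]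
  congr 1
  by_cases h : circ g.1 p = circ g.1 q
  · rw [Gen.flip_label_of_eq h, Gen.flip_label_of_eq h.symm, Gen.label_congr h]
  · rw [Gen.flip_label_of_ne h, Gen.flip_label_of_ne (Ne.symm h), mul_comm]

theorem xMat_mul_self (p : G.Pt) : xMat t p * xMat t p = t • (1 : Matrix G.Gen G.Gen R) := by
  ext g' g
  rw [mul_xMat_apply, xMat, Matrix.of_apply, Gen.flip_flip, Gen.flip_label_of_eq rfl, ite_mul,
    xCoef_not_mul, zero_mul, Matrix.smul_apply, Matrix.one_apply, smul_eq_mul, mul_ite, mul_one,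
    mul_zero]

/-- The basis vector of a generator. -/
abbrev genVec (R : Type*) [CommRing R] (g : G.Gen) : G.Gen → R := Pi.single g 1

theorem genVec_apply (g g' : G.Gen) : genVec R g g' = if g' = g then 1 else 0 :=
  Pi.single_apply _ _ _

theorem mulVec_genVec (A : Matrix G.Gen G.Gen R) (g g' : G.Gen) :
    A.mulVec (genVec R g) g' = A g' g := by
  rw [genVec, Matrix.mulVec_single_one]
  rfl

theorem xMat_mulVec_genVec (p : G.Pt) (g : G.Gen) :
    (xMat t p).mulVec (genVec R g) = xCoef t (g.label p) • genVec R (g.flip p) := by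
  funext g'
  rw [mulVec_genVec, xMat, Matrix.of_apply, Pi.smul_apply, genVec_apply, smul_eq_mul, mul_ite,
    mul_one, mul_zero]

theorem xMat_mulVec_congr {p q : G.Pt} {g : G.Gen} (h : circ g.1 p = circ g.1 q) :
    (xMat t p).mulVec (genVec R g) = (xMat t q).mulVec (genVec R g) := by
  rw [xMat_mulVec_genVec, xMat_mulVec_genVec, Gen.label_congr h, Gen.flip_congr h]

/-- A matrix that commutes with the multiplications by `X` is determined by its values on the
generators without label `-`. -/
theorem eq_zero_of_commute_xMat {A : Matrix G.Gen G.Gen R}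
    (hA : ∀ p, A * xMat t p = xMat t p * A)
    (h0 : ∀ s, A.mulVec (genVec R (allPlus s)) = 0) : A = 0 := by
  have key : ∀ (n : ℕ) (g : G.Gen),
      (Finset.univ.filter fun p => g.label p = false).card = n → A.mulVec (genVec R g) = 0 := by
    intro n
    induction n using Nat.strong_induction_on with
    | _ n ih =>
      intro g hg
      by_cases h : ∃ p, g.label p = false
      · obtain ⟨p, hp⟩ := h
        have hlt : (Finset.univ.filter fun q => (g.flip p).label q = false).card < n := by
          rw [← hg]
          refine Finset.card_lt_card (Finset.ssubset_iff_subset_ne.2 ⟨?_, ?_⟩)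
          · intro q
            simp only [Finset.mem_filter, Finset.mem_univ, true_and]
            intro hq
            by_cases e : circ g.1 q = circ g.1 p
            · rw [Gen.label_congr e, hp]
            · rwa [Gen.flip_label_of_ne e] at hq
          · intro e
            have : p ∈ Finset.univ.filter fun q => g.label q = false := by simpa using hp
            rw [← e, Finset.mem_filter, Gen.flip_label_of_eq rfl, hp] at this
            exact absurd this.2 (by decide)
        have := xMat_mulVec_genVec t p (g.flip p)
        rw [Gen.flip_flip, Gen.flip_label_of_eq rfl, hp] at this
        change _ = (1 : R) • _ at this
        rw [one_smul] at this
        rw [← this, Matrix.mulVec_mulVec, hA, ← Matrix.mulVec_mulVec, ih _ hlt _ rfl,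
          Matrix.mulVec_zero]
      · have : g = allPlus g.1 := by
          refine Gen.ext_label rfl fun p => ?_
          change _ = true
          by_contra e
          exact h ⟨p, by simpa using e⟩
        rw [this]
        exact h0 _
  ext g' g
  rw [← mulVec_genVec A, key _ g rfl]
  rfl

/-- Multiplication by the sum of the two classes `X` at the crossing `c`, which gives the
comultiplication of the unit. -/
def handleMat (c : G.Cr) : Matrix G.Gen G.Gen R :=
  xMat t (G.inEdge c true) + xMat t (G.outEdge c true)

theorem edgeMat_mulVec_of_true {c : G.Cr} {g : G.Gen} (h : g.1 c = true) :
    (edgeMat t c).mulVec (genVec R g) = 0 := by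
  funext g'
  rw [mulVec_genVec, edgeMat_of_not]
  · rfl
  · rw [h]
    simp

theorem edgeMat_mulVec_allPlus_of_ne {s : G.Cr → Bool} {c : G.Cr} (hc : s c = false)
    (h : circ s (G.inEdge c true) ≠ circ s (G.outEdge c true)) :
    (edgeMat t c).mulVec (genVec R (allPlus s)) =
      genVec R (allPlus (Function.update s c true)) := by
  funext g'
  rw [mulVec_genVec, genVec_apply]
  by_cases hs : g'.1 = Function.update s c true
  swap
  · rw [edgeMat_of_not t fun e => hs e.2, if_neg]
    rintro rfl
    exact hs rfl
  have hm : Merges s g'.1 c := merges_of_circ_ne (update_off hs) (update_ne hc hs) h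
  rw [edgeMat_of_merges t hc hs hm]
  change (if _ then mergeCoef t true true _ else 0) = _
  split_ifs with h1 h2 h2
  · rw [h2]
    change mergeCoef t true true true = 1
    simp [mergeCoef, khMerge, leeMerge]
  · cases hl : g'.label (G.inEdge c true)
    · simp [mergeCoef, khMerge, leeMerge]
    · refine absurd (Gen.ext_label hs fun p => ?_) h2
      by_cases hp : Touches s c p
      · rw [Gen.label_congr (hm.circ_eq_inEdge_iff.2 hp), hl]
        rfl
      · exact h1 p hp
  · refine absurd (fun p _ => ?_) h1
    rw [h2]
    rfl
  · rfl

theorem eq_flip_allPlus_iff {s : G.Cr → Bool} {c : G.Cr} {g' : G.Gen} (h : Merges g'.1 s c) :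
    (g' = (allPlus g'.1).flip (G.inEdge c true) ↔ AgreeOff c (allPlus s) g' ∧
      g'.label (G.inEdge c true) = false ∧ g'.label (G.outEdge c true) = true) ∧
    (g' = (allPlus g'.1).flip (G.outEdge c true) ↔ AgreeOff c (allPlus s) g' ∧
      g'.label (G.inEdge c true) = true ∧ g'.label (G.outEdge c true) = false) := by
  have hoff {p q : G.Pt} (hq : Touches s c q) (hp : ¬ Touches s c p) : circ g'.1 p ≠ circ g'.1 q :=
    fun e => hp (h.touches_iff.2 ((h.touches_iff.1 hq).congr e))
  constructor
  · constructor
    · intro e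
      have hl (p : G.Pt) := congrArg (fun g => Gen.label g p) e
      refine ⟨fun p hp => ?_, ?_, ?_⟩
      · exact (hl p).trans (Gen.flip_label_of_ne (hoff (touches_inEdge s c true) hp))
      · exact (hl _).trans (Gen.flip_label_of_eq rfl)
      · exact (hl _).trans (Gen.flip_label_of_ne (Ne.symm h.1))
    · rintro ⟨h1, h2, h3⟩
      refine Gen.ext_label rfl fun p => ?_
      by_cases e : circ g'.1 p = circ g'.1 (G.inEdge c true)
      · rw [Gen.flip_label_of_eq (g := allPlus g'.1) e, Gen.label_congr e, h2]
        rfl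
      · rw [Gen.flip_label_of_ne (g := allPlus g'.1) e]
        by_cases hp : Touches s c p
        · rw [Gen.label_congr ((h.touches_iff.1 hp).resolve_left e), h3]
          rfl
        · exact h1 p hp
  · constructor
    · intro e
      have hl (p : G.Pt) := congrArg (fun g => Gen.label g p) e
      refine ⟨fun p hp => ?_, ?_, ?_⟩
      · exact (hl p).trans (Gen.flip_label_of_ne (hoff (touches_outEdge s c true) hp))
      · exact (hl _).trans (Gen.flip_label_of_ne h.1)
      · exact (hl _).trans (Gen.flip_label_of_eq rfl)
    · rintro ⟨h1, h2, h3⟩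
      refine Gen.ext_label rfl fun p => ?_
      by_cases e : circ g'.1 p = circ g'.1 (G.outEdge c true)
      · rw [Gen.flip_label_of_eq (g := allPlus g'.1) e, Gen.label_congr e, h3]
        rfl
      · rw [Gen.flip_label_of_ne (g := allPlus g'.1) e]
        by_cases hp : Touches s c p
        · rw [Gen.label_congr ((h.touches_iff.1 hp).resolve_right e), h2]
          rfl
        · exact h1 p hp

theorem handleMat_mulVec (c : G.Cr) (g : G.Gen) :
    (handleMat t c).mulVec (genVec R g) = (xMat t (G.inEdge c true)).mulVec (genVec R g) +
      (xMat t (G.outEdge c true)).mulVec (genVec R g) := Matrix.add_mulVec _ _ _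

variable [CharP R 2]

theorem handleMat_mulVec_of_circ_eq {c : G.Cr} {g : G.Gen}
    (h : circ g.1 (G.inEdge c true) = circ g.1 (G.outEdge c true)) :
    (handleMat t c).mulVec (genVec R g) = 0 := by
  rw [handleMat_mulVec, xMat_mulVec_congr t h]
  funext g'
  exact CharTwo.add_self_eq_zero _

theorem edgeMat_mulVec_allPlus_of_eq {s : G.Cr → Bool} {c : G.Cr} (hc : s c = false)
    (h : circ s (G.inEdge c true) = circ s (G.outEdge c true)) :
    (edgeMat t c).mulVec (genVec R (allPlus s)) =
      (handleMat t c).mulVec (genVec R (allPlus (Function.update s c true))) := by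
  funext g'
  rw [mulVec_genVec]
  by_cases hs : g'.1 = Function.update s c true
  swap
  · rw [edgeMat_of_not t fun e => hs e.2, handleMat_mulVec, xMat_mulVec_genVec,
      xMat_mulVec_genVec, Pi.add_apply, Pi.smul_apply, Pi.smul_apply, genVec_apply, genVec_apply,
      if_neg, if_neg, smul_zero, smul_zero, add_zero]
    · rintro rfl
      exact hs rfl
    · rintro rfl
      exact hs rfl
  rcases merges_or_merges_or (update_off hs) (update_ne hc hs) with hm | hm | hm
  · exact absurd h hm.1
  · rw [edgeMat_of_splits (g := allPlus s) t hc hs hm, handleMat_mulVec, xMat_mulVec_genVec,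
      xMat_mulVec_genVec, Pi.add_apply, Pi.smul_apply, Pi.smul_apply, genVec_apply, genVec_apply,
      ← hs]
    simp only [(eq_flip_allPlus_iff hm).1, (eq_flip_allPlus_iff hm).2]
    change (if _ then splitCoef t true _ _ else 0) = (1 : R) • _ + (1 : R) • _
    by_cases k : AgreeOff c (allPlus s) g'
    · cases g'.label (G.inEdge c true) <;> cases g'.label (G.outEdge c true) <;>
        simp [k, splitCoef, khSplit, leeSplit]
    · simp [k]
  · rw [edgeMat_of_circ_eq (g := allPlus s) t hm.1 hm.2, handleMat_mulVec_of_circ_eq t (hs ▸ hm.2)]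
    rfl

end Deformed

/-! ### The deformed differential squares to zero -/

section Deformed

variable {R : Type*} [CommRing R] (t : R)

theorem edgeMat_mul_self (c : G.Cr) : edgeMat t c * edgeMat (G := G) t c = 0 := by
  ext g'' g
  rw [Matrix.mul_apply]
  refine Finset.sum_eq_zero fun g' _ => ?_
  by_cases h : g.1 c = false ∧ g'.1 = Function.update g.1 c true
  · rw [edgeMat_of_not t (g := g'), zero_mul]
    rw [h.2, Function.update_self]
    simp
  · rw [edgeMat_of_not t h, mul_zero]

/-- The comultiplication factor of an edge map: the edge map at `c` sends the generator
without label `-` of the smoothing `s` to the product of this factor with the generator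
without label `-`. -/
def factorMat (s : G.Cr → Bool) (c : G.Cr) : Matrix G.Gen G.Gen R :=
  if circ s (G.inEdge c true) = circ s (G.outEdge c true) then handleMat t c else 1

theorem handleMat_comm (c c' : G.Cr) :
    handleMat t c * handleMat t c' = handleMat t c' * handleMat (G := G) t c := by
  simp only [handleMat, add_mul, mul_add, xMat_comm t (G.inEdge c true),
    xMat_comm t (G.outEdge c true)]
  abel

theorem edgeMat_mul_factorMat (c c' : G.Cr) (s : G.Cr → Bool) :
    edgeMat t c * factorMat t s c' = factorMat t s c' * edgeMat (G := G) t c := by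
  unfold factorMat
  split_ifs with h
  · simp only [handleMat, add_mul, mul_add, edgeMat_mul_xMat]
  · simp

variable [CharP R 2]

theorem edgeMat_mulVec_allPlus {s : G.Cr → Bool} {c : G.Cr} (hc : s c = false) :
    (edgeMat t c).mulVec (genVec R (allPlus s)) =
      (factorMat t s c).mulVec (genVec R (allPlus (Function.update s c true))) := by
  unfold factorMat
  split_ifs with h
  · exact edgeMat_mulVec_allPlus_of_eq t hc h
  · rw [edgeMat_mulVec_allPlus_of_ne t hc h, Matrix.one_mulVec]

section Square

variable {s : G.Cr → Bool} {c₁ c₂ : G.Cr}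

/-- If two circles touch `c`, but only one does so after the change of the smoothing of `c'`, then
these two circles also touch `c'`. -/
theorem touches_of_circ_ne_of_circ_eq {s s' : G.Cr → Bool} {c c' : G.Cr}
    (h : ∀ k, k ≠ c' → s' k = s k)
    (hn : circ s (G.inEdge c true) ≠ circ s (G.outEdge c true))
    (he : circ s' (G.inEdge c true) = circ s' (G.outEdge c true)) :
    (circ s (G.inEdge c' true) = circ s (G.inEdge c true) ∧
      circ s (G.outEdge c' true) = circ s (G.outEdge c true)) ∨
    (circ s (G.inEdge c' true) = circ s (G.outEdge c true) ∧
      circ s (G.outEdge c' true) = circ s (G.inEdge c true)) := by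
  rcases circ_eq_or_touches h he with e | ⟨e | e, e' | e'⟩
  · exact absurd e hn
  · exact absurd (e.trans e'.symm) hn
  · exact Or.inl ⟨e.symm, e'.symm⟩
  · exact Or.inr ⟨e'.symm, e.symm⟩
  · exact absurd (e.trans e'.symm) hn

/-- The two composites of edge maps around a square of the cube of resolutions agree on the
generator without label `-`. -/
theorem factorMat_square (hc : c₁ ≠ c₂) (h1 : s c₁ = false) (h2 : s c₂ = false) :
    (factorMat t s c₂ * factorMat t (Function.update s c₂ true) c₁).mulVec
      (genVec R (allPlus (Function.update (Function.update s c₁ true) c₂ true))) =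
    (factorMat t s c₁ * factorMat t (Function.update s c₁ true) c₂).mulVec
      (genVec R (allPlus (Function.update (Function.update s c₁ true) c₂ true))) := by
  set s₁ := Function.update s c₁ true with hs₁
  set s₂ := Function.update s c₂ true with hs₂
  set s₃ := Function.update s₁ c₂ true with hs₃
  have hs₃' : s₃ = Function.update s₂ c₁ true := Function.update_comm hc _ _ _
  have o1 : ∀ k, k ≠ c₁ → s₁ k = s k := update_off hs₁
  have o2 : ∀ k, k ≠ c₂ → s₂ k = s k := update_off hs₂
  have o3 : ∀ k, k ≠ c₂ → s₃ k = s₁ k := update_off hs₃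
  have o3' : ∀ k, k ≠ c₁ → s₃ k = s₂ k := update_off hs₃'
  have n1 : s₁ c₁ ≠ s c₁ := update_ne h1 hs₁
  have n2 : s₂ c₂ ≠ s c₂ := update_ne h2 hs₂
  have n3 : s₃ c₂ ≠ s₁ c₂ := update_ne (by rw [hs₁, Function.update_of_ne hc.symm, h2]) hs₃
  have n3' : s₃ c₁ ≠ s₂ c₁ := update_ne (by rw [hs₂, Function.update_of_ne hc, h1]) hs₃'
  have hzero {c : G.Cr} (e : circ s₃ (G.inEdge c true) = circ s₃ (G.outEdge c true)) :
      (handleMat t c).mulVec (genVec R (allPlus s₃)) = 0 :=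
    handleMat_mulVec_of_circ_eq t (g := allPlus s₃) e
  unfold factorMat
  by_cases e1 : circ s (G.inEdge c₁ true) = circ s (G.outEdge c₁ true) <;>
    by_cases e2 : circ s (G.inEdge c₂ true) = circ s (G.outEdge c₂ true)
  · -- Each of the crossings is touched by one circle only.  If the circle is split at one of them
    -- and the parts are joined again at the other, then the composite is multiplication by
    -- `X + X = 0`.  Otherwise both composites are the product of the two multiplications.
    have k1 (e : circ s₂ (G.inEdge c₁ true) ≠ circ s₂ (G.outEdge c₁ true)) :
        circ s₃ (G.inEdge c₁ true) = circ s₃ (G.outEdge c₁ true) ∧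
        circ s₃ (G.inEdge c₂ true) = circ s₃ (G.outEdge c₂ true) := by
      have m := merges_of_circ_ne o3' n3' e
      refine ⟨m.circ_eq, ?_⟩
      rcases touches_of_circ_ne_of_circ_eq (fun k hk => (o2 k hk).symm) e e1 with ⟨x, y⟩ | ⟨x, y⟩
      · rw [m.mono x, m.mono y, m.circ_eq]
      · rw [m.mono x, m.mono y, m.circ_eq]
    have k2 (e : circ s₁ (G.inEdge c₂ true) ≠ circ s₁ (G.outEdge c₂ true)) :
        circ s₃ (G.inEdge c₁ true) = circ s₃ (G.outEdge c₁ true) ∧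
        circ s₃ (G.inEdge c₂ true) = circ s₃ (G.outEdge c₂ true) := by
      have m := merges_of_circ_ne o3 n3 e
      refine ⟨?_, m.circ_eq⟩
      rcases touches_of_circ_ne_of_circ_eq (fun k hk => (o1 k hk).symm) e e2 with ⟨x, y⟩ | ⟨x, y⟩
      · rw [m.mono x, m.mono y, m.circ_eq]
      · rw [m.mono x, m.mono y, m.circ_eq]
    rw [if_pos e1, if_pos e2]
    by_cases e : circ s₃ (G.inEdge c₁ true) = circ s₃ (G.outEdge c₁ true) ∧
        circ s₃ (G.inEdge c₂ true) = circ s₃ (G.outEdge c₂ true)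
    · have z1 := hzero e.1
      have z2 := hzero e.2
      split_ifs <;> simp only [mul_one, ← Matrix.mulVec_mulVec, z1, z2, Matrix.mulVec_zero]
    · rw [if_pos (by by_contra k; exact e (k1 k)), if_pos (by by_contra k; exact e (k2 k)),
        handleMat_comm]
  · -- two circles touch `c₂`, but only one touches `c₁`
    have m := merges_of_circ_ne o2 n2 e2
    rw [if_pos e1, if_neg e2, if_pos (m.mono e1), if_neg, one_mul, mul_one]
    exact fun e => e2 (circ_eq_of_circ_eq o1 e1 e)
  · have m := merges_of_circ_ne o1 n1 e1
    rw [if_neg e1, if_pos e2, if_pos (m.mono e2), if_neg, one_mul, mul_one]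
    exact fun e => e1 (circ_eq_of_circ_eq o2 e2 e)
  · have m1 := merges_of_circ_ne o1 n1 e1
    have m2 := merges_of_circ_ne o2 n2 e2
    rw [if_neg e1, if_neg e2]
    have key : circ s₂ (G.inEdge c₁ true) = circ s₂ (G.outEdge c₁ true) ↔
        circ s₁ (G.inEdge c₂ true) = circ s₁ (G.outEdge c₂ true) := by
      constructor
      · intro e
        rcases touches_of_circ_ne_of_circ_eq o2 e1 e with ⟨x, y⟩ | ⟨x, y⟩
        · rw [m1.mono x, m1.mono y, m1.circ_eq]
        · rw [m1.mono x, m1.mono y, m1.circ_eq]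
      · intro e
        rcases touches_of_circ_ne_of_circ_eq o1 e2 e with ⟨x, y⟩ | ⟨x, y⟩
        · rw [m2.mono x, m2.mono y, m2.circ_eq]
        · rw [m2.mono x, m2.mono y, m2.circ_eq]
    by_cases e : circ s₂ (G.inEdge c₁ true) = circ s₂ (G.outEdge c₁ true)
    swap
    · rw [if_neg e, if_neg (key.not.1 e)]
    -- the same two circles touch both crossings; they first become one, which is then split
    rw [if_pos e, if_pos (key.1 e), one_mul, one_mul, handleMat_mulVec, handleMat_mulVec]
    have q2 : circ s₂ (G.inEdge c₂ true) = circ s₂ (G.inEdge c₁ true) := by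
      rcases touches_of_circ_ne_of_circ_eq o2 e1 e with ⟨x, y⟩ | ⟨x, y⟩
      · exact m2.mono x
      · rw [m2.mono x, e]
    have q1 : circ s₁ (G.inEdge c₁ true) = circ s₁ (G.inEdge c₂ true) := by
      rcases touches_of_circ_ne_of_circ_eq o1 e2 (key.1 e) with ⟨x, y⟩ | ⟨x, y⟩
      · exact m1.mono x
      · rw [m1.mono x, key.1 e]
    have t2 {p : G.Pt} (hp : circ s₂ p = circ s₂ (G.inEdge c₁ true)) : Touches s₃ c₁ p := by
      rcases circ_eq_or_touches (fun k hk => (o3' k hk).symm) hp with x | x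
      · exact Or.inl x
      · exact x.1
    have t1 {p : G.Pt} (hp : circ s₁ p = circ s₁ (G.inEdge c₂ true)) : Touches s₃ c₂ p := by
      rcases circ_eq_or_touches (fun k hk => (o3 k hk).symm) hp with x | x
      · exact Or.inl x
      · exact x.1
    have ta2 : Touches s₃ c₁ (G.inEdge c₂ true) := t2 q2
    have tb2 : Touches s₃ c₁ (G.outEdge c₂ true) := t2 (m2.circ_eq.symm.trans q2)
    have ta1 : Touches s₃ c₂ (G.inEdge c₁ true) := t1 q1
    have tb1 : Touches s₃ c₂ (G.outEdge c₁ true) := t1 (m1.circ_eq.symm.trans q1)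
    have cong {p q : G.Pt} (h : circ s₃ p = circ s₃ q) :
        (xMat t p).mulVec (genVec R (allPlus s₃)) = (xMat t q).mulVec (genVec R (allPlus s₃)) :=
      xMat_mulVec_congr t (g := allPlus s₃) h
    rcases ta2 with x | x <;> rcases tb2 with y | y
    · have z : circ s₃ (G.outEdge c₁ true) = circ s₃ (G.inEdge c₁ true) := by
        rcases tb1 with w | w
        · exact w.trans x
        · exact w.trans y
      rw [cong x, cong y, cong z]
    · rw [cong x, cong y]
    · rw [cong x, cong y, add_comm]
    · have z : circ s₃ (G.inEdge c₁ true) = circ s₃ (G.outEdge c₁ true) := by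
        rcases ta1 with w | w
        · exact w.trans x
        · exact w.trans y
      rw [cong x, cong y, cong z]

end Square

theorem edgeMat_comm (c₁ c₂ : G.Cr) :
    edgeMat t c₁ * edgeMat t c₂ = edgeMat t c₂ * edgeMat (G := G) t c₁ := by
  rcases eq_or_ne c₁ c₂ with rfl | hc
  · rfl
  rw [← sub_eq_zero]
  refine eq_zero_of_commute_xMat t (fun p => ?_) fun s => ?_
  · rw [sub_mul, mul_sub, mul_assoc, edgeMat_mul_xMat, ← mul_assoc, edgeMat_mul_xMat, mul_assoc,
      mul_assoc, edgeMat_mul_xMat, ← mul_assoc (edgeMat t c₂), edgeMat_mul_xMat, mul_assoc]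
  · rw [Matrix.sub_mulVec, sub_eq_zero]
    -- if one of the smoothings is already changed, then both sides vanish
    have hz {c c' : G.Cr} (h : s c = true) (hcc : c ≠ c') :
        (edgeMat t c * edgeMat t c').mulVec (genVec R (allPlus s)) = 0 ∧
        (edgeMat t c' * edgeMat t c).mulVec (genVec R (allPlus s)) = 0 := by
      rw [← Matrix.mulVec_mulVec, ← Matrix.mulVec_mulVec,
        edgeMat_mulVec_of_true t (g := allPlus s) h, Matrix.mulVec_zero]
      refine ⟨?_, rfl⟩
      cases h' : s c'
      · rw [edgeMat_mulVec_allPlus t h', Matrix.mulVec_mulVec, edgeMat_mul_factorMat,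
          ← Matrix.mulVec_mulVec, edgeMat_mulVec_of_true, Matrix.mulVec_zero]
        change Function.update s c' true c = true
        rw [Function.update_of_ne hcc, h]
      · rw [edgeMat_mulVec_of_true t (g := allPlus s) h', Matrix.mulVec_zero]
    cases h1 : s c₁
    swap
    · rw [(hz h1 hc).1, (hz h1 hc).2]
    cases h2 : s c₂
    swap
    · rw [(hz h2 hc.symm).1, (hz h2 hc.symm).2]
    have hpath {c c' : G.Cr} (h : s c = false) (h' : s c' = false) (hcc : c ≠ c') :
        (edgeMat t c * edgeMat t c').mulVec (genVec R (allPlus s)) =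
        (factorMat t s c' * factorMat t (Function.update s c' true) c).mulVec
          (genVec R (allPlus (Function.update (Function.update s c true) c' true))) := by
      rw [← Matrix.mulVec_mulVec, edgeMat_mulVec_allPlus t h', Matrix.mulVec_mulVec,
        edgeMat_mul_factorMat, ← Matrix.mulVec_mulVec, edgeMat_mulVec_allPlus,
        Matrix.mulVec_mulVec, Function.update_comm hcc]
      rw [Function.update_of_ne hcc, h]
    rw [hpath h1 h2 hc, hpath h2 h1 hc.symm, factorMat_square t hc h1 h2,
      Function.update_comm hc]

/-- In characteristic two the square of a sum of commuting elements is the sum of the squares. -/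
theorem sum_mul_sum_of_commute {ι A : Type*} [Ring A] (h2 : ∀ a : A, a + a = 0) (s : Finset ι)
    (f : ι → A) (h : ∀ i j, f i * f j = f j * f i) :
    (∑ i ∈ s, f i) * ∑ i ∈ s, f i = ∑ i ∈ s, f i * f i := by
  induction s using Finset.induction_on with
  | empty => simp
  | insert a s ha ih =>
    have hc : (∑ i ∈ s, f i) * f a = f a * ∑ i ∈ s, f i := by
      rw [Finset.sum_mul, Finset.mul_sum]
      exact Finset.sum_congr rfl fun i _ => h i a
    rw [Finset.sum_insert ha, Finset.sum_insert ha, add_mul, mul_add, mul_add, ih, hc,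
      add_assoc (f a * f a), ← add_assoc (f a * ∑ i ∈ s, f i), h2, zero_add]

theorem matrix_add_self (A : Matrix G.Gen G.Gen R) : A + A = 0 := by
  ext i j
  exact CharTwo.add_self_eq_zero _

theorem sum_edgeMat_mul_self : (∑ c, edgeMat t c) * ∑ c, edgeMat (G := G) t c = 0 := by
  rw [sum_mul_sum_of_commute matrix_add_self _ _ fun c c' => edgeMat_comm t c c']
  exact Finset.sum_eq_zero fun c _ => edgeMat_mul_self t c

end Deformed

/-! ### The `k`-degree of the edge maps -/

/-- The number of intersections of the circle through `p` with `γ`, modulo two. -/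
def circWt (s : G.Cr → Bool) (p : G.Pt) : ZMod 2 := ∑ q with circ s q = circ s p, G.wt q

theorem nontriv_circ_iff {s : G.Cr → Bool} {p : G.Pt} :
    Nontriv (circ s p) ↔ circWt s p = 1 := Iff.rfl

/-- The contribution to the `k`-degree of a circle with weight `u` and label `b`. -/
def circDeg (u : ZMod 2) (b : Bool) : ℤ := if u = 1 then (if b = true then 1 else -1) else 0

/-- The contribution of the circle through `p` to the `k`-degree. -/
def Gen.degAt (g : G.Gen) (p : G.Pt) : ℤ := circDeg (circWt g.1 p) (g.label p)

section Merge

variable {c : G.Cr} {p : G.Pt}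

theorem Merges.circWt_of_not_touches {s s' : G.Cr → Bool} (h : Merges s s' c)
    (hp : ¬ Touches s c p) : circWt s' p = circWt s p := by
  unfold circWt
  simp only [h.circ_eq_iff_of_not_touches hp]

theorem Merges.circWt_inEdge {s s' : G.Cr → Bool} (h : Merges s s' c) :
    circWt s' (G.inEdge c true) =
      circWt s (G.inEdge c true) + circWt s (G.outEdge c true) := by
  unfold circWt
  simp only [h.circ_eq_inEdge_iff, Touches]
  rw [Finset.filter_or, Finset.sum_union]
  rw [Finset.disjoint_filter]
  exact fun q _ e e' => h.1 (e.symm.trans e')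

/-- The contribution of a circle to the `k`-degree. -/
def Gen.circleDeg (g : G.Gen) (Z : G.Circle g.1) : ℤ :=
  if Nontriv Z then (if g.2 Z = true then 1 else -1) else 0

theorem Gen.kDeg_eq_sum (g : G.Gen) : g.kDeg = ∑ Z, g.circleDeg Z := rfl

theorem Gen.circleDeg_circ (g : G.Gen) (p : G.Pt) : g.circleDeg (circ g.1 p) = g.degAt p := by
  unfold Gen.circleDeg Gen.degAt circDeg
  exact if_congr nontriv_circ_iff rfl rfl

theorem Merges.kDeg_add {g g' : G.Gen} (h : Merges g.1 g'.1 c)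
    (hl : ∀ p, ¬ Touches g.1 c p → g'.label p = g.label p) :
    g.kDeg + g'.degAt (G.inEdge c true) =
      g'.kDeg + (g.degAt (G.inEdge c true) + g.degAt (G.outEdge c true)) := by
  rw [g.kDeg_eq_sum, g'.kDeg_eq_sum,
    ← Finset.add_sum_erase _ _ (Finset.mem_univ (circ g.1 (G.inEdge c true))),
    ← Finset.add_sum_erase _ _ (Finset.mem_erase.2 ⟨h.1.symm, Finset.mem_univ _⟩),
    ← Finset.add_sum_erase _ _ (Finset.mem_univ (circ g'.1 (G.inEdge c true))),
    Gen.circleDeg_circ, Gen.circleDeg_circ, Gen.circleDeg_circ]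
  have ht {p : G.Pt} : circ g.1 p ∈ ((Finset.univ : Finset (G.Circle g.1)).erase
      (circ g.1 (G.inEdge c true))).erase (circ g.1 (G.outEdge c true)) ↔
      ¬ Touches g.1 c p := by
    rw [Finset.mem_erase, Finset.mem_erase]
    exact ⟨fun hp => not_or.2 ⟨hp.2.1, hp.1⟩,
      fun hp => ⟨fun e => hp (Or.inr e), fun e => hp (Or.inl e), Finset.mem_univ _⟩⟩
  have ht' {p : G.Pt} : circ g'.1 p ∈ (Finset.univ : Finset (G.Circle g'.1)).erase
      (circ g'.1 (G.inEdge c true)) ↔ ¬ Touches g.1 c p := by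
    rw [Finset.mem_erase, ← h.circ_eq_inEdge_iff]
    exact and_iff_left (Finset.mem_univ _)
  -- the circles that do not touch `c` are the same before and after the merge
  have hrest : ∑ Z ∈ ((Finset.univ : Finset (G.Circle g.1)).erase
        (circ g.1 (G.inEdge c true))).erase (circ g.1 (G.outEdge c true)), g.circleDeg Z =
      ∑ Z ∈ (Finset.univ : Finset (G.Circle g'.1)).erase (circ g'.1 (G.inEdge c true)),
        g'.circleDeg Z := by
    refine Finset.sum_bij
      (fun Z _ => Quot.lift (circ g'.1) (fun p q hpq => h.mono (Quot.sound hpq)) Z) ?_ ?_ ?_ ?_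
    · intro Z hZ
      induction Z using Quot.ind with
      | mk p => exact ht'.2 (ht.1 hZ)
    · intro Z hZ Z' hZ' e
      induction Z using Quot.ind with
      | mk p =>
        induction Z' using Quot.ind with
        | mk q => exact (h.circ_eq_iff_of_not_touches (ht.1 hZ')).1 e
    · intro Z hZ
      induction Z using Quot.ind with
      | mk p => exact ⟨circ g.1 p, ht.2 (ht'.1 hZ), rfl⟩
    · intro Z hZ
      induction Z using Quot.ind with
      | mk p =>
        change g.circleDeg (circ g.1 p) = g'.circleDeg (circ g'.1 p)
        rw [Gen.circleDeg_circ, Gen.circleDeg_circ, Gen.degAt, Gen.degAt,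
          h.circWt_of_not_touches (ht.1 hZ), hl p (ht.1 hZ)]
  rw [hrest]
  ring

end Merge

theorem circDeg_khMerge : ∀ (u v : ZMod 2) (x y z : Bool), khMerge x y z →
    circDeg (u + v) z = circDeg u x + circDeg v y ∨
    circDeg (u + v) z = circDeg u x + circDeg v y + -2 := by
  intro u v x y z
  unfold circDeg
  revert u v
  cases x <;> cases y <;> cases z <;> dsimp only [khMerge] <;> decide

theorem circDeg_khSplit : ∀ (u v : ZMod 2) (x y z : Bool), khSplit x y z →
    circDeg u y + circDeg v z = circDeg (u + v) x ∨
    circDeg u y + circDeg v z = circDeg (u + v) x + -2 := by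
  intro u v x y z
  unfold circDeg
  revert u v
  cases x <;> cases y <;> cases z <;> dsimp only [khSplit] <;> decide

theorem circDeg_leeMerge : ∀ (u v : ZMod 2) (x y z : Bool), leeMerge x y z →
    circDeg (u + v) z = circDeg u x + circDeg v y ∨
    circDeg (u + v) z = circDeg u x + circDeg v y + 2 := by
  unfold leeMerge circDeg
  decide

theorem circDeg_leeSplit : ∀ (u v : ZMod 2) (x y z : Bool), leeSplit x y z →
    circDeg u y + circDeg v z = circDeg (u + v) x ∨
    circDeg u y + circDeg v z = circDeg (u + v) x + 2 := by
  unfold leeSplit circDeg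
  decide

/-- An edge map changes the `k`-degree as its merge and split maps do on the circles that touch
the crossing. -/
theorem EdgeTerm.kDeg_eq {merge split : Bool → Bool → Bool → Prop} {n : ℤ}
    (hm : ∀ (u v : ZMod 2) (x y z : Bool), merge x y z →
      circDeg (u + v) z = circDeg u x + circDeg v y ∨
      circDeg (u + v) z = circDeg u x + circDeg v y + n)
    (hs : ∀ (u v : ZMod 2) (x y z : Bool), split x y z →
      circDeg u y + circDeg v z = circDeg (u + v) x ∨
      circDeg u y + circDeg v z = circDeg (u + v) x + n)
    {c : G.Cr} {g g' : G.Gen} (h : EdgeTerm merge split c g g') :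
    g'.kDeg = g.kDeg ∨ g'.kDeg = g.kDeg + n := by
  rcases h.merges_or with m | m
  · have hk := m.kDeg_add h.agreeOff
    have := hm (circWt g.1 (G.inEdge c true)) (circWt g.1 (G.outEdge c true)) _ _ _
      ((edgeTerm_iff_of_merges h.1 h.2.1 m).1 h).2
    rw [← m.circWt_inEdge] at this
    unfold Gen.degAt at hk
    omega
  · have hk := m.kDeg_add fun p hp => (h.agreeOff p (m.touches_iff.not.2 hp)).symm
    have := hs (circWt g'.1 (G.inEdge c true)) (circWt g'.1 (G.outEdge c true)) _ _ _
      ((edgeTerm_iff_of_splits h.1 h.2.1 m).1 h).2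
    rw [← m.circWt_inEdge] at this
    unfold Gen.degAt at hk
    omega

theorem kDeg_of_khovanov {c : G.Cr} {g g' : G.Gen} (h : EdgeTerm khMerge khSplit c g g') :
    g'.kDeg = g.kDeg ∨ g'.kDeg = g.kDeg + -2 := h.kDeg_eq circDeg_khMerge circDeg_khSplit

theorem kDeg_of_lee {c : G.Cr} {g g' : G.Gen} (h : EdgeTerm leeMerge leeSplit c g g') :
    g'.kDeg = g.kDeg ∨ g'.kDeg = g.kDeg + 2 := h.kDeg_eq circDeg_leeMerge circDeg_leeSplit

/-! ### The operators as homogeneous matrices -/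

theorem ofRel_apply (r : G.Gen → G.Gen → Prop) (g g' : G.Gen) :
    ofRel r g' g = if r g g' then 1 else 0 := rfl

theorem ofRel_ne_zero {r : G.Gen → G.Gen → Prop} {g g' : G.Gen} :
    ofRel r g' g ≠ 0 ↔ r g g' := by
  rw [ofRel_apply]
  split_ifs with h <;> simp [h]

theorem hasDegree_ofRel {r : G.Gen → G.Gen → Prop} {deg : G.Gen → ℤ} {n : ℤ}
    (h : ∀ g g', r g g' → deg g' = deg g + n) : HasDegree deg n (ofRel r) :=
  fun g' g hne => h g g' (ofRel_ne_zero.1 hne)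

variable (G)

/-- The Khovanov differential. -/
def khMat : Matrix G.Gen G.Gen (ZMod 2) :=
  ofRel fun g g' => ∃ c, EdgeTerm khMerge khSplit c g g'

/-- The Lee differential. -/
def leeMat : Matrix G.Gen G.Gen (ZMod 2) :=
  ofRel fun g g' => ∃ c, EdgeTerm leeMerge leeSplit c g g'

variable {G}

theorem hasDegree_dZero : HasDegree Gen.kDeg 0 G.dZero :=
  hasDegree_ofRel fun g g' h => by rw [h.2, add_zero]

theorem hasDegree_dMinus : HasDegree Gen.kDeg (-2) G.dMinus :=
  hasDegree_ofRel fun g g' h => by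
    obtain ⟨⟨c, hc⟩, hlt⟩ := h
    rcases kDeg_of_khovanov hc with e | e
    · omega
    · exact e

theorem hasDegree_leeZero : HasDegree Gen.kDeg 0 G.leeZero :=
  hasDegree_ofRel fun g g' h => by rw [h.2, add_zero]

theorem hasDegree_leePlus : HasDegree Gen.kDeg 2 G.leePlus :=
  hasDegree_ofRel fun g g' h => by
    obtain ⟨⟨c, hc⟩, hlt⟩ := h
    rcases kDeg_of_lee hc with e | e
    · omega
    · exact e

theorem khMat_eq_add : G.khMat = G.dZero + G.dMinus := by
  ext g' g
  rw [Matrix.add_apply, khMat, dZero, dMinus, ofRel_apply, ofRel_apply, ofRel_apply]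
  by_cases h : ∃ c, EdgeTerm khMerge khSplit c g g'
  · obtain ⟨c, hc⟩ := id h
    rcases kDeg_of_khovanov hc with e | e
    · simp [h, e]
    · simp [h, e]
  · simp [h]

theorem leeMat_eq_add : G.leeMat = G.leeZero + G.leePlus := by
  ext g' g
  rw [Matrix.add_apply, leeMat, leeZero, leePlus, ofRel_apply, ofRel_apply, ofRel_apply]
  by_cases h : ∃ c, EdgeTerm leeMerge leeSplit c g g'
  · obtain ⟨c, hc⟩ := id h
    rcases kDeg_of_lee hc with e | e
    · simp [h, e]
    · simp [h, e]
  · simp [h]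

theorem Gen.kDeg_flip (g : G.Gen) (p : G.Pt) :
    (g.flip p).kDeg + g.degAt p = g.kDeg + (g.flip p).degAt p := by
  have h (g : G.Gen) := (Finset.add_sum_erase Finset.univ g.circleDeg
    (Finset.mem_univ (circ g.1 p))).symm
  rw [g.kDeg_eq_sum, (g.flip p).kDeg_eq_sum, h g, h (g.flip p), Gen.circleDeg_circ,
    Gen.circleDeg_circ]
  have hrest : ∑ Z ∈ Finset.univ.erase (circ g.1 p), g.circleDeg Z =
      ∑ Z ∈ Finset.univ.erase (circ g.1 p), (g.flip p).circleDeg Z := by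
    refine Finset.sum_congr rfl fun Z hZ => ?_
    induction Z using Quot.ind with
    | mk q =>
      change g.circleDeg (circ g.1 q) = (g.flip p).circleDeg (circ (g.flip p).1 q)
      rw [Gen.circleDeg_circ, Gen.circleDeg_circ, Gen.degAt, Gen.degAt,
        Gen.flip_label_of_ne (Finset.ne_of_mem_erase hZ)]
      rfl
  rw [hrest]
  change _ + ∑ Z ∈ Finset.univ.erase (circ g.1 p), (g.flip p).circleDeg Z + _ = _
  ring

theorem fAct_iff {g g' : G.Gen} :
    (∃ Z : G.Circle g.1, Nontriv Z ∧ g.2 Z = true ∧ g' = ⟨g.1, Function.update g.2 Z false⟩) ↔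
      ∃ p, circWt g.1 p = 1 ∧ g.label p = true ∧ g' = g.flip p := by
  constructor
  · rintro ⟨Z, hZ, hl, h⟩
    induction Z using Quot.ind with
    | mk p => exact ⟨p, hZ, hl, h.trans (Gen.mk_update hl)⟩
  · rintro ⟨p, hp, hl, h⟩
    exact ⟨circ g.1 p, hp, hl, h.trans (Gen.mk_update (b := false) hl).symm⟩

theorem eAct_iff {g g' : G.Gen} :
    (∃ Z : G.Circle g.1, Nontriv Z ∧ g.2 Z = false ∧ g' = ⟨g.1, Function.update g.2 Z true⟩) ↔
      ∃ p, circWt g.1 p = 1 ∧ g.label p = false ∧ g' = g.flip p := by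
  constructor
  · rintro ⟨Z, hZ, hl, h⟩
    induction Z using Quot.ind with
    | mk p => exact ⟨p, hZ, hl, h.trans (Gen.mk_update hl)⟩
  · rintro ⟨p, hp, hl, h⟩
    exact ⟨circ g.1 p, hp, hl, h.trans (Gen.mk_update (b := true) hl).symm⟩

theorem hasDegree_fAct : HasDegree Gen.kDeg (-2) G.fAct :=
  hasDegree_ofRel fun g g' h => by
    obtain ⟨p, hp, hl, rfl⟩ := fAct_iff.1 h
    have h1 := g.kDeg_flip p
    have h2 : g.degAt p = 1 := by rw [Gen.degAt, hp, hl]; rfl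
    have h3 : (g.flip p).degAt p = -1 := by
      rw [Gen.degAt, Gen.flip_label_of_eq rfl, hl, Gen.flip_fst, hp]; rfl
    omega

theorem hasDegree_eAct : HasDegree Gen.kDeg 2 G.eAct :=
  hasDegree_ofRel fun g g' h => by
    obtain ⟨p, hp, hl, rfl⟩ := eAct_iff.1 h
    have h1 := g.kDeg_flip p
    have h2 : g.degAt p = -1 := by rw [Gen.degAt, hp, hl]; rfl
    have h3 : (g.flip p).degAt p = 1 := by
      rw [Gen.degAt, Gen.flip_label_of_eq rfl, hl, Gen.flip_fst, hp]; rfl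
    omega

/-! ### Extraction of the coefficients of powers of `t` -/

section Coefficients

open Polynomial

/-- A matrix over `𝔽₂` as a matrix over `𝔽₂[t]`. -/
abbrev constMat (A : Matrix G.Gen G.Gen (ZMod 2)) : Matrix G.Gen G.Gen (ZMod 2)[X] :=
  A.map (C : ZMod 2 →+* (ZMod 2)[X])

theorem constMat_mul (A B : Matrix G.Gen G.Gen (ZMod 2)) :
    constMat (A * B) = constMat A * constMat B := Matrix.map_mul

theorem constMat_add (A B : Matrix G.Gen G.Gen (ZMod 2)) :
    constMat (A + B) = constMat A + constMat B := Matrix.map_add _ (map_add _) _ _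

theorem coeff_eq_zero_of_matrix {A B D : Matrix G.Gen G.Gen (ZMod 2)}
    (h : constMat A + (X : (ZMod 2)[X]) • constMat B + (X ^ 2 : (ZMod 2)[X]) • constMat D = 0) :
    A = 0 ∧ B = 0 ∧ D = 0 := by
  have h' (i j : G.Gen) : C (A i j) + X * C (B i j) + X ^ 2 * C (D i j) = 0 :=
    congrFun (congrFun h i) j
  refine ⟨?_, ?_, ?_⟩ <;> ext i j
  · simpa [coeff_mul_C, coeff_X_pow] using congrArg (fun f => coeff f 0) (h' i j)
  · simpa [coeff_mul_C, coeff_X_pow, coeff_C] using congrArg (fun f => coeff f 1) (h' i j)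
  · simpa [coeff_mul_C, coeff_X, coeff_X_pow, coeff_C] using
      congrArg (fun f => coeff f 2) (h' i j)

theorem constMat_ofRel (r : G.Gen → G.Gen → Prop) (g' g : G.Gen) :
    constMat (ofRel r) g' g = if r g g' then 1 else 0 := by
  rw [constMat, Matrix.map_apply, ofRel_apply]
  by_cases h : r g g'
  · rw [if_pos h, if_pos h, map_one]
  · rw [if_neg h, if_neg h, map_zero]

theorem sum_ite_eq_ite_exists {R ι : Type*} [AddCommMonoidWithOne R] [Fintype ι] (P : ι → Prop)
    {Q : Prop} (hQ : Q ↔ ∃ i, P i)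
    (h : ∀ i j, P i → P j → i = j) : (∑ i, if P i then (1 : R) else 0) = if Q then 1 else 0 := by
  split_ifs with hP
  · obtain ⟨i, hi⟩ := hQ.1 hP
    rw [Finset.sum_eq_single i, if_pos hi]
    · exact fun j _ hj => if_neg fun k => hj (h j i k hi)
    · simp
  · exact Finset.sum_eq_zero fun i _ => if_neg fun k => hP (hQ.2 ⟨i, k⟩)

theorem sum_edgeMat_eq :
    ∑ c, edgeMat (X : (ZMod 2)[X]) c =
      constMat G.khMat + (X : (ZMod 2)[X]) • constMat G.leeMat := by
  ext1 g' g
  have h1 : (∑ c, if EdgeTerm khMerge khSplit c g g' then (1 : (ZMod 2)[X]) else 0) =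
      constMat G.khMat g' g := by
    rw [khMat, constMat_ofRel]
    exact sum_ite_eq_ite_exists _ Iff.rfl fun c c' h h' => EdgeTerm.crossing_unique h' h
  have h2 : (∑ c, if EdgeTerm leeMerge leeSplit c g g' then (1 : (ZMod 2)[X]) else 0) =
      constMat G.leeMat g' g := by
    rw [leeMat, constMat_ofRel]
    exact sum_ite_eq_ite_exists _ Iff.rfl fun c c' h h' => EdgeTerm.crossing_unique h' h
  rw [Matrix.sum_apply, Matrix.add_apply, Matrix.smul_apply, ← h1, ← h2, smul_eq_mul,
    Finset.mul_sum, ← Finset.sum_add_distrib]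
  rfl

/-- The sum of the multiplications by `X` on all nontrivial circles is `f + t e`. -/
theorem sum_wt_xMat_eq :
    ∑ p, (C (G.wt p) : (ZMod 2)[X]) • xMat (X : (ZMod 2)[X]) p =
      constMat G.fAct + (X : (ZMod 2)[X]) • constMat G.eAct := by
  ext1 g' g
  rw [Matrix.sum_apply, Matrix.add_apply, Matrix.smul_apply, fAct, eAct, constMat_ofRel,
    constMat_ofRel]
  simp only [fAct_iff, eAct_iff, Matrix.smul_apply, xMat, Matrix.of_apply, smul_eq_mul]
  by_cases h : ∃ p, g' = g.flip p
  · obtain ⟨p, rfl⟩ := h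
    have hflip (q : G.Pt) : g.flip p = g.flip q ↔ circ g.1 q = circ g.1 p := by
      refine ⟨fun e => ?_, fun e => (Gen.flip_congr e).symm⟩
      by_contra hne
      have := congrArg (fun k => Gen.label k q) e
      simp only [Gen.flip_label_of_ne hne, Gen.flip_label_of_eq rfl] at this
      revert this
      cases g.label q <;> simp
    have hsum : ∑ q, C (G.wt q) * (if g.flip p = g.flip q then
        xCoef (X : (ZMod 2)[X]) (g.label q) else 0) =
        C (circWt g.1 p) * xCoef (X : (ZMod 2)[X]) (g.label p) := by
      rw [circWt, map_sum, Finset.sum_mul, Finset.sum_filter]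
      refine Finset.sum_congr rfl fun q _ => ?_
      by_cases e : circ g.1 q = circ g.1 p
      · rw [if_pos ((hflip q).2 e), if_pos e, Gen.label_congr e]
      · rw [if_neg ((hflip q).not.2 e), if_neg e, mul_zero]
    have hex (b : Bool) : (∃ q, circWt g.1 q = 1 ∧ g.label q = b ∧ g.flip p = g.flip q) ↔
        circWt g.1 p = 1 ∧ g.label p = b := by
      constructor
      · rintro ⟨q, h1, h2, h3⟩
        have e := (hflip q).1 h3
        refine ⟨?_, ?_⟩
        · unfold circWt at *
          rwa [← e]
        · rwa [← Gen.label_congr e]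
      · rintro ⟨h1, h2⟩
        exact ⟨p, h1, h2, rfl⟩
    simp only [hex]
    refine hsum.trans ?_
    have h01 : ∀ u : ZMod 2, u = 0 ∨ u = 1 := by decide
    rcases h01 (circWt g.1 p) with hw | hw <;> rw [hw] <;> cases g.label p <;> simp [xCoef]
  · rw [Finset.sum_eq_zero, if_neg, if_neg]
    · simp
    · exact fun ⟨q, _, _, e⟩ => h ⟨q, e⟩
    · exact fun ⟨q, _, _, e⟩ => h ⟨q, e⟩
    · intro q _
      rw [if_neg fun e => h ⟨q, e⟩, mul_zero]

/-- The Khovanov and the Lee differential square to zero and commute. -/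
theorem khMat_leeMat_relations : G.khMat * G.khMat = 0 ∧
    G.khMat * G.leeMat + G.leeMat * G.khMat = 0 ∧ G.leeMat * G.leeMat = 0 := by
  apply coeff_eq_zero_of_matrix
  rw [← sum_edgeMat_mul_self (G := G) (X : (ZMod 2)[X]), sum_edgeMat_eq]
  simp only [constMat_mul, constMat_add, add_mul, mul_add, smul_mul_assoc, mul_smul_comm,
    smul_add, smul_smul, pow_two]
  abel

/-- The relations between the actions of `e` and `f`, from the square of `f + t e`. -/
theorem eAct_fAct_relations : G.fAct * G.fAct = 0 ∧
    G.fAct * G.eAct + G.eAct * G.fAct = (∑ p, G.wt p) • (1 : Matrix G.Gen G.Gen (ZMod 2)) ∧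
    G.eAct * G.eAct = 0 := by
  have hsq : (∑ p, (C (G.wt p) : (ZMod 2)[X]) • xMat (X : (ZMod 2)[X]) p) *
      (∑ p, (C (G.wt p) : (ZMod 2)[X]) • xMat (X : (ZMod 2)[X]) p) =
      (X : (ZMod 2)[X]) • constMat ((∑ p, G.wt p) • (1 : Matrix G.Gen G.Gen (ZMod 2))) := by
    rw [sum_mul_sum_of_commute matrix_add_self]
    · have hw : ∀ u : ZMod 2, u * u = u := by decide
      simp only [smul_mul_assoc, mul_smul_comm, smul_smul, xMat_mul_self, ← mul_assoc, ← C_mul, hw]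
      rw [← Finset.sum_smul, ← Finset.sum_mul, ← map_sum]
      ext1 i j
      simp only [Matrix.smul_apply, Matrix.map_apply, Matrix.one_apply, smul_eq_mul]
      split_ifs <;> simp [mul_comm]
    · intro p q
      simp only [smul_mul_assoc, mul_smul_comm, smul_smul, xMat_comm (X : (ZMod 2)[X]) p q]
      rw [mul_comm]
  have key := coeff_eq_zero_of_matrix (A := G.fAct * G.fAct)
    (B := G.fAct * G.eAct + G.eAct * G.fAct - (∑ p, G.wt p) • (1 : Matrix G.Gen G.Gen (ZMod 2)))
    (D := G.eAct * G.eAct) (by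
      rw [sub_eq_add_neg, constMat_add, smul_add]
      have hneg (A : Matrix G.Gen G.Gen (ZMod 2)) : -A = A :=
        neg_eq_of_add_eq_zero_left (matrix_add_self A)
      rw [hneg, ← hsq, sum_wt_xMat_eq]
      have h0 := matrix_add_self ((constMat G.fAct + (X : (ZMod 2)[X]) • constMat G.eAct) *
        (constMat G.fAct + (X : (ZMod 2)[X]) • constMat G.eAct))
      rw [← h0]
      simp only [constMat_mul, constMat_add, add_mul, mul_add, smul_mul_assoc, mul_smul_comm,
        smul_add, smul_smul, pow_two]
      abel)
  exact ⟨key.1, sub_eq_zero.1 key.2.1, key.2.2⟩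

/-- The relations between the differentials and the actions of `e` and `f`: multiplication by `X`
on all nontrivial circles commutes with the deformed differential. -/
theorem commutator_relations : G.fAct * G.khMat - G.khMat * G.fAct = 0 ∧
    (G.fAct * G.leeMat - G.leeMat * G.fAct) + (G.eAct * G.khMat - G.khMat * G.eAct) = 0 ∧
    G.eAct * G.leeMat - G.leeMat * G.eAct = 0 := by
  have hcomm : (∑ p, (C (G.wt p) : (ZMod 2)[X]) • xMat (X : (ZMod 2)[X]) p) *
      (∑ c, edgeMat (X : (ZMod 2)[X]) c) =
      (∑ c, edgeMat (X : (ZMod 2)[X]) c) *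
      (∑ p, (C (G.wt p) : (ZMod 2)[X]) • xMat (X : (ZMod 2)[X]) p) := by
    rw [Finset.sum_mul_sum, Finset.sum_mul_sum, Finset.sum_comm]
    simp only [smul_mul_assoc, mul_smul_comm, edgeMat_mul_xMat]
  have hsub (A B : Matrix G.Gen G.Gen (ZMod 2)) : constMat (A - B) = constMat A - constMat B :=
    Matrix.map_sub _ (map_sub _) _ _
  apply coeff_eq_zero_of_matrix
  rw [← sub_eq_zero.2 hcomm, sum_edgeMat_eq, sum_wt_xMat_eq]
  simp only [constMat_mul, constMat_add, hsub, add_mul, mul_add, smul_mul_assoc, mul_smul_comm,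
    smul_add, smul_sub, smul_smul, pow_two]
  abel

end Coefficients

/-! ### The homogeneous components of the relations -/

/-- The components of `∂² = 0` with respect to the `k`-degree. -/
theorem khovanov_relations : G.dZero * G.dZero = 0 ∧
    G.dZero * G.dMinus + G.dMinus * G.dZero = 0 ∧ G.dMinus * G.dMinus = 0 := by
  refine HasDegree.eq_zero_of_add_add_eq_zero (a := 0 + 0) (b := 0 + -2) (c := -2 + -2)
    (hasDegree_dZero.mul hasDegree_dZero)
    ((hasDegree_dZero.mul hasDegree_dMinus).add (hasDegree_dMinus.mul hasDegree_dZero))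
    (hasDegree_dMinus.mul hasDegree_dMinus) (by decide) (by decide) (by decide) ?_
  rw [← khMat_leeMat_relations.1, khMat_eq_add]
  noncomm_ring

/-- The components of `(∂ᴸᵉᵉ)² = 0` with respect to the `k`-degree. -/
theorem lee_relations : G.leeZero * G.leeZero = 0 ∧
    G.leeZero * G.leePlus + G.leePlus * G.leeZero = 0 ∧ G.leePlus * G.leePlus = 0 := by
  refine HasDegree.eq_zero_of_add_add_eq_zero (a := 0 + 0) (b := 0 + 2) (c := 2 + 2)
    (hasDegree_leeZero.mul hasDegree_leeZero)
    ((hasDegree_leeZero.mul hasDegree_leePlus).add (hasDegree_leePlus.mul hasDegree_leeZero))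
    (hasDegree_leePlus.mul hasDegree_leePlus) (by decide) (by decide) (by decide) ?_
  rw [← khMat_leeMat_relations.2.2, leeMat_eq_add]
  noncomm_ring

/-- The components of `∂ ∂ᴸᵉᵉ + ∂ᴸᵉᵉ ∂ = 0` with respect to the `k`-degree. -/
theorem khovanov_lee_relations :
    G.dZero * G.leeZero + G.leeZero * G.dZero + (G.leePlus * G.dMinus + G.dMinus * G.leePlus) = 0 ∧
    G.dZero * G.leePlus + G.leePlus * G.dZero = 0 ∧
    G.dMinus * G.leeZero + G.leeZero * G.dMinus = 0 := by
  refine HasDegree.eq_zero_of_add_add_eq_zero (deg := Gen.kDeg) (a := 0) (b := 2) (c := -2)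
    (((hasDegree_dZero.mul hasDegree_leeZero).add (hasDegree_leeZero.mul hasDegree_dZero)).add
      ((hasDegree_leePlus.mul hasDegree_dMinus).add (hasDegree_dMinus.mul hasDegree_leePlus)))
    ((hasDegree_dZero.mul hasDegree_leePlus).add (hasDegree_leePlus.mul hasDegree_dZero))
    ((hasDegree_dMinus.mul hasDegree_leeZero).add (hasDegree_leeZero.mul hasDegree_dMinus))
    (by decide) (by decide) (by decide) ?_
  rw [← khMat_leeMat_relations.2.1, khMat_eq_add, leeMat_eq_add]
  noncomm_ring

/-- The components of `[f, ∂] = 0` with respect to the `k`-degree. -/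
theorem fAct_khovanov_relations : G.fAct * G.dZero - G.dZero * G.fAct = 0 ∧
    G.fAct * G.dMinus - G.dMinus * G.fAct = 0 := by
  refine HasDegree.eq_zero_of_add_eq_zero (m := -2 + 0) (n := -2 + -2)
    ((hasDegree_fAct.mul hasDegree_dZero).sub (hasDegree_dZero.mul hasDegree_fAct))
    ((hasDegree_fAct.mul hasDegree_dMinus).sub (hasDegree_dMinus.mul hasDegree_fAct))
    (by decide) ?_
  rw [← commutator_relations.1, khMat_eq_add]
  noncomm_ring

/-- The components of `[e, ∂ᴸᵉᵉ] = 0` with respect to the `k`-degree. -/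
theorem eAct_lee_relations : G.eAct * G.leeZero - G.leeZero * G.eAct = 0 ∧
    G.eAct * G.leePlus - G.leePlus * G.eAct = 0 := by
  refine HasDegree.eq_zero_of_add_eq_zero (m := 2 + 0) (n := 2 + 2)
    ((hasDegree_eAct.mul hasDegree_leeZero).sub (hasDegree_leeZero.mul hasDegree_eAct))
    ((hasDegree_eAct.mul hasDegree_leePlus).sub (hasDegree_leePlus.mul hasDegree_eAct))
    (by decide) ?_
  rw [← commutator_relations.2.2, leeMat_eq_add]
  noncomm_ring

/-- The components, with respect to the `k`-degree, of the coefficient of `t` in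
`[f + t e, ∂ + t ∂ᴸᵉᵉ] = 0`. -/
theorem mixed_relations : G.fAct * G.leeZero - G.leeZero * G.fAct = 0 ∧
    (G.fAct * G.leePlus - G.leePlus * G.fAct) + (G.eAct * G.dMinus - G.dMinus * G.eAct) = 0 ∧
    G.eAct * G.dZero - G.dZero * G.eAct = 0 := by
  refine HasDegree.eq_zero_of_add_add_eq_zero (deg := Gen.kDeg) (a := -2) (b := 0) (c := 2)
    ((hasDegree_fAct.mul hasDegree_leeZero).sub (hasDegree_leeZero.mul hasDegree_fAct))
    (((hasDegree_fAct.mul hasDegree_leePlus).sub (hasDegree_leePlus.mul hasDegree_fAct)).add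
      ((hasDegree_eAct.mul hasDegree_dMinus).sub (hasDegree_dMinus.mul hasDegree_eAct)))
    ((hasDegree_eAct.mul hasDegree_dZero).sub (hasDegree_dZero.mul hasDegree_eAct))
    (by decide) (by decide) (by decide) ?_
  rw [← commutator_relations.2.1, khMat_eq_add, leeMat_eq_add]
  noncomm_ring

/-- Modulo two, the number of nontrivial circles is the number of intersections of the link with
`γ`, so that `h` acts by a scalar. -/
theorem hAct_eq : G.hAct = (∑ p, G.wt p) • (1 : Matrix G.Gen G.Gen (ZMod 2)) := by
  have h01 : ∀ u : ZMod 2, u = 0 ∨ u = 1 := by decide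
  have key (g : G.Gen) : (g.kDeg : ZMod 2) = ∑ p, G.wt p := by
    rw [g.kDeg_eq_sum, Int.cast_sum, ← Finset.sum_fiberwise Finset.univ (circ g.1) G.wt]
    refine Finset.sum_congr rfl fun Z _ => ?_
    induction Z using Quot.ind with
    | mk p =>
      change ((g.circleDeg (circ g.1 p) : ℤ) : ZMod 2) = circWt g.1 p
      rw [Gen.circleDeg_circ, Gen.degAt, circDeg]
      rcases h01 (circWt g.1 p) with h | h <;> rw [h] <;> cases g.label p <;> rfl
  ext i j
  rw [hAct, Matrix.smul_apply, Matrix.diagonal_apply, Matrix.one_apply, key, smul_eq_mul, mul_ite,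
    mul_one, mul_zero]

end GaussData

/-! ### Commutators in characteristic two -/

section Commutator

variable {A : Type*} [Ring A]

/-- The anticommutator, which is the commutator in characteristic two. -/
def comm₂ (a b : A) : A := a * b + b * a

theorem comm₂_comm (a b : A) : comm₂ a b = comm₂ b a := add_comm _ _

theorem comm₂_comm₂ (h : ∀ a : A, a + a = 0) (a b c : A) :
    comm₂ (comm₂ a b) c = comm₂ a (comm₂ b c) + comm₂ b (comm₂ a c) := by
  have e : comm₂ a (comm₂ b c) + comm₂ b (comm₂ a c) = comm₂ (comm₂ a b) c +
      ((a * c * b + b * c * a) + (a * c * b + b * c * a)) := by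
    unfold comm₂
    noncomm_ring
  rw [e, h, add_zero]

theorem comm₂_self_comm₂ (h : ∀ a : A, a + a = 0) {a : A} (ha : a * a = 0) (b : A) :
    comm₂ a (comm₂ a b) = 0 := by
  have e : comm₂ a (comm₂ a b) = (a * a) * b + b * (a * a) + (a * b * a + a * b * a) := by
    unfold comm₂
    noncomm_ring
  rw [e, h, ha, zero_mul, mul_zero, add_zero, add_zero]

theorem comm₂_zero (a : A) : comm₂ a 0 = 0 := by simp [comm₂]

/-- The bracket of two basis elements of `sl₂(∧)_dg` over `𝔽₂`, which is a basis element or zero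
(`none`). -/
def SlBasis.bracketTwo : SlBasis → SlBasis → Option SlBasis
  | .e, .f => some .h
  | .f, .e => some .h
  | .e, .vm2 => some .v0
  | .vm2, .e => some .v0
  | .f, .v2 => some .v0
  | .v2, .f => some .v0
  | .v2, .vm2 => some .x
  | .vm2, .v2 => some .x
  | .d, .D => some .x
  | .D, .d => some .x
  | _, _ => none

theorem Sl2dg.bracket_basis_eq (a b : SlBasis) :
    bracket (basis a) (basis b) = (a.bracketTwo b).elim 0 basis := by
  rw [bracket_basis]
  revert a b
  decide

/-- In characteristic two the relations between `e`, `f`, `h`, `v₂`, `v₋₂`, `d` and `D` imply those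
with the commutators `ṽ₀` and `x`. -/
theorem bracketTwo_relations (h2 : ∀ a : A, a + a = 0) (ρ : SlBasis → A)
    (hh : ∀ a, comm₂ (ρ .h) a = 0)
    (hef : comm₂ (ρ .e) (ρ .f) = ρ .h) (hew : comm₂ (ρ .e) (ρ .vm2) = ρ .v0)
    (hfv : comm₂ (ρ .f) (ρ .v2) = ρ .v0) (hvw : comm₂ (ρ .v2) (ρ .vm2) = ρ .x)
    (hdD : comm₂ (ρ .d) (ρ .D) = ρ .x)
    (hev : comm₂ (ρ .e) (ρ .v2) = 0) (hed : comm₂ (ρ .e) (ρ .d) = 0)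
    (heD : comm₂ (ρ .e) (ρ .D) = 0) (hfw : comm₂ (ρ .f) (ρ .vm2) = 0)
    (hfd : comm₂ (ρ .f) (ρ .d) = 0) (hfD : comm₂ (ρ .f) (ρ .D) = 0)
    (hvd : comm₂ (ρ .v2) (ρ .d) = 0) (hvD : comm₂ (ρ .v2) (ρ .D) = 0)
    (hwd : comm₂ (ρ .vm2) (ρ .d) = 0) (hwD : comm₂ (ρ .vm2) (ρ .D) = 0)
    (hee : ρ .e * ρ .e = 0) (hff : ρ .f * ρ .f = 0) (hvv : ρ .v2 * ρ .v2 = 0)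
    (hww : ρ .vm2 * ρ .vm2 = 0) (a b : SlBasis) :
    comm₂ (ρ a) (ρ b) = (a.bracketTwo b).elim 0 ρ := by
  have hself (a : A) : comm₂ a a = 0 := h2 _
  have hev0 : comm₂ (ρ .e) (ρ .v0) = 0 := by rw [← hew, comm₂_self_comm₂ h2 hee]
  have hfv0 : comm₂ (ρ .f) (ρ .v0) = 0 := by rw [← hfv, comm₂_self_comm₂ h2 hff]
  have hvv0 : comm₂ (ρ .v2) (ρ .v0) = 0 := by
    rw [← hfv, comm₂_comm (ρ .f), comm₂_self_comm₂ h2 hvv]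
  have hwv0 : comm₂ (ρ .vm2) (ρ .v0) = 0 := by
    rw [← hew, comm₂_comm (ρ .e), comm₂_self_comm₂ h2 hww]
  have hv0d : comm₂ (ρ .v0) (ρ .d) = 0 := by
    rw [← hew, comm₂_comm₂ h2, hwd, hed, comm₂_zero, comm₂_zero, add_zero]
  have hv0D : comm₂ (ρ .v0) (ρ .D) = 0 := by
    rw [← hew, comm₂_comm₂ h2, hwD, heD, comm₂_zero, comm₂_zero, add_zero]
  have hvx : comm₂ (ρ .v2) (ρ .x) = 0 := by rw [← hvw, comm₂_self_comm₂ h2 hvv]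
  have hwx : comm₂ (ρ .vm2) (ρ .x) = 0 := by
    rw [← hvw, comm₂_comm (ρ .v2), comm₂_self_comm₂ h2 hww]
  have hxe : comm₂ (ρ .x) (ρ .e) = 0 := by
    rw [← hvw, comm₂_comm₂ h2, comm₂_comm (ρ .vm2), hew, hvv0, comm₂_comm (ρ .v2) (ρ .e), hev,
      comm₂_zero, add_zero]
  have hxf : comm₂ (ρ .x) (ρ .f) = 0 := by
    rw [← hvw, comm₂_comm₂ h2, comm₂_comm (ρ .vm2) (ρ .f), hfw, comm₂_comm (ρ .v2) (ρ .f), hfv,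
      hwv0, comm₂_zero, add_zero]
  have hxd : comm₂ (ρ .x) (ρ .d) = 0 := by
    rw [← hvw, comm₂_comm₂ h2, hwd, hvd, comm₂_zero, comm₂_zero, add_zero]
  have hxD : comm₂ (ρ .x) (ρ .D) = 0 := by
    rw [← hvw, comm₂_comm₂ h2, hwD, hvD, comm₂_zero, comm₂_zero, add_zero]
  have hv0x : comm₂ (ρ .v0) (ρ .x) = 0 := by
    rw [← hew, comm₂_comm₂ h2, hwx, comm₂_comm (ρ .e) (ρ .x), hxe, comm₂_zero, comm₂_zero,
      add_zero]
  cases a <;> cases b <;> first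
    | exact hself _
    | assumption
    | exact hh _
    | (rw [comm₂_comm]; first | assumption | exact hh _)

end Commutator

namespace GaussData

variable {G : GaussData}

/-! ### `CKh` is an `L∞`-module -/

theorem EdgeTerm.homDeg_eq {merge split : Bool → Bool → Bool → Prop} {c : G.Cr} {g g' : G.Gen}
    (h : EdgeTerm merge split c g g') : g'.homDeg = g.homDeg + 1 := by
  have hins : (Finset.univ.filter fun k => g'.1 k = true) =
      insert c (Finset.univ.filter fun k => g.1 k = true) := by
    ext k
    rw [Finset.mem_insert, Finset.mem_filter, Finset.mem_filter, h.2.1, Function.update_apply]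
    by_cases e : k = c <;> simp [e]
  unfold Gen.homDeg
  rw [hins, Finset.card_insert_of_notMem (by simp [h.1])]
  push_cast
  ring

theorem hasDegree_basisAct (a : SlBasis) : HasDegree Gen.homDeg a.degree (G.basisAct a) := by
  have he : HasDegree Gen.homDeg 0 G.eAct := hasDegree_ofRel fun g g' h => by
    obtain ⟨Z, -, -, rfl⟩ := h
    rw [add_zero]
    rfl
  have hf : HasDegree Gen.homDeg 0 G.fAct := hasDegree_ofRel fun g g' h => by
    obtain ⟨Z, -, -, rfl⟩ := h
    rw [add_zero]
    rfl
  have hm : HasDegree Gen.homDeg 1 G.dMinus := hasDegree_ofRel fun g g' h => by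
    obtain ⟨⟨c, hc⟩, -⟩ := h
    exact hc.homDeg_eq
  have hp : HasDegree Gen.homDeg 1 G.leePlus := hasDegree_ofRel fun g g' h => by
    obtain ⟨⟨c, hc⟩, -⟩ := h
    exact hc.homDeg_eq
  cases a
  case e => exact he
  case f => exact hf
  case h =>
    intro i j hij
    have : i = j := by
      by_contra hne
      exact hij (Matrix.diagonal_apply_ne _ hne)
    rw [this]
    exact (add_zero _).symm
  case v2 => exact hp
  case vm2 => exact hm
  case v0 => exact (he.mul hm).sub (hm.mul he)
  case d =>
    refine hasDegree_ofRel fun g g' h => ?_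
    obtain ⟨⟨c, hc⟩, -⟩ := h
    exact hc.homDeg_eq
  case D =>
    refine hasDegree_ofRel fun g g' h => ?_
    obtain ⟨⟨c, hc⟩, -⟩ := h
    exact hc.homDeg_eq
  case x => exact (hp.mul hm).add (hm.mul hp)

theorem comm₂_basisAct (a b : SlBasis) :
    comm₂ (G.basisAct a) (G.basisAct b) = (a.bracketTwo b).elim 0 G.basisAct := by
  have h2 (A : Matrix G.Gen G.Gen (ZMod 2)) : A + A = 0 := matrix_add_self A
  have hsub (A B : Matrix G.Gen G.Gen (ZMod 2)) : A - B = A + B := by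
    rw [sub_eq_add_neg, neg_eq_of_add_eq_zero_left (h2 B)]
  have hs {A B : Matrix G.Gen G.Gen (ZMod 2)} (h : A * B - B * A = 0) : comm₂ A B = 0 := by
    rw [comm₂, ← hsub, h]
  have hac {A B : Matrix G.Gen G.Gen (ZMod 2)} (h : A * B + B * A = 0) : comm₂ B A = 0 := by
    rw [comm₂_comm, comm₂, h]
  have hdD := khovanov_lee_relations (G := G)
  have hmix := mixed_relations (G := G)
  refine bracketTwo_relations h2 G.basisAct ?_ ?_ ?_ ?_ ?_ ?_ (hs eAct_lee_relations.2)
    (hs hmix.2.2) (hs eAct_lee_relations.1) (hs fAct_khovanov_relations.2)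
    (hs fAct_khovanov_relations.1) (hs hmix.1) (hac hdD.2.1) (hac lee_relations.2.1)
    (hac khovanov_relations.2.1) hdD.2.2 eAct_fAct_relations.2.2 eAct_fAct_relations.1
    lee_relations.2.2 khovanov_relations.2.2 a b
  · intro A
    change comm₂ G.hAct A = 0
    rw [hAct_eq, comm₂, smul_mul_assoc, mul_smul_comm, one_mul, mul_one, h2]
  · change comm₂ G.eAct G.fAct = G.hAct
    rw [comm₂_comm, hAct_eq]
    exact eAct_fAct_relations.2.1
  · exact (hsub _ _).symm
  · change comm₂ G.fAct G.leePlus = G.eAct * G.dMinus - G.dMinus * G.eAct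
    rw [comm₂, ← hsub, eq_neg_of_add_eq_zero_left hmix.2.1]
    exact neg_eq_of_add_eq_zero_left (h2 _)
  · rfl
  · change comm₂ G.dZero G.leeZero = G.leePlus * G.dMinus + G.dMinus * G.leePlus
    rw [comm₂, eq_neg_of_add_eq_zero_left hdD.1]
    exact neg_eq_of_add_eq_zero_left (h2 _)

theorem isLInfModule_CKh (G : GaussData) : IsLInfModule Sl2dg.ops G.CKh := by
  refine isLInfModule_of_basisAct khovanov_relations.1 (fun a b => ?_) hasDegree_basisAct
  rw [Sl2dg.bracket_basis_eq]
  change _ = Matrix.toLin' (comm₂ (G.basisAct a) (G.basisAct b))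
  rw [comm₂_basisAct]
  cases a.bracketTwo b with
  | none => simp
  | some c => exact act_basis G c

variable {p : G.Pt} {w : ZMod 2} {ov pos : Bool}

/-! ### The circles of a diagram with a kink -/

/-- The edge `q` of the old diagram; the edge `p` is the part in front of the kink. -/
def oldEdge (q : G.Pt) : (G.kink p w ov pos).Pt := Sum.inl q

/-- The edge inside the kink. -/
def loopEdge : (G.kink p w ov pos).Pt := Sum.inr false

/-- The part of the edge `p` behind the kink. -/
def exitEdge : (G.kink p w ov pos).Pt := Sum.inr true

/-- A crossing of the old diagram. -/
def oldCr (c : G.Cr) : (G.kink p w ov pos).Cr := some c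

/-- The crossing of the kink. -/
def newCr : (G.kink p w ov pos).Cr := none

theorem kink_edge_cases {P : (G.kink p w ov pos).Pt → Prop} (h1 : ∀ q, P (oldEdge q))
    (h2 : P loopEdge) (h3 : P exitEdge) : ∀ x, P x
  | Sum.inl q => h1 q
  | Sum.inr false => h2
  | Sum.inr true => h3

theorem kink_cr_cases {P : (G.kink p w ov pos).Cr → Prop} (h1 : ∀ c, P (oldCr c))
    (h2 : P newCr) : ∀ x, P x
  | some c => h1 c
  | none => h2

theorem oldCr_ne_newCr (c : G.Cr) : (oldCr c : (G.kink p w ov pos).Cr) ≠ newCr :=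
  Option.some_ne_none c

theorem oldCr_inj {c c' : G.Cr} : (oldCr c : (G.kink p w ov pos).Cr) = oldCr c' ↔ c = c' :=
  Option.some_inj

theorem kink_next_oldEdge {q : G.Pt} (h : q ≠ p) :
    (G.kink p w ov pos).next (oldEdge q) = oldEdge (G.next q) := by
  have h1 : (Sum.inl q : G.Pt ⊕ Bool) ≠ Sum.inl p := fun e => h (Sum.inl.inj e)
  change (Equiv.sumCongr G.next (Equiv.refl Bool)) ((Equiv.swap (Sum.inl p) (Sum.inr false))
    ((Equiv.swap (Sum.inr false) (Sum.inr true)) (Sum.inl q))) = _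
  rw [Equiv.swap_apply_of_ne_of_ne (a := Sum.inr false) (by simp) (by simp),
    Equiv.swap_apply_of_ne_of_ne h1 (by simp)]
  rfl

theorem kink_next_oldEdge_self :
    (G.kink p w ov pos).next (oldEdge p) = loopEdge := by
  change (Equiv.sumCongr G.next (Equiv.refl Bool)) ((Equiv.swap (Sum.inl p) (Sum.inr false))
    ((Equiv.swap (Sum.inr false) (Sum.inr true)) (Sum.inl p))) = _
  rw [Equiv.swap_apply_of_ne_of_ne (a := Sum.inr false) (by simp) (by simp),
    Equiv.swap_apply_left]
  rfl

theorem kink_next_loopEdge : (G.kink p w ov pos).next loopEdge = exitEdge := by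
  change (Equiv.sumCongr G.next (Equiv.refl Bool)) ((Equiv.swap (Sum.inl p) (Sum.inr false))
    ((Equiv.swap (Sum.inr false) (Sum.inr true)) (Sum.inr false))) = _
  rw [Equiv.swap_apply_left, Equiv.swap_apply_of_ne_of_ne (by simp) (by simp)]
  rfl

theorem kink_next_exitEdge : (G.kink p w ov pos).next exitEdge = oldEdge (G.next p) := by
  change (Equiv.sumCongr G.next (Equiv.refl Bool)) ((Equiv.swap (Sum.inl p) (Sum.inr false))
    ((Equiv.swap (Sum.inr false) (Sum.inr true)) (Sum.inr true))) = _
  rw [Equiv.swap_apply_right, Equiv.swap_apply_right]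
  rfl

theorem oldEdge_mem_range_strand {q : G.Pt} :
    (oldEdge q : (G.kink p w ov pos).Pt) ∈ Set.range (G.kink p w ov pos).strand ↔
      q ∈ Set.range G.strand := by
  constructor
  · rintro ⟨⟨c, b⟩, h⟩
    induction c using kink_cr_cases with
    | h1 c => exact ⟨(c, b), Sum.inl.inj h⟩
    | h2 => cases h
  · rintro ⟨⟨c, b⟩, rfl⟩
    exact ⟨(oldCr c, b), rfl⟩

theorem kink_strand_newCr (b : Bool) :
    (G.kink p w ov pos).strand (newCr, b) = if xor b ov = true then exitEdge else loopEdge := by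
  change Sum.inr (xor b ov) = _
  cases xor b ov <;> rfl

theorem kink_outEdge_oldCr (c : G.Cr) (b : Bool) :
    (G.kink p w ov pos).outEdge (oldCr c) b = oldEdge (G.outEdge c b) := rfl

theorem kink_inEdge_oldCr (c : G.Cr) (b : Bool) :
    (G.kink p w ov pos).inEdge (oldCr c) b =
      if G.inEdge c b = p then exitEdge else oldEdge (G.inEdge c b) := by
  unfold inEdge
  rw [Equiv.symm_apply_eq]
  split_ifs with h
  · rw [kink_next_exitEdge, ← h, Equiv.apply_symm_apply]
    rfl
  · rw [kink_next_oldEdge h, Equiv.apply_symm_apply]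
    rfl

theorem kink_outEdge_newCr (b : Bool) :
    (G.kink p w ov pos).outEdge newCr b = if xor b ov = true then exitEdge else loopEdge :=
  kink_strand_newCr b

theorem kink_inEdge_newCr (b : Bool) :
    (G.kink p w ov pos).inEdge newCr b = if xor b ov = true then loopEdge else oldEdge p := by
  unfold inEdge
  rw [Equiv.symm_apply_eq, kink_strand_newCr]
  split_ifs with h
  · rw [kink_next_loopEdge]
  · rw [kink_next_oldEdge_self]

theorem kink_positive_newCr : (G.kink p w ov pos).positive newCr = pos := rfl

theorem kink_positive_oldCr (c : G.Cr) :
    (G.kink p w ov pos).positive (oldCr c) = G.positive c := rfl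

/-- The smoothing of the crossings of the old diagram. -/
def oldState (s : (G.kink p w ov pos).Cr → Bool) : G.Cr → Bool := fun c => s (oldCr c)

/-- The smoothing `s` of the old crossings together with the smoothing `a` of the new one. -/
def kinkState (a : Bool) (s : G.Cr → Bool) : (G.kink p w ov pos).Cr → Bool :=
  fun c => Option.elim c a s

section Circles

variable {s : (G.kink p w ov pos).Cr → Bool}

theorem circ_exitEdge : circ s exitEdge = circ s (oldEdge p) := by
  by_cases h : s newCr = (G.kink p w ov pos).positive newCr
  · have h1 := Quot.sound (Joined.unorientedIn newCr h)
    have h2 := Quot.sound (Joined.unorientedOut newCr h)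
    rw [kink_inEdge_newCr, kink_inEdge_newCr] at h1
    rw [kink_outEdge_newCr, kink_outEdge_newCr] at h2
    cases ov
    · exact h2.trans h1
    · exact h2.symm.trans h1.symm
  · have h1 := Quot.sound (Joined.oriented newCr ov h)
    rw [kink_inEdge_newCr, kink_outEdge_newCr] at h1
    cases ov
    · exact h1.symm
    · exact h1.symm

theorem circ_loopEdge_of_eq (h : s newCr = pos) : circ s loopEdge = circ s (oldEdge p) := by
  have h1 := Quot.sound (Joined.unorientedIn newCr h)
  rw [kink_inEdge_newCr, kink_inEdge_newCr] at h1
  cases ov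
  · exact h1
  · exact h1.symm

theorem circ_inEdge_oldCr (c : G.Cr) (b : Bool) :
    circ s ((G.kink p w ov pos).inEdge (oldCr c) b) = circ s (oldEdge (G.inEdge c b)) := by
  rw [kink_inEdge_oldCr]
  split_ifs with h
  · rw [h]
    exact circ_exitEdge
  · rfl

theorem circ_oldEdge_of_joined {q r : G.Pt} (h : G.Joined (oldState s) q r) :
    circ s (oldEdge q) = circ s (oldEdge r) := by
  cases h with
  | pass q hq =>
    by_cases e : q = p
    · subst e
      have := Quot.sound (Joined.pass (s := s) exitEdge (by
        rwa [kink_next_exitEdge, oldEdge_mem_range_strand]))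
      rw [kink_next_exitEdge] at this
      exact circ_exitEdge.symm.trans this
    · have := Quot.sound (Joined.pass (s := s) (oldEdge q) (by
        rwa [kink_next_oldEdge e, oldEdge_mem_range_strand]))
      rwa [kink_next_oldEdge e] at this
  | oriented c b hc =>
    have := Quot.sound (Joined.oriented (s := s) (oldCr c) b hc)
    exact (circ_inEdge_oldCr c b).symm.trans this
  | unorientedIn c hc =>
    have := Quot.sound (Joined.unorientedIn (s := s) (oldCr c) hc)
    exact (circ_inEdge_oldCr c true).symm.trans (this.trans (circ_inEdge_oldCr c false))
  | unorientedOut c hc => exact Quot.sound (Joined.unorientedOut (s := s) (oldCr c) hc)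

theorem circ_oldEdge_of_circ {q r : G.Pt} (h : circ (oldState s) q = circ (oldState s) r) :
    circ s (oldEdge q) = circ s (oldEdge r) := by
  have hgen := Quot.eqvGen_exact h
  clear h
  induction hgen with
  | rel q r h => exact circ_oldEdge_of_joined h
  | refl q => rfl
  | symm q r _ ih => exact ih.symm
  | trans q r t _ _ ih1 ih2 => exact ih1.trans ih2

/-- The circle of the old diagram through an edge of the new one; there is none for the edge
inside the kink if it forms a circle of its own. -/
def oldCircleAt (s : (G.kink p w ov pos).Cr → Bool) :
    (G.kink p w ov pos).Pt → Option (G.Circle (oldState s))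
  | Sum.inl q => some (circ (oldState s) q)
  | Sum.inr true => some (circ (oldState s) p)
  | Sum.inr false => if s newCr = pos then some (circ (oldState s) p) else none

theorem oldCircleAt_loopEdge : oldCircleAt s loopEdge =
    if s newCr = pos then some (circ (oldState s) p) else none := rfl

theorem oldCircleAt_inEdge_oldCr (c : G.Cr) (b : Bool) :
    oldCircleAt s ((G.kink p w ov pos).inEdge (oldCr c) b) =
      some (circ (oldState s) (G.inEdge c b)) := by
  rw [kink_inEdge_oldCr]
  split_ifs with h
  · rw [h]
    rfl
  · rfl

theorem oldCircleAt_eq_of_joined {x y : (G.kink p w ov pos).Pt}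
    (h : (G.kink p w ov pos).Joined s x y) : oldCircleAt s x = oldCircleAt s y := by
  cases h with
  | pass x hx =>
    induction x using kink_edge_cases with
    | h1 q =>
      by_cases e : q = p
      · subst e
        refine absurd ⟨(newCr, ov), ?_⟩ hx
        rw [kink_next_oldEdge_self, kink_strand_newCr]
        cases ov <;> rfl
      · rw [kink_next_oldEdge e] at hx ⊢
        rw [oldEdge_mem_range_strand] at hx
        exact congrArg some (Quot.sound (Joined.pass q hx))
    | h2 =>
      refine absurd ⟨(newCr, !ov), ?_⟩ hx
      rw [kink_next_loopEdge, kink_strand_newCr]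
      cases ov <;> rfl
    | h3 =>
      rw [kink_next_exitEdge] at hx ⊢
      rw [oldEdge_mem_range_strand] at hx
      exact congrArg some (Quot.sound (Joined.pass p hx))
  | oriented c b hc =>
    induction c using kink_cr_cases with
    | h1 c =>
      rw [oldCircleAt_inEdge_oldCr]
      exact congrArg some (Quot.sound (Joined.oriented c b hc))
    | h2 =>
      rw [kink_inEdge_newCr, kink_outEdge_newCr]
      cases ov <;> cases b <;> rfl
  | unorientedIn c hc =>
    induction c using kink_cr_cases with
    | h1 c =>
      rw [oldCircleAt_inEdge_oldCr, oldCircleAt_inEdge_oldCr]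
      exact congrArg some (Quot.sound (Joined.unorientedIn c hc))
    | h2 =>
      have hl : oldCircleAt s loopEdge = some (circ (oldState s) p) := if_pos hc
      rw [kink_inEdge_newCr, kink_inEdge_newCr]
      cases ov
      · exact hl
      · exact hl.symm
  | unorientedOut c hc =>
    induction c using kink_cr_cases with
    | h1 c => exact congrArg some (Quot.sound (Joined.unorientedOut c hc))
    | h2 =>
      have hl : oldCircleAt s loopEdge = some (circ (oldState s) p) := if_pos hc
      rw [kink_outEdge_newCr, kink_outEdge_newCr]
      cases ov
      · exact hl.symm
      · exact hl

/-- The circle of the old diagram that corresponds to a circle of the new one; there is none for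
the circle formed by the edge inside the kink. -/
def oldCircle (Z : (G.kink p w ov pos).Circle s) : Option (G.Circle (oldState s)) :=
  Quot.lift (oldCircleAt s) (fun _ _ h => oldCircleAt_eq_of_joined h) Z

theorem circ_oldEdge_iff {q r : G.Pt} :
    circ s (oldEdge q) = circ s (oldEdge r) ↔ circ (oldState s) q = circ (oldState s) r := by
  refine ⟨fun h => ?_, circ_oldEdge_of_circ⟩
  exact Option.some_inj.1 (congrArg oldCircle h)

theorem circ_loopEdge_ne (h : s newCr ≠ pos) (q : G.Pt) :
    circ s loopEdge ≠ circ s (oldEdge q) := by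
  intro e
  have h1 : oldCircleAt s loopEdge = some (circ (oldState s) q) := congrArg oldCircle e
  rw [oldCircleAt_loopEdge, if_neg h] at h1
  cases h1

theorem circ_loopEdge_ne_of_ne (h : s newCr ≠ pos) {x : (G.kink p w ov pos).Pt}
    (hx : x ≠ loopEdge) : circ s x ≠ circ s loopEdge := by
  induction x using kink_edge_cases with
  | h1 q => exact (circ_loopEdge_ne h q).symm
  | h2 => exact absurd rfl hx
  | h3 =>
    rw [circ_exitEdge]
    exact (circ_loopEdge_ne h p).symm

theorem kink_sum_edges {M : Type*} [AddCommMonoid M] (f : (G.kink p w ov pos).Pt → M) :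
    ∑ x, f x = ∑ q, f (oldEdge q) + (f exitEdge + f loopEdge) := by
  refine (Fintype.sum_sum_type f).trans ?_
  rw [Fintype.sum_bool]
  rfl

theorem circWt_oldEdge (q : G.Pt) : circWt s (oldEdge q) = circWt (oldState s) q := by
  have hloop : (G.kink p w ov pos).wt loopEdge = 0 := rfl
  have hexit : (G.kink p w ov pos).wt exitEdge = G.wt p - w := rfl
  have hold (r : G.Pt) : (G.kink p w ov pos).wt (oldEdge r) = if r = p then w else G.wt r := rfl
  unfold circWt
  rw [Finset.sum_filter, Finset.sum_filter, kink_sum_edges]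
  simp only [circ_exitEdge, circ_oldEdge_iff, hloop, hexit, hold]
  have key (r : G.Pt) : (if circ (oldState s) r = circ (oldState s) q then
      (if r = p then w else G.wt r) else 0) =
      (if circ (oldState s) r = circ (oldState s) q then G.wt r else 0) +
      (if r = p then (if circ (oldState s) p = circ (oldState s) q then w - G.wt p else 0)
        else 0) := by
    by_cases e : r = p
    · subst e
      split_ifs <;> simp
    · simp [e]
  rw [Finset.sum_congr rfl fun r _ => key r, Finset.sum_add_distrib,
    Finset.sum_ite_eq' Finset.univ p]
  simp only [ite_self, Finset.mem_univ, if_true, add_zero]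
  split_ifs
  · abel
  · simp only [add_zero]

theorem circWt_loopEdge (h : s newCr ≠ pos) : circWt s loopEdge = 0 := by
  unfold circWt
  refine Finset.sum_eq_zero fun x hx => ?_
  have : x = loopEdge := by
    by_contra hne
    exact circ_loopEdge_ne_of_ne h hne (Finset.mem_filter.1 hx).2
  rw [this]
  rfl

end Circles

/-! ### The generators of a diagram with a kink -/

/-- The generator of the new diagram that extends a generator of the old one by the smoothing `a`
of the new crossing and, if the edge inside the kink forms a circle of its own, by the label `b`
on this circle. -/
def kinkGen (a b : Bool) (g : G.Gen) : (G.kink p w ov pos).Gen :=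
  ⟨kinkState a g.1, fun Z => (oldCircle Z).elim b g.2⟩

/-- The generator of the old diagram obtained by forgetting the kink. -/
def oldGen (g : (G.kink p w ov pos).Gen) : G.Gen :=
  ofLabel (oldState g.1) (fun q => g.label (oldEdge q)) fun _ _ h =>
    Gen.label_congr (circ_oldEdge_of_circ h)

section KinkGen

variable {a b : Bool} {g g₁ : G.Gen}

theorem kinkGen_fst_newCr : (kinkGen a b g : (G.kink p w ov pos).Gen).1 newCr = a := rfl

theorem kinkGen_fst_oldCr (c : G.Cr) :
    (kinkGen a b g : (G.kink p w ov pos).Gen).1 (oldCr c) = g.1 c := rfl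

theorem kinkGen_label_oldEdge (q : G.Pt) :
    (kinkGen a b g : (G.kink p w ov pos).Gen).label (oldEdge q) = g.label q := rfl

theorem kinkGen_label_exitEdge :
    (kinkGen a b g : (G.kink p w ov pos).Gen).label exitEdge = g.label p := rfl

theorem kinkGen_label_loopEdge (h : a ≠ pos) :
    (kinkGen a b g : (G.kink p w ov pos).Gen).label loopEdge = b := by
  have h1 : oldCircleAt (kinkState a g.1 : (G.kink p w ov pos).Cr → Bool) loopEdge = none :=
    oldCircleAt_loopEdge.trans (if_neg h)
  exact congrArg (fun o => Option.elim o b g.2) h1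

theorem eq_kinkGen_oldGen (g : (G.kink p w ov pos).Gen) :
    g = kinkGen (g.1 newCr) (g.label loopEdge) (oldGen g) := by
  have hs : g.1 = kinkState (g.1 newCr) (oldState g.1) := by
    funext c
    induction c using kink_cr_cases with
    | h1 c => rfl
    | h2 => rfl
  refine Gen.ext_label hs fun x => ?_
  induction x using kink_edge_cases with
  | h1 q => rfl
  | h2 =>
    by_cases h : g.1 newCr = pos
    · have h1 := Gen.label_congr (g := g) (circ_loopEdge_of_eq h)
      have h2 := Gen.label_congr (g := kinkGen (g.1 newCr) (g.label loopEdge) (oldGen g))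
        (circ_loopEdge_of_eq (p := p) (w := w) (ov := ov) h)
      exact h1.trans h2.symm
    · exact (kinkGen_label_loopEdge h).symm
  | h3 => exact Gen.label_congr circ_exitEdge

/-- If the edge inside the kink forms no circle of its own, then its label is redundant. -/
theorem kinkGen_of_eq (b b' : Bool) (g : G.Gen) :
    (kinkGen pos b g : (G.kink p w ov pos).Gen) = kinkGen pos b' g := by
  have hc (b : Bool) : (kinkGen pos b g : (G.kink p w ov pos).Gen).label loopEdge =
      (kinkGen pos b g : (G.kink p w ov pos).Gen).label (oldEdge p) :=
    Gen.label_congr (circ_loopEdge_of_eq rfl)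
  refine Gen.ext_label rfl fun x => ?_
  induction x using kink_edge_cases with
  | h1 q => rfl
  | h2 => rw [hc, hc]; rfl
  | h3 => rfl

theorem kinkGen_injective :
    Function.Injective (kinkGen a b : G.Gen → (G.kink p w ov pos).Gen) := by
  intro g g₁ h
  have hs := congrArg (fun k : (G.kink p w ov pos).Gen => oldState k.1) h
  refine Gen.ext_label hs fun q => ?_
  exact congrArg (fun k : (G.kink p w ov pos).Gen => k.label (oldEdge q)) h

theorem kDeg_kinkGen : (kinkGen a b g : (G.kink p w ov pos).Gen).kDeg = g.kDeg := by
  rw [Gen.kDeg_eq_sum, Gen.kDeg_eq_sum]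
  let g' : (G.kink p w ov pos).Gen := kinkGen a b g
  let θ : G.Circle g.1 → (G.kink p w ov pos).Circle g'.1 :=
    Quot.lift (fun q => circ g'.1 (oldEdge q)) fun _ _ h =>
      circ_oldEdge_of_joined (s := g'.1) h
  symm
  refine Fintype.sum_of_injective θ ?_ g.circleDeg g'.circleDeg ?_ ?_
  · intro Z Z' h
    induction Z using Quot.ind with
    | mk q =>
      induction Z' using Quot.ind with
      | mk r => exact (circ_oldEdge_iff (s := g'.1)).1 h
  · intro Z hZ
    induction Z using Quot.ind with
    | mk x =>
      induction x using kink_edge_cases with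
      | h1 q => exact absurd ⟨circ g.1 q, rfl⟩ hZ
      | h2 =>
        by_cases h : a = pos
        · exact absurd ⟨circ g.1 p, (circ_loopEdge_of_eq (s := g'.1) h).symm⟩ hZ
        · change g'.circleDeg (circ g'.1 loopEdge) = 0
          rw [Gen.circleDeg_circ, Gen.degAt, circWt_loopEdge h]
          rfl
      | h3 => exact absurd ⟨circ g.1 p, (circ_exitEdge (s := g'.1)).symm⟩ hZ
  · intro Z
    induction Z using Quot.ind with
    | mk q =>
      change g.circleDeg (circ g.1 q) = g'.circleDeg (circ g'.1 (oldEdge q))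
      rw [Gen.circleDeg_circ, Gen.circleDeg_circ, Gen.degAt, Gen.degAt, circWt_oldEdge]
      rfl

theorem kink_card_filter (P : (G.kink p w ov pos).Cr → Prop) [DecidablePred P] :
    (Finset.univ.filter P).card =
      (if P newCr then 1 else 0) + (Finset.univ.filter fun c => P (oldCr c)).card := by
  rw [Finset.card_filter, Finset.card_filter]
  exact Fintype.sum_option _

theorem homDeg_kinkGen (h : a ≠ pos) :
    (kinkGen a b g : (G.kink p w ov pos).Gen).homDeg = g.homDeg := by
  unfold Gen.homDeg
  rw [kink_card_filter, kink_card_filter]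
  simp only [kinkGen_fst_newCr, kinkGen_fst_oldCr, kink_positive_newCr, kink_positive_oldCr]
  revert h
  cases a <;> cases pos <;> simp <;> rfl

end KinkGen

/-! ### The operators on the complex of a diagram with a kink -/

section Operators

variable {merge split : Bool → Bool → Bool → Prop} {a b : Bool} {g g₁ : G.Gen}

theorem kinkState_eq_update_iff {c : G.Cr} {s s₁ : G.Cr → Bool} :
    (kinkState a s₁ : (G.kink p w ov pos).Cr → Bool) =
      Function.update (kinkState a s) (oldCr c) true ↔ s₁ = Function.update s c true := by
  constructor
  · intro h
    funext k
    have := congrFun h (oldCr k)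
    rw [Function.update_apply] at this ⊢
    simp only [oldCr_inj] at this
    exact this
  · rintro rfl
    funext k
    induction k using kink_cr_cases with
    | h1 k =>
      rw [Function.update_apply]
      simp only [oldCr_inj]
      change Function.update s c true k = _
      rw [Function.update_apply]
      rfl
    | h2 =>
      rw [Function.update_of_ne (oldCr_ne_newCr c).symm]
      rfl

theorem edgeTerm_oldCr_iff (h : a ≠ pos) (c : G.Cr) :
    EdgeTerm merge split (oldCr c) (kinkGen a b g : (G.kink p w ov pos).Gen) (kinkGen a b g₁) ↔
      EdgeTerm merge split c g g₁ := by
  have hc (g : G.Gen) (q r : G.Pt) : circ (kinkGen a b g : (G.kink p w ov pos).Gen).1 (oldEdge q) =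
      circ (kinkGen a b g : (G.kink p w ov pos).Gen).1 (oldEdge r) ↔ circ g.1 q = circ g.1 r :=
    circ_oldEdge_iff
  have hin (g : G.Gen) (x : Bool) : (kinkGen a b g : (G.kink p w ov pos).Gen).label
      ((G.kink p w ov pos).inEdge (oldCr c) x) = g.label (G.inEdge c x) :=
    Gen.label_congr (circ_inEdge_oldCr c x)
  unfold EdgeTerm
  refine and_congr Iff.rfl (and_congr kinkState_eq_update_iff (and_congr ?_ ?_))
  · simp only [circ_inEdge_oldCr, kink_outEdge_oldCr]
    constructor
    · intro k q h1 h2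
      exact k (oldEdge q) ((hc _ _ _).not.2 h1) ((hc _ _ _).not.2 h2)
    · intro k x
      induction x using kink_edge_cases with
      | h1 q =>
        intro h1 h2
        exact k q ((hc _ _ _).not.1 h1) ((hc _ _ _).not.1 h2)
      | h2 =>
        intro _ _
        rw [kinkGen_label_loopEdge h, kinkGen_label_loopEdge h]
      | h3 =>
        rw [circ_exitEdge]
        intro h1 h2
        exact k p ((hc _ _ _).not.1 h1) ((hc _ _ _).not.1 h2)
  · simp only [hin, kinkGen_label_oldEdge, circ_inEdge_oldCr, kink_outEdge_oldCr, hc, ne_eq]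

/-- The edge maps at the old crossings do not change the kink. -/
theorem EdgeTerm.newCr_eq {c : G.Cr} {g g₁ : (G.kink p w ov pos).Gen}
    (h : EdgeTerm merge split (oldCr c) g g₁) : g₁.1 newCr = g.1 newCr :=
  update_off h.2.1 _ (oldCr_ne_newCr c).symm

theorem EdgeTerm.label_loopEdge {c : G.Cr} {g g₁ : (G.kink p w ov pos).Gen}
    (h : EdgeTerm merge split (oldCr c) g g₁) (hg : g.1 newCr ≠ pos) :
    g₁.label loopEdge = g.label loopEdge := by
  refine h.agreeOff _ (not_or.2 ⟨?_, ?_⟩)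
  · rw [circ_inEdge_oldCr]
    exact circ_loopEdge_ne hg _
  · exact circ_loopEdge_ne hg _

theorem exists_edgeTerm_iff (h : a ≠ pos) :
    (∃ c, EdgeTerm merge split c (kinkGen a b g : (G.kink p w ov pos).Gen) (kinkGen a b g₁)) ↔
      ∃ c, EdgeTerm merge split c g g₁ := by
  constructor
  · rintro ⟨c, hc⟩
    induction c using kink_cr_cases with
    | h1 c => exact ⟨c, (edgeTerm_oldCr_iff h c).1 hc⟩
    | h2 => exact (update_ne hc.1 hc.2.1 rfl).elim
  · rintro ⟨c, hc⟩
    exact ⟨oldCr c, (edgeTerm_oldCr_iff h c).2 hc⟩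

theorem flip_oldEdge_kinkGen (h : a ≠ pos) (q : G.Pt) :
    (kinkGen a b g : (G.kink p w ov pos).Gen).flip (oldEdge q) = kinkGen a b (g.flip q) := by
  have hc (r : G.Pt) : circ (kinkGen a b g : (G.kink p w ov pos).Gen).1 (oldEdge r) =
      circ (kinkGen a b g : (G.kink p w ov pos).Gen).1 (oldEdge q) ↔ circ g.1 r = circ g.1 q :=
    circ_oldEdge_iff
  have hold (r : G.Pt) : ((kinkGen a b g : (G.kink p w ov pos).Gen).flip (oldEdge q)).label
      (oldEdge r) = (g.flip q).label r := by
    by_cases e : circ g.1 r = circ g.1 q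
    · rw [Gen.flip_label_of_eq ((hc r).2 e), Gen.flip_label_of_eq e]
      rfl
    · rw [Gen.flip_label_of_ne ((hc r).not.2 e), Gen.flip_label_of_ne e]
      rfl
  refine Gen.ext_label rfl fun x => ?_
  induction x using kink_edge_cases with
  | h1 r => exact hold r
  | h2 =>
    rw [Gen.flip_label_of_ne (circ_loopEdge_ne h q), kinkGen_label_loopEdge h,
      kinkGen_label_loopEdge h]
  | h3 => exact (Gen.label_congr circ_exitEdge).trans (hold p)

/-- A change of the label of a nontrivial circle does not affect the kink. -/
theorem exists_flip_iff (h : a ≠ pos) {l : Bool} {g' : (G.kink p w ov pos).Gen} :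
    (∃ x, circWt (kinkGen a b g : (G.kink p w ov pos).Gen).1 x = 1 ∧
      (kinkGen a b g : (G.kink p w ov pos).Gen).label x = l ∧
      g' = (kinkGen a b g : (G.kink p w ov pos).Gen).flip x) ↔
      ∃ q, circWt g.1 q = 1 ∧ g.label q = l ∧ g' = kinkGen a b (g.flip q) := by
  have hwt (q : G.Pt) : circWt (kinkGen a b g : (G.kink p w ov pos).Gen).1 (oldEdge q) =
      circWt g.1 q := circWt_oldEdge q
  constructor
  · rintro ⟨x, h1, h2, h3⟩
    induction x using kink_edge_cases with
    | h1 q => exact ⟨q, (hwt q).symm.trans h1, h2, h3.trans (flip_oldEdge_kinkGen h q)⟩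
    | h2 =>
      rw [circWt_loopEdge h] at h1
      exact absurd h1 (by decide)
    | h3 =>
      rw [Gen.flip_congr circ_exitEdge] at h3
      unfold circWt at h1
      rw [circ_exitEdge] at h1
      exact ⟨p, (hwt p).symm.trans h1, h2, h3.trans (flip_oldEdge_kinkGen h p)⟩
  · rintro ⟨q, h1, h2, h3⟩
    exact ⟨oldEdge q, (hwt q).trans h1, h2, h3.trans (flip_oldEdge_kinkGen h q).symm⟩

end Operators

end GaussData

/-! ### Matrices of inclusions and projections of basis elements -/

section Inclusion

variable {α β : Type*} {ι : α → β}
  {A : Matrix α α (ZMod 2)} {A' : Matrix β β (ZMod 2)}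

/-- The map that sends the basis element `a` to the basis element `ι a`. -/
def inclMat (ι : α → β) : Matrix β α (ZMod 2) := Matrix.of fun x a => if x = ι a then 1 else 0

/-- The map that sends the basis element `ι a` to the basis element `a` and the other basis
elements to zero. -/
def projMat (ι : α → β) : Matrix α β (ZMod 2) := Matrix.of fun a x => if x = ι a then 1 else 0

theorem projMat_mulVec [Fintype β] (v : β → ZMod 2) (a : α) : (projMat ι).mulVec v a = v (ι a) := by
  change ∑ x, (if x = ι a then (1 : ZMod 2) else 0) * v x = _
  simp

theorem inclMat_mulVec [Fintype α] (hι : Function.Injective ι) (v : α → ZMod 2) (a : α) :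
    (inclMat ι).mulVec v (ι a) = v a := by
  change ∑ b, (if ι a = ι b then (1 : ZMod 2) else 0) * v b = _
  simp [hι.eq_iff]

theorem inclMat_mulVec_of_ne [Fintype α] {x : β} (hx : ∀ a, x ≠ ι a) (v : α → ZMod 2) :
    (inclMat ι).mulVec v x = 0 := by
  change ∑ b, (if x = ι b then (1 : ZMod 2) else 0) * v b = _
  simp [hx]

theorem mul_inclMat [Fintype α] [Fintype β] (hι : Function.Injective ι)
    (h : ∀ a b, A' (ι a) (ι b) = A a b)
    (h0 : ∀ x b, A' x (ι b) ≠ 0 → ∃ a, x = ι a) : A' * inclMat ι = inclMat ι * A := by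
  ext x b
  have hL : (A' * inclMat ι) x b = A' x (ι b) := by
    change ∑ y, A' x y * (if y = ι b then (1 : ZMod 2) else 0) = _
    simp
  rw [hL]
  change _ = ∑ a, (if x = ι a then (1 : ZMod 2) else 0) * A a b
  by_cases hx : ∃ a, x = ι a
  · obtain ⟨a, rfl⟩ := hx
    simp [hι.eq_iff, h]
  · have : A' x (ι b) = 0 := by
      by_contra hne
      exact hx (h0 x b hne)
    rw [this, Finset.sum_eq_zero]
    exact fun a _ => by rw [if_neg fun e => hx ⟨a, e⟩, zero_mul]

theorem projMat_mul [Fintype α] [Fintype β] (hι : Function.Injective ι)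
    (h : ∀ a b, A' (ι a) (ι b) = A a b)
    (h0 : ∀ x a, A' (ι a) x ≠ 0 → ∃ b, x = ι b) : projMat ι * A' = A * projMat ι := by
  ext a x
  have hL : (projMat ι * A') a x = A' (ι a) x := by
    change ∑ y, (if y = ι a then (1 : ZMod 2) else 0) * A' y x = _
    simp
  rw [hL]
  change _ = ∑ b, A a b * (if x = ι b then (1 : ZMod 2) else 0)
  by_cases hx : ∃ b, x = ι b
  · obtain ⟨b, rfl⟩ := hx
    simp [hι.eq_iff, h]
  · have : A' (ι a) x = 0 := by
      by_contra hne
      exact hx (h0 x a hne)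
    rw [this, Finset.sum_eq_zero]
    exact fun b _ => by rw [if_neg fun e => hx ⟨b, e⟩, mul_zero]

variable {i j k : α → β}

theorem sum_of_bijective [Fintype α] [Fintype β]
    (h : Function.Bijective (Sum.elim (Sum.elim i j) k)) (f : β → ZMod 2) :
    ∑ x, f x = ∑ a, f (i a) + ∑ a, f (j a) + ∑ a, f (k a) := by
  rw [← Equiv.sum_comp (Equiv.ofBijective _ h) f, Fintype.sum_sum_type, Fintype.sum_sum_type]
  rfl

theorem forall_of_surjective (h : Function.Bijective (Sum.elim (Sum.elim i j) k)) {P : β → Prop}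
    (hi : ∀ a, P (i a)) (hj : ∀ a, P (j a)) (hk : ∀ a, P (k a)) (x : β) : P x := by
  obtain ⟨(a | a) | a, rfl⟩ := h.2 x
  exacts [hi a, hj a, hk a]

theorem ne_of_bijective (h : Function.Bijective (Sum.elim (Sum.elim i j) k)) (a b : α) :
    i a ≠ j b ∧ i a ≠ k b ∧ j a ≠ k b := by
  refine ⟨fun e => ?_, fun e => ?_, fun e => ?_⟩
  · have := h.1 (a₁ := Sum.inl (Sum.inl a)) (a₂ := Sum.inl (Sum.inr b)) e
    simp at this
  · have := h.1 (a₁ := Sum.inl (Sum.inl a)) (a₂ := Sum.inr b) e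
    simp at this
  · have := h.1 (a₁ := Sum.inl (Sum.inr a)) (a₂ := Sum.inr b) e
    simp at this

theorem injective_of_bijective (h : Function.Bijective (Sum.elim (Sum.elim i j) k)) :
    Function.Injective i ∧ Function.Injective j ∧ Function.Injective k := by
  refine ⟨fun a b e => ?_, fun a b e => ?_, fun a b e => ?_⟩
  · simpa using h.1 (a₁ := Sum.inl (Sum.inl a)) (a₂ := Sum.inl (Sum.inl b)) e
  · simpa using h.1 (a₁ := Sum.inl (Sum.inr a)) (a₂ := Sum.inl (Sum.inr b)) e
  · simpa using h.1 (a₁ := Sum.inr a) (a₂ := Sum.inr b) e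

/-- The kernel of the projection to the part `i` is acyclic if the differential maps the part `j`
to the part `k` by the identity, and does not map it to the part `i`. -/
theorem exists_of_projMat_eq_zero [Fintype α] [DecidableEq α] [Fintype β]
    (h : Function.Bijective (Sum.elim (Sum.elim i j) k))
    (hA : A' * A' = 0) (hkj : ∀ a b, A' (k a) (j b) = if a = b then 1 else 0)
    (hij : ∀ a b, A' (i a) (j b) = 0) {v : β → ZMod 2} (hv : (projMat i).mulVec v = 0)
    (hAv : A'.mulVec v = 0) : ∃ u, (projMat i).mulVec u = 0 ∧ A'.mulVec u = v := by
  obtain ⟨-, hinj, -⟩ := injective_of_bijective h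
  have hvi (a : α) : v (i a) = 0 := (projMat_mulVec v a).symm.trans (congrFun hv a)
  -- a vector supported on the part `j` that cancels the components of `v` in the part `k`
  let u := (inclMat j).mulVec fun a => v (k a)
  have hui (a : α) : u (i a) = 0 := inclMat_mulVec_of_ne (fun b => (ne_of_bijective h a b).1) _
  have huj (a : α) : u (j a) = v (k a) := inclMat_mulVec hinj _ a
  have huk (a : α) : u (k a) = 0 :=
    inclMat_mulVec_of_ne (fun b => (ne_of_bijective h b a).2.2.symm) _
  have hmul (x : β) (u : β → ZMod 2) : A'.mulVec u x = ∑ y, A' x y * u y := rfl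
  have hd0 : v - A'.mulVec u = 0 := by
    set v' := v - A'.mulVec u with hv'
    have hAv' : A'.mulVec v' = 0 := by
      rw [hv', Matrix.mulVec_sub, hAv, Matrix.mulVec_mulVec, hA, Matrix.zero_mulVec, sub_zero]
    have h1 (a : α) : v' (i a) = 0 := by
      rw [hv', Pi.sub_apply, hmul, sum_of_bijective h, hvi]
      simp [hui, huk, hij]
    have h3 (a : α) : v' (k a) = 0 := by
      rw [hv', Pi.sub_apply, hmul, sum_of_bijective h]
      simp [hui, huk, hkj, huj]
    have h2 (a : α) : v' (j a) = 0 := by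
      have := congrFun hAv' (k a)
      rw [hmul, sum_of_bijective h] at this
      simpa [h1, h3, hkj] using this
    exact funext fun x => forall_of_surjective h (P := fun x => v' x = 0) h1 h2 h3 x
  refine ⟨u, ?_, (sub_eq_zero.1 hd0).symm⟩
  funext a
  rw [projMat_mulVec, hui]
  rfl

/-- The quotient by the part `j` is acyclic if the differential maps the part `k` to the part `i`
by the identity, and does not map the part `j` to the part `i`. -/
theorem exists_sub_mem_range_inclMat [Fintype α] [DecidableEq α] [Fintype β]
    (h : Function.Bijective (Sum.elim (Sum.elim i j) k))
    (hA : A' * A' = 0) (hik : ∀ a b, A' (i a) (k b) = if a = b then 1 else 0)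
    (hij : ∀ a b, A' (i a) (j b) = 0) {v : β → ZMod 2}
    (hv : ∃ y, (inclMat j).mulVec y = A'.mulVec v) :
    ∃ u y, (inclMat j).mulVec y = v - A'.mulVec u := by
  obtain ⟨-, hinj, hink⟩ := injective_of_bijective h
  have hmul (x : β) (u : β → ZMod 2) : A'.mulVec u x = ∑ y, A' x y * u y := rfl
  -- a vector supported on the part `k` that cancels the components of `v` in the part `i`
  let u := (inclMat k).mulVec fun a => v (i a)
  have hui (a : α) : u (i a) = 0 := inclMat_mulVec_of_ne (fun b => (ne_of_bijective h a b).2.1) _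
  have huj (a : α) : u (j a) = 0 := inclMat_mulVec_of_ne (fun b => (ne_of_bijective h a b).2.2) _
  have huk (a : α) : u (k a) = v (i a) := inclMat_mulVec hink _ a
  set v' := v - A'.mulVec u with hv'
  have hAv' (a : α) : A'.mulVec v' (i a) = 0 := by
    obtain ⟨y, hy⟩ := hv
    rw [hv', Matrix.mulVec_sub, Matrix.mulVec_mulVec, hA, Matrix.zero_mulVec, sub_zero, ← hy]
    exact inclMat_mulVec_of_ne (fun b => (ne_of_bijective h a b).1) _
  have h1 (a : α) : v' (i a) = 0 := by
    rw [hv', Pi.sub_apply, hmul, sum_of_bijective h]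
    simp [hui, huj, hik, huk]
  have h3 (a : α) : v' (k a) = 0 := by
    have := hAv' a
    rw [hmul, sum_of_bijective h] at this
    simpa [h1, hij, hik] using this
  refine ⟨u, fun a => v' (j a), funext fun x => ?_⟩
  revert x
  refine forall_of_surjective h (fun a => ?_) (fun a => ?_) fun a => ?_
  · exact (inclMat_mulVec_of_ne (fun b => (ne_of_bijective h a b).1) _).trans (h1 a).symm
  · exact inclMat_mulVec hinj _ a
  · exact (inclMat_mulVec_of_ne (fun b => (ne_of_bijective h b a).2.2.symm) _).trans (h3 a).symm

end Inclusion

namespace GaussData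

/-! ### Strict homomorphisms between the complexes of diagrams -/

theorem isLInfHom_of_intertwines {G G' : GaussData} {Φ : Matrix G'.Gen G.Gen (ZMod 2)}
    (hΦ : ∀ a, Φ * G.basisAct a = G'.basisAct a * Φ)
    (hdeg : ∀ g' g, Φ g' g ≠ 0 → g'.homDeg = g.homDeg) :
    IsLInfHom Sl2dg.ops G.CKh G'.CKh (strictOps (Matrix.toLin' Φ)) := by
  have hΦ' (a : SlBasis) (m : G.Gen → ZMod 2) :
      Matrix.toLin' Φ (Matrix.toLin' (G.basisAct a) m) =
      Matrix.toLin' (G'.basisAct a) (Matrix.toLin' Φ m) := by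
    rw [← Matrix.toLin'_mul_apply, ← Matrix.toLin'_mul_apply, hΦ]
  refine isLInfHom_strictOps (fun b m hm g' hg' => ?_) fun n x m => ?_
  · obtain ⟨g, -, hg⟩ := Finset.exists_ne_zero_of_sum_ne_zero hg'
    rw [hdeg g' g (left_ne_zero_of_mul hg)]
    exact hm g (right_ne_zero_of_mul hg)
  · match n with
    | 0 => exact hΦ' .d m
    | 1 =>
      have := Sl2dg.lin_ext (f := (LinearMap.lcomp (ZMod 2) _ (Matrix.toLin' Φ)).comp G'.act)
        (g := (LinearMap.compRight (ZMod 2) (Matrix.toLin' Φ)).comp G.act) fun a => by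
          refine LinearMap.ext fun m => ?_
          change G'.act (Sl2dg.basis a) (Matrix.toLin' Φ m) =
            Matrix.toLin' Φ (G.act (Sl2dg.basis a) m)
          rw [act_basis, act_basis, hΦ']
      exact (congrArg (fun f => f (x 0) m) this).symm
    | n + 2 => exact map_zero _

variable {G : GaussData} {p : G.Pt} {w : ZMod 2} {ov pos : Bool}

/-- To commute with all operators, it suffices to commute with those other than `ṽ₀` and `x`, which
are defined as commutators. -/
theorem mul_basisAct_eq {G G' : GaussData} {Φ : Matrix G'.Gen G.Gen (ZMod 2)}
    (he : Φ * G.eAct = G'.eAct * Φ) (hf : Φ * G.fAct = G'.fAct * Φ)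
    (hh : Φ * G.hAct = G'.hAct * Φ) (hp : Φ * G.leePlus = G'.leePlus * Φ)
    (hm : Φ * G.dMinus = G'.dMinus * Φ) (hd : Φ * G.dZero = G'.dZero * Φ)
    (hD : Φ * G.leeZero = G'.leeZero * Φ) (a : SlBasis) :
    Φ * G.basisAct a = G'.basisAct a * Φ := by
  cases a
  case e => exact he
  case f => exact hf
  case h => exact hh
  case v2 => exact hp
  case vm2 => exact hm
  case v0 =>
    change Φ * (G.eAct * G.dMinus - G.dMinus * G.eAct) =
      (G'.eAct * G'.dMinus - G'.dMinus * G'.eAct) * Φ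
    rw [Matrix.mul_sub, Matrix.sub_mul, ← Matrix.mul_assoc, ← Matrix.mul_assoc, he, hm,
      Matrix.mul_assoc, Matrix.mul_assoc, he, hm, Matrix.mul_assoc, Matrix.mul_assoc]
  case d => exact hd
  case D => exact hD
  case x =>
    change Φ * (G.leePlus * G.dMinus + G.dMinus * G.leePlus) =
      (G'.leePlus * G'.dMinus + G'.dMinus * G'.leePlus) * Φ
    rw [Matrix.mul_add, Matrix.add_mul, ← Matrix.mul_assoc, ← Matrix.mul_assoc, hp, hm,
      Matrix.mul_assoc, Matrix.mul_assoc, hp, hm, Matrix.mul_assoc, Matrix.mul_assoc]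

theorem ofRel_congr {G' : GaussData} {r : G.Gen → G.Gen → Prop} {r' : G'.Gen → G'.Gen → Prop}
    {g g₁ : G.Gen} {g' g₁' : G'.Gen} (h : r' g' g₁' ↔ r g g₁) :
    ofRel r' g₁' g' = ofRel r g₁ g := by
  rw [ofRel_apply, ofRel_apply]
  exact if_congr h rfl rfl

section Blocks

variable {merge split : Bool → Bool → Bool → Prop} {a b : Bool} {g g₁ : G.Gen}

theorem differential_kinkGen_iff (h : a ≠ pos) (cond : ℤ → ℤ → Prop) :
    ((∃ c, EdgeTerm merge split c (kinkGen a b g : (G.kink p w ov pos).Gen) (kinkGen a b g₁)) ∧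
      cond (kinkGen a b g₁ : (G.kink p w ov pos).Gen).kDeg
        (kinkGen a b g : (G.kink p w ov pos).Gen).kDeg) ↔
      (∃ c, EdgeTerm merge split c g g₁) ∧ cond g₁.kDeg g.kDeg := by
  rw [exists_edgeTerm_iff h, kDeg_kinkGen, kDeg_kinkGen]

theorem fAct_kinkGen (h : a ≠ pos) :
    (G.kink p w ov pos).fAct (kinkGen a b g₁) (kinkGen a b g) = G.fAct g₁ g := by
  refine ofRel_congr ?_
  rw [fAct_iff, fAct_iff, exists_flip_iff h]
  simp only [kinkGen_injective.eq_iff]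

theorem eAct_kinkGen (h : a ≠ pos) :
    (G.kink p w ov pos).eAct (kinkGen a b g₁) (kinkGen a b g) = G.eAct g₁ g := by
  refine ofRel_congr ?_
  rw [eAct_iff, eAct_iff, exists_flip_iff h]
  simp only [kinkGen_injective.eq_iff]

theorem hAct_kinkGen :
    (G.kink p w ov pos).hAct (kinkGen a b g₁) (kinkGen a b g) = G.hAct g₁ g := by
  unfold hAct
  rw [Matrix.diagonal_apply, Matrix.diagonal_apply, kDeg_kinkGen]
  simp only [kinkGen_injective.eq_iff]

theorem eq_of_hAct_ne_zero {g g' : G.Gen} (h : G.hAct g' g ≠ 0) : g' = g := by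
  by_contra hne
  exact h (Matrix.diagonal_apply_ne _ hne)

theorem exists_eq_kinkGen_of_fAct_ne_zero (h : a ≠ pos) {g' : (G.kink p w ov pos).Gen}
    (hne : (G.kink p w ov pos).fAct g' (kinkGen a b g) ≠ 0) : ∃ g₁, g' = kinkGen a b g₁ := by
  obtain ⟨q, -, -, hq⟩ := (exists_flip_iff h).1 (fAct_iff.1 (ofRel_ne_zero.1 hne))
  exact ⟨_, hq⟩

theorem exists_eq_kinkGen_of_eAct_ne_zero (h : a ≠ pos) {g' : (G.kink p w ov pos).Gen}
    (hne : (G.kink p w ov pos).eAct g' (kinkGen a b g) ≠ 0) : ∃ g₁, g' = kinkGen a b g₁ := by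
  obtain ⟨q, -, -, hq⟩ := (exists_flip_iff h).1 (eAct_iff.1 (ofRel_ne_zero.1 hne))
  exact ⟨_, hq⟩

theorem exists_flip_symm {g g' : G.Gen} {l : Bool}
    (h : ∃ q, circWt g.1 q = 1 ∧ g.label q = l ∧ g' = g.flip q) :
    ∃ q, circWt g'.1 q = 1 ∧ g'.label q = !l ∧ g = g'.flip q := by
  obtain ⟨q, h1, h2, rfl⟩ := h
  exact ⟨q, h1, by rw [Gen.flip_label_of_eq rfl, h2], (g.flip_flip q).symm⟩

theorem exists_eq_kinkGen_of_fAct_ne_zero' (h : a ≠ pos) {g' : (G.kink p w ov pos).Gen}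
    (hne : (G.kink p w ov pos).fAct (kinkGen a b g) g' ≠ 0) : ∃ g₁, g' = kinkGen a b g₁ := by
  obtain ⟨q, -, -, hq⟩ :=
    (exists_flip_iff h).1 (exists_flip_symm (fAct_iff.1 (ofRel_ne_zero.1 hne)))
  exact ⟨_, hq⟩

theorem exists_eq_kinkGen_of_eAct_ne_zero' (h : a ≠ pos) {g' : (G.kink p w ov pos).Gen}
    (hne : (G.kink p w ov pos).eAct (kinkGen a b g) g' ≠ 0) : ∃ g₁, g' = kinkGen a b g₁ := by
  obtain ⟨q, -, -, hq⟩ :=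
    (exists_flip_iff h).1 (exists_flip_symm (eAct_iff.1 (ofRel_ne_zero.1 hne)))
  exact ⟨_, hq⟩

/-- At a negative kink, the generators with the `1`-smoothing of the new crossing and a fixed label
of the new circle are mapped to such generators. -/
theorem EdgeTerm.exists_eq_kinkGen_right {c : (G.kink p w ov false).Cr}
    {g' : (G.kink p w ov false).Gen} (h : EdgeTerm merge split c (kinkGen true b g) g') :
    ∃ g₁, g' = kinkGen true b g₁ := by
  induction c using kink_cr_cases with
  | h1 c =>
    have h1 := h.newCr_eq
    have h2 := h.label_loopEdge (by simp [kinkGen_fst_newCr])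
    rw [kinkGen_fst_newCr] at h1
    rw [kinkGen_label_loopEdge (by decide)] at h2
    refine ⟨oldGen g', (eq_kinkGen_oldGen g').trans ?_⟩
    rw [h1, h2]
  | h2 => exact absurd h.1 (by simp [kinkGen_fst_newCr])

/-- At a positive kink, the generators with the `0`-smoothing of the new crossing and a fixed label
of the new circle are only reached from such generators. -/
theorem EdgeTerm.exists_eq_kinkGen_left {c : (G.kink p w ov true).Cr}
    {g' : (G.kink p w ov true).Gen} (h : EdgeTerm merge split c g' (kinkGen false b g)) :
    ∃ g₁, g' = kinkGen false b g₁ := by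
  induction c using kink_cr_cases with
  | h1 c =>
    have h1 := h.newCr_eq
    rw [kinkGen_fst_newCr] at h1
    have h2 := h.label_loopEdge (by simp [← h1])
    rw [kinkGen_label_loopEdge (by decide)] at h2
    refine ⟨oldGen g', (eq_kinkGen_oldGen g').trans ?_⟩
    rw [← h1, ← h2]
  | h2 =>
    have := congrFun h.2.1 newCr
    rw [Function.update_self, kinkGen_fst_newCr] at this
    exact absurd this (by decide)

/-- The inclusion into the complex of a negative kink commutes with all operators. -/
theorem inclMat_mul_basisAct (b : Bool) (y : SlBasis) :
    inclMat (kinkGen true b : G.Gen → (G.kink p w ov false).Gen) * G.basisAct y =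
      (G.kink p w ov false).basisAct y * inclMat (kinkGen true b) := by
  have hne : true ≠ false := by decide
  refine mul_basisAct_eq ?_ ?_ ?_ ?_ ?_ ?_ ?_ y <;> symm
  · exact mul_inclMat kinkGen_injective (fun _ _ => eAct_kinkGen hne)
      fun _ _ => exists_eq_kinkGen_of_eAct_ne_zero hne
  · exact mul_inclMat kinkGen_injective (fun _ _ => fAct_kinkGen hne)
      fun _ _ => exists_eq_kinkGen_of_fAct_ne_zero hne
  · exact mul_inclMat kinkGen_injective (fun _ _ => hAct_kinkGen)
      fun _ g h => ⟨g, eq_of_hAct_ne_zero h⟩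
  · refine mul_inclMat kinkGen_injective
      (fun _ _ => ofRel_congr (differential_kinkGen_iff hne fun m n => n < m)) fun _ _ h => ?_
    obtain ⟨⟨c, hc⟩, -⟩ := ofRel_ne_zero.1 h
    exact hc.exists_eq_kinkGen_right
  · refine mul_inclMat kinkGen_injective
      (fun _ _ => ofRel_congr (differential_kinkGen_iff hne fun m n => m < n)) fun _ _ h => ?_
    obtain ⟨⟨c, hc⟩, -⟩ := ofRel_ne_zero.1 h
    exact hc.exists_eq_kinkGen_right
  · refine mul_inclMat kinkGen_injective
      (fun _ _ => ofRel_congr (differential_kinkGen_iff hne fun m n => m = n)) fun _ _ h => ?_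
    obtain ⟨⟨c, hc⟩, -⟩ := ofRel_ne_zero.1 h
    exact hc.exists_eq_kinkGen_right
  · refine mul_inclMat kinkGen_injective
      (fun _ _ => ofRel_congr (differential_kinkGen_iff hne fun m n => m = n)) fun _ _ h => ?_
    obtain ⟨⟨c, hc⟩, -⟩ := ofRel_ne_zero.1 h
    exact hc.exists_eq_kinkGen_right

/-- The projection from the complex of a positive kink commutes with all operators. -/
theorem projMat_mul_basisAct (b : Bool) (y : SlBasis) :
    projMat (kinkGen false b : G.Gen → (G.kink p w ov true).Gen) *
      (G.kink p w ov true).basisAct y = G.basisAct y * projMat (kinkGen false b) := by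
  have hne : false ≠ true := by decide
  refine mul_basisAct_eq ?_ ?_ ?_ ?_ ?_ ?_ ?_ y
  · exact projMat_mul kinkGen_injective (fun _ _ => eAct_kinkGen hne)
      fun _ _ => exists_eq_kinkGen_of_eAct_ne_zero' hne
  · exact projMat_mul kinkGen_injective (fun _ _ => fAct_kinkGen hne)
      fun _ _ => exists_eq_kinkGen_of_fAct_ne_zero' hne
  · exact projMat_mul kinkGen_injective (fun _ _ => hAct_kinkGen)
      fun _ g h => ⟨g, (eq_of_hAct_ne_zero h).symm⟩
  · refine projMat_mul kinkGen_injective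
      (fun _ _ => ofRel_congr (differential_kinkGen_iff hne fun m n => n < m)) fun _ _ h => ?_
    obtain ⟨⟨c, hc⟩, -⟩ := ofRel_ne_zero.1 h
    exact hc.exists_eq_kinkGen_left
  · refine projMat_mul kinkGen_injective
      (fun _ _ => ofRel_congr (differential_kinkGen_iff hne fun m n => m < n)) fun _ _ h => ?_
    obtain ⟨⟨c, hc⟩, -⟩ := ofRel_ne_zero.1 h
    exact hc.exists_eq_kinkGen_left
  · refine projMat_mul kinkGen_injective
      (fun _ _ => ofRel_congr (differential_kinkGen_iff hne fun m n => m = n)) fun _ _ h => ?_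
    obtain ⟨⟨c, hc⟩, -⟩ := ofRel_ne_zero.1 h
    exact hc.exists_eq_kinkGen_left
  · refine projMat_mul kinkGen_injective
      (fun _ _ => ofRel_congr (differential_kinkGen_iff hne fun m n => m = n)) fun _ _ h => ?_
    obtain ⟨⟨c, hc⟩, -⟩ := ofRel_ne_zero.1 h
    exact hc.exists_eq_kinkGen_left

end Blocks

/-! ### Invariance under Reidemeister I -/

section Kink

variable {g g₁ : G.Gen}

theorem khMerge_true_left {x z : Bool} : khMerge true x z ↔ z = x := by
  cases x <;> rfl

theorem khMerge_true_right {x z : Bool} : khMerge x true z ↔ z = x := by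
  cases x <;> rfl

theorem khSplit_false_left {x z : Bool} : khSplit x false z ↔ z = x := by
  cases x <;> cases z <;> simp [khSplit]

theorem khSplit_false_right {x y : Bool} : khSplit x y false ↔ y = x := by
  cases x <;> cases y <;> simp [khSplit]

theorem eq_of_label_eq (hg : g.1 = g₁.1) (hp : g.label p = g₁.label p)
    (h : ∀ q, circ g₁.1 q ≠ circ g₁.1 p → g.label q = g₁.label q) : g = g₁ := by
  refine Gen.ext_label hg fun q => ?_
  by_cases e : circ g₁.1 q = circ g₁.1 p
  · have e' : circ g.1 q = circ g.1 p := by rw [hg]; exact e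
    rw [Gen.label_congr e, Gen.label_congr e', hp]
  · exact h q e

theorem eq_of_kinkState_eq_update {s s₁ : G.Cr → Bool}
    (h : (kinkState true s : (G.kink p w ov pos).Cr → Bool) =
      Function.update (kinkState false s₁) newCr true) : s = s₁ := by
  funext c
  have := congrFun h (oldCr c)
  rwa [Function.update_of_ne (oldCr_ne_newCr c)] at this

theorem kinkState_true_eq_update (s : G.Cr → Bool) :
    (kinkState true s : (G.kink p w ov pos).Cr → Bool) =
      Function.update (kinkState false s) newCr true := by
  funext c
  induction c using kink_cr_cases with
  | h1 c =>
    rw [Function.update_of_ne (oldCr_ne_newCr c)]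
    rfl
  | h2 =>
    rw [Function.update_self]
    rfl

/-- The merge map at a positive kink, when the circle inside the kink is labelled by the unit. -/
theorem edgeTerm_newCr_iff_of_merge {split : Bool → Bool → Bool → Prop} {b : Bool} :
    EdgeTerm khMerge split newCr (kinkGen false true g₁ : (G.kink p w ov true).Gen)
      (kinkGen true b g) ↔ g = g₁ := by
  have hne : false ≠ true := by decide
  have hloop : (kinkGen false true g₁ : (G.kink p w ov true).Gen).label loopEdge = true :=
    kinkGen_label_loopEdge hne
  have hloop' : (kinkGen true b g : (G.kink p w ov true).Gen).label loopEdge = g.label p :=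
    Gen.label_congr (circ_loopEdge_of_eq rfl)
  have hcirc (q : G.Pt) : circ (kinkGen false true g₁ : (G.kink p w ov true).Gen).1 loopEdge ≠
      circ (kinkGen false true g₁ : (G.kink p w ov true).Gen).1 (oldEdge q) :=
    circ_loopEdge_ne hne q
  have hcirc' : circ (kinkGen true b g : (G.kink p w ov true).Gen).1 loopEdge =
      circ (kinkGen true b g : (G.kink p w ov true).Gen).1 (oldEdge p) :=
    circ_loopEdge_of_eq rfl
  have hold (q r : G.Pt) : circ (kinkGen false true g₁ : (G.kink p w ov true).Gen).1 (oldEdge q) =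
      circ (kinkGen false true g₁ : (G.kink p w ov true).Gen).1 (oldEdge r) ↔
      circ g₁.1 q = circ g₁.1 r := circ_oldEdge_iff
  unfold EdgeTerm
  rw [kink_inEdge_newCr, kink_outEdge_newCr]
  constructor
  · rintro ⟨-, hs, h1, h2⟩
    refine eq_of_label_eq (p := p) (eq_of_kinkState_eq_update hs) ?_ fun q hq => ?_
    · cases ov
      · simp only [Bool.xor_false, if_true, circ_exitEdge, hcirc', hloop, hloop',
          kinkGen_label_exitEdge, khMerge_true_left, ne_eq, not_true, false_and, and_false,
          or_false] at h2
        exact h2.2.2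
      · simp only [Bool.xor_true, Bool.not_true, Bool.false_eq_true, if_false, hcirc', hloop,
          kinkGen_label_oldEdge, khMerge_true_right, ne_eq, not_true, false_and, and_false,
          or_false] at h2
        exact h2.2.2
    · refine h1 (oldEdge q) ?_ ?_
      · cases ov
        · exact (hcirc q).symm
        · exact (hold q p).not.2 hq
      · cases ov
        · exact fun e => hq ((hold q p).1 (e.trans circ_exitEdge))
        · exact (hcirc q).symm
  · rintro rfl
    refine ⟨rfl, kinkState_true_eq_update _, fun x => ?_, Or.inl ?_⟩
    · induction x using kink_edge_cases with
      | h1 q => exact fun _ _ => rfl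
      | h2 =>
        cases ov
        · exact fun h _ => absurd rfl h
        · exact fun _ h => absurd rfl h
      | h3 => exact fun _ _ => rfl
    · cases ov
      · simp only [Bool.xor_false, if_true, circ_exitEdge, hcirc', hloop, hloop',
          kinkGen_label_exitEdge, khMerge_true_left]
        exact ⟨hcirc p, trivial, trivial⟩
      · simp only [Bool.xor_true, Bool.not_true, Bool.false_eq_true, if_false, hcirc', hloop,
          kinkGen_label_oldEdge, khMerge_true_right]
        exact ⟨(hcirc p).symm, trivial, trivial⟩

/-- The component of the split map at a negative kink whose value on the circle inside the kink is
`-`. -/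
theorem edgeTerm_newCr_iff_of_split {merge : Bool → Bool → Bool → Prop} {b : Bool} :
    EdgeTerm merge khSplit newCr (kinkGen false b g₁ : (G.kink p w ov false).Gen)
      (kinkGen true false g) ↔ g = g₁ := by
  have hne : true ≠ false := by decide
  have hloop : (kinkGen true false g : (G.kink p w ov false).Gen).label loopEdge = false :=
    kinkGen_label_loopEdge hne
  have hloop' : (kinkGen false b g₁ : (G.kink p w ov false).Gen).label loopEdge = g₁.label p :=
    Gen.label_congr (circ_loopEdge_of_eq rfl)
  have hcirc (q : G.Pt) : circ (kinkGen true false g : (G.kink p w ov false).Gen).1 loopEdge ≠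
      circ (kinkGen true false g : (G.kink p w ov false).Gen).1 (oldEdge q) :=
    circ_loopEdge_ne hne q
  have hcirc' : circ (kinkGen false b g₁ : (G.kink p w ov false).Gen).1 loopEdge =
      circ (kinkGen false b g₁ : (G.kink p w ov false).Gen).1 (oldEdge p) :=
    circ_loopEdge_of_eq rfl
  have hold (q r : G.Pt) : circ (kinkGen false b g₁ : (G.kink p w ov false).Gen).1 (oldEdge q) =
      circ (kinkGen false b g₁ : (G.kink p w ov false).Gen).1 (oldEdge r) ↔
      circ g₁.1 q = circ g₁.1 r := circ_oldEdge_iff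
  unfold EdgeTerm
  rw [kink_inEdge_newCr, kink_outEdge_newCr]
  constructor
  · rintro ⟨-, hs, h1, h2⟩
    refine eq_of_label_eq (p := p) (eq_of_kinkState_eq_update hs) ?_ fun q hq => ?_
    · cases ov
      · simp only [Bool.xor_false, if_true, circ_exitEdge, hcirc', hloop, hloop',
          kinkGen_label_exitEdge, khSplit_false_left, ne_eq, not_true, false_and, false_or] at h2
        exact h2.2.2
      · simp only [Bool.xor_true, Bool.not_true, Bool.false_eq_true, if_false, hcirc', hloop,
          kinkGen_label_oldEdge, khSplit_false_right, ne_eq, not_true, false_and, false_or] at h2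
        exact h2.2.2
    · have hq' := (hold q p).not.2 hq
      refine h1 (oldEdge q) ?_ ?_
      · cases ov
        · exact fun e => hq' (e.trans hcirc')
        · exact hq'
      · cases ov
        · exact fun e => hq' (e.trans circ_exitEdge)
        · exact fun e => hq' (e.trans hcirc')
  · rintro rfl
    refine ⟨rfl, kinkState_true_eq_update _, fun x => ?_, Or.inr ?_⟩
    · induction x using kink_edge_cases with
      | h1 q => exact fun _ _ => rfl
      | h2 =>
        cases ov
        · exact fun h _ => absurd rfl h
        · exact fun _ h => absurd rfl h
      | h3 => exact fun _ _ => rfl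
    · cases ov
      · simp only [Bool.xor_false, if_true, circ_exitEdge, hcirc', hloop, hloop',
          kinkGen_label_exitEdge, khSplit_false_left]
        exact ⟨trivial, hcirc p, trivial⟩
      · simp only [Bool.xor_true, Bool.not_true, Bool.false_eq_true, if_false, hcirc', hloop,
          kinkGen_label_oldEdge, khSplit_false_right]
        exact ⟨trivial, (hcirc p).symm, trivial⟩

/-- The generators of the complex of a kink fall into three copies of those of the complex without
the kink: two, distinguished by the label of the circle inside the kink, where the new crossing is
smoothed so that there is such a circle, and one where it is smoothed the other way. -/
theorem bijective_kinkGen : Function.Bijective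
    (Sum.elim (Sum.elim (kinkGen (!pos) false) (kinkGen (!pos) true)) (kinkGen pos false) :
      (G.Gen ⊕ G.Gen) ⊕ G.Gen → (G.kink p w ov pos).Gen) := by
  have hne : (!pos) ≠ pos := by cases pos <;> decide
  have hcr {a b a' b' : Bool} {g g₁ : G.Gen}
      (h : (kinkGen a b g : (G.kink p w ov pos).Gen) = kinkGen a' b' g₁) : a = a' :=
    congrArg (fun k : (G.kink p w ov pos).Gen => k.1 newCr) h
  have hlab {b b' : Bool} {g g₁ : G.Gen}
      (h : (kinkGen (!pos) b g : (G.kink p w ov pos).Gen) = kinkGen (!pos) b' g₁) : b = b' := by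
    have := congrArg (fun k : (G.kink p w ov pos).Gen => k.label loopEdge) h
    rwa [kinkGen_label_loopEdge hne, kinkGen_label_loopEdge hne] at this
  constructor
  · rintro ((g | g) | g) ((g₁ | g₁) | g₁) h
    · exact congrArg _ (congrArg _ (kinkGen_injective h))
    · exact absurd (hlab h) (by decide)
    · exact absurd (hcr h) hne
    · exact absurd (hlab h) (by decide)
    · exact congrArg _ (congrArg _ (kinkGen_injective h))
    · exact absurd (hcr h) hne
    · exact absurd (hcr h) hne.symm
    · exact absurd (hcr h) hne.symm
    · exact congrArg _ (kinkGen_injective h)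
  · intro g
    by_cases h : g.1 newCr = pos
    · refine ⟨Sum.inr (oldGen g), ?_⟩
      refine Eq.trans ?_ (eq_kinkGen_oldGen g).symm
      rw [h]
      exact kinkGen_of_eq _ _ _
    · have h' : g.1 newCr = !pos := Bool.eq_not.2 h
      cases hb : g.label loopEdge
      · refine ⟨Sum.inl (Sum.inl (oldGen g)), ?_⟩
        refine Eq.trans ?_ (eq_kinkGen_oldGen g).symm
        rw [h', hb]
        rfl
      · refine ⟨Sum.inl (Sum.inr (oldGen g)), ?_⟩
        refine Eq.trans ?_ (eq_kinkGen_oldGen g).symm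
        rw [h', hb]
        rfl

theorem dZero_kinkGen_eq_zero :
    (G.kink p w ov pos).dZero (kinkGen (!pos) false g) (kinkGen (!pos) true g₁) = 0 := by
  have hne : (!pos) ≠ pos := by cases pos <;> decide
  by_contra h
  obtain ⟨⟨c, hc⟩, -⟩ := ofRel_ne_zero.1 h
  induction c using kink_cr_cases with
  | h1 c =>
    have := hc.label_loopEdge hne
    rw [kinkGen_label_loopEdge hne, kinkGen_label_loopEdge hne] at this
    exact absurd this (by decide)
  | h2 => exact update_ne hc.1 hc.2.1 rfl

theorem exists_edgeTerm_newCr_iff {merge split : Bool → Bool → Bool → Prop} {b b' : Bool} :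
    (∃ c, EdgeTerm merge split c (kinkGen false b g₁ : (G.kink p w ov pos).Gen)
      (kinkGen true b' g)) ↔ EdgeTerm merge split newCr
        (kinkGen false b g₁ : (G.kink p w ov pos).Gen) (kinkGen true b' g) := by
  refine ⟨?_, fun h => ⟨_, h⟩⟩
  rintro ⟨c, hc⟩
  induction c using kink_cr_cases with
  | h1 c => exact absurd hc.newCr_eq (by decide : true ≠ false)
  | h2 => exact hc

theorem dZero_kinkGen_of_positive (g g₁ : G.Gen) :
    (G.kink p w ov true).dZero (kinkGen true false g) (kinkGen false true g₁) =
      if g = g₁ then 1 else 0 := by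
  have key : ((∃ c, EdgeTerm khMerge khSplit c
      (kinkGen false true g₁ : (G.kink p w ov true).Gen) (kinkGen true false g)) ∧
      (kinkGen true false g : (G.kink p w ov true).Gen).kDeg =
        (kinkGen false true g₁ : (G.kink p w ov true).Gen).kDeg) ↔ g = g₁ := by
    rw [exists_edgeTerm_newCr_iff, edgeTerm_newCr_iff_of_merge, kDeg_kinkGen, kDeg_kinkGen]
    exact ⟨fun h => h.1, fun h => ⟨h, by rw [h]⟩⟩
  by_cases h : g = g₁
  · rw [if_pos h]
    exact if_pos (key.2 h)
  · rw [if_neg h]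
    exact if_neg (mt key.1 h)

theorem dZero_kinkGen_of_negative (g g₁ : G.Gen) :
    (G.kink p w ov false).dZero (kinkGen true false g) (kinkGen false false g₁) =
      if g = g₁ then 1 else 0 := by
  have key : ((∃ c, EdgeTerm khMerge khSplit c
      (kinkGen false false g₁ : (G.kink p w ov false).Gen) (kinkGen true false g)) ∧
      (kinkGen true false g : (G.kink p w ov false).Gen).kDeg =
        (kinkGen false false g₁ : (G.kink p w ov false).Gen).kDeg) ↔ g = g₁ := by
    rw [exists_edgeTerm_newCr_iff, edgeTerm_newCr_iff_of_split, kDeg_kinkGen, kDeg_kinkGen]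
    exact ⟨fun h => h.1, fun h => ⟨h, by rw [h]⟩⟩
  by_cases h : g = g₁
  · rw [if_pos h]
    exact if_pos (key.2 h)
  · rw [if_neg h]
    exact if_neg (mt key.1 h)

theorem dZero_mulVec_dZero (m : G.Gen → ZMod 2) :
    Matrix.toLin' G.dZero (Matrix.toLin' G.dZero m) = 0 := by
  rw [← Matrix.toLin'_mul_apply, G.khovanov_relations.1, map_zero, LinearMap.zero_apply]

/-- For a positive kink, the projection to the generators with a circle labelled `-` inside the
kink is a quasi-isomorphism. -/
theorem exists_isLInfQuasiIso_of_positive (G : GaussData) (p : G.Pt) (w : ZMod 2) (ov : Bool) :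
    ∃ h, IsLInfQuasiIso Sl2dg.ops (G.kink p w ov true).CKh G.CKh h := by
  let Φ := projMat (kinkGen false false : G.Gen → (G.kink p w ov true).Gen)
  have hΦ := projMat_mul_basisAct (G := G) (p := p) (w := w) (ov := ov) false
  refine ⟨strictOps (Matrix.toLin' Φ), isLInfHom_of_intertwines hΦ ?_, fun m => ?_, ?_⟩
  · intro g g' h
    have : g' = kinkGen false false g := by
      by_contra hne
      exact h (if_neg hne)
    rw [this, homDeg_kinkGen (by decide)]
  · change Matrix.toLin' Φ (Matrix.toLin' _ m) = Matrix.toLin' _ (Matrix.toLin' Φ m)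
    rw [← Matrix.toLin'_mul_apply, ← Matrix.toLin'_mul_apply]
    exact congrArg (fun A => Matrix.toLin' A m) (hΦ .d)
  · refine bijective_homologyMap_of_surjective (Matrix.toLin' Φ) _ dZero_mulVec_dZero
      (fun v => ⟨(inclMat (kinkGen false false)).mulVec v, funext fun g => ?_⟩) fun m h1 h2 => ?_
    · exact (projMat_mulVec _ _).trans (inclMat_mulVec kinkGen_injective v g)
    · exact exists_of_projMat_eq_zero (bijective_kinkGen (pos := true))
        (G.kink p w ov true).khovanov_relations.1
        dZero_kinkGen_of_positive
        (fun _ _ => dZero_kinkGen_eq_zero) h1 h2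

/-- For a negative kink, the inclusion of the generators with a circle labelled `+` inside the
kink is a quasi-isomorphism. -/
theorem exists_isLInfQuasiIso_of_negative (G : GaussData) (p : G.Pt) (w : ZMod 2) (ov : Bool) :
    ∃ h, IsLInfQuasiIso Sl2dg.ops G.CKh (G.kink p w ov false).CKh h := by
  let Φ := inclMat (kinkGen true true : G.Gen → (G.kink p w ov false).Gen)
  have hΦ := inclMat_mul_basisAct (G := G) (p := p) (w := w) (ov := ov) true
  refine ⟨strictOps (Matrix.toLin' Φ), isLInfHom_of_intertwines hΦ ?_, fun m => ?_, ?_⟩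
  · intro g' g h
    have : g' = kinkGen true true g := by
      by_contra hne
      exact h (if_neg hne)
    rw [this, homDeg_kinkGen (by decide)]
  · change Matrix.toLin' Φ (Matrix.toLin' _ m) = Matrix.toLin' _ (Matrix.toLin' Φ m)
    rw [← Matrix.toLin'_mul_apply, ← Matrix.toLin'_mul_apply]
    exact congrArg (fun A => Matrix.toLin' A m) (hΦ .d)
  · refine bijective_homologyMap_of_injective (Matrix.toLin' Φ) _ dZero_mulVec_dZero
      (fun v v' h => funext fun g => ?_) fun v h => ?_
    · have := congrFun h (kinkGen true true g)
      exact (inclMat_mulVec kinkGen_injective v g).symm.trans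
        (this.trans (inclMat_mulVec kinkGen_injective v' g))
    · exact exists_sub_mem_range_inclMat (bijective_kinkGen (pos := false))
        (G.kink p w ov false).khovanov_relations.1
        dZero_kinkGen_of_negative
        (fun _ _ => dZero_kinkGen_eq_zero) h

end Kink

end GaussData

end AnnularKh

end

theorem mainTheorem6 (L : AnnularKh.AnnularDiagram) (p : L.Pt) (w : ZMod 2) (overFirst : Bool) :
    AnnularKh.IsLInfModule AnnularKh.Sl2dg.ops L.CKh ∧
    (∀ pos : Bool, AnnularKh.IsLInfModule AnnularKh.Sl2dg.ops (L.kink p w overFirst pos).CKh) ∧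
    (∃ h, AnnularKh.IsLInfQuasiIso AnnularKh.Sl2dg.ops
      (L.kink p w overFirst true).CKh L.CKh h) ∧
    (∃ h, AnnularKh.IsLInfQuasiIso AnnularKh.Sl2dg.ops
      L.CKh (L.kink p w overFirst false).CKh h) :=
  ⟨AnnularKh.GaussData.isLInfModule_CKh _, fun _ => AnnularKh.GaussData.isLInfModule_CKh _,
    AnnularKh.GaussData.exists_isLInfQuasiIso_of_positive _ p w overFirst,
    AnnularKh.GaussData.exists_isLInfQuasiIso_of_negative _ p w overFirst⟩
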